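/- **Setting.** Let $m,n,u,v$ be non-negative integers with $m+n>0$ and $u+v>0$. Let $\mathbf B_{m|n}=\{\overline m<\cdots<\overline 1<1<\cdots<n\}$, with degrees $|b|=0$ for $b\in\mathbf B^+_{m|n}=\{\overline m,\dots,\overline 1\}$ and $|b|=1$ for $b\in\mathbf B^-_{m|n}=\{1,\dots,n\}$. Let $P_{m|n}=\bigoplus_{b}\mathbb Z\epsilon_b$ with the form $(\epsilon_b,\epsilon_{b'})=(-1)^{|b|}\delta_{bb'}$. Let $I_{m|n}=\{\overline{m-1},\dots,\overline1,0,1,\dots,n-1\}$, where $0$ is present only if $m,n>0$. Put $\alpha_{\overline k}=\epsilon_{\overline{k+1}}-\epsilon_{\overline k}$, $\alpha_0=\epsilon_{\overline1}-\epsilon_1$, $\alpha_l=\epsilon_l-\epsilon_{l+1}$, and $\langle h_i,\lambda\rangle=(\alpha_i,\lambda)$ for $i=\overline{m-1},\dots,\overline1,0$, $\langle h_i,\lambda\rangle=-(\alpha_i,\lambda)$ for $i=1,\dots,n-1$. **Crystals.** A $\mathfrak{gl}_{m|n}$-crystal is a set $B$ with maps $\mathrm{wt}:B\to P_{m|n}$,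 $\varepsilon_i,\varphi_i:B\to\mathbb Z_{\ge0}$, $e_i,f_i:B\to B\cup\{0\}$ $(i\in I_{m|n})$ such that for all $b,b'\in B$: (a) $\varphi_i(b)-\varepsilon_i(b)=\langle h_i,\mathrm{wt}(b)\rangle$ for $i\ne0$; $\langle h_0,\mathrm{wt}(b)\rangle\ge0$, and $\varphi_0(b)+\varepsilon_0(b)$ is $0$ if $\langle h_0,\mathrm{wt}(b)\rangle=0$ and $1$ otherwise; (b) if $e_ib\in B$, then $\varepsilon_i(e_ib)=\varepsilon_i(b)-1$, $\varphi_i(e_ib)=\varphi_i(b)+1$, $\mathrm{wt}(e_ib)=\mathrm{wt}(b)+\alpha_i$; (c) if $f_ib\in B$, then $\varepsilon_i(f_ib)=\varepsilon_i(b)+1$, $\varphi_i(f_ib)=\varphi_i(b)-1$, $\mathrm{wt}(f_ib)=\mathrm{wt}(b)-\alpha_i$; (d) $f_ib=b'$ if and only if $b=e_ib'$. A $(\mathfrak{gl}_{m|n},\mathfrak{gl}_{u|v})$-bicrystal is a set that is a crystal for both, with operators $e_i,f_i$ $(i\in I_{m|n})$ and $e_j^*,f_j^*$ $(j\in I_{u|v})$,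 such that each of $e_i,f_i$ commutes with each of $e_j^*,f_j^*$ as maps of $B\cup\{0\}$ fixing $0$. Its connected components are those of the graph with edges $b\to f_ib$ and $b\to f_j^*b$ (for non-zero images). An isomorphism of bicrystals is a bijection that preserves both weights and all $\varepsilon_i,\varphi_i,\varepsilon_j^*,\varphi_j^*$ and commutes with $e_i,f_i,e_j^*,f_j^*$ (where $0\mapsto0$). **Words.** $\mathbf B_{m|n}$ is the crystal $\overline m\to\cdots\to\overline1\to1\to\cdots\to n$, the arrows being coloured $\overline{m-1},\dots,\overline1,0,1,\dots,n-1$ in this order, with $\mathrm{wt}(b)=\epsilon_b$ and with $\varepsilon_i(b)$ (resp. $\varphi_i(b)$) the number of $i$-arrows into (resp. out of) $b$. A tensor product $b_1\otimes b_2$ has weight $\mathrm{wt}(b_1)+\mathrm{wt}(b_2)$, and, with $h_i(b)=\langle h_i,\mathrm{wt}(b)\rangle$ and $0\otimes b_2=b_1\otimes0=0$: * for barred $i$: $\varepsilon_i=\max(\varepsilon_i(b_1),\varepsilon_i(b_2)-h_i(b_1))$, $\varphi_i=\max(\varphi_i(b_1)+h_i(b_2),\varphi_i(b_2))$; $e_i$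 acts on $b_1$ if $\varphi_i(b_1)\ge\varepsilon_i(b_2)$ and on $b_2$ otherwise; $f_i$ acts on $b_1$ if $\varphi_i(b_1)>\varepsilon_i(b_2)$ and on $b_2$ otherwise; * for $i=1,\dots,n-1$: $\varepsilon_i=\max(\varepsilon_i(b_1)-h_i(b_2),\varepsilon_i(b_2))$, $\varphi_i=\max(\varphi_i(b_1),\varphi_i(b_2)+h_i(b_1))$; $e_i$ acts on $b_1$ if $\varphi_i(b_2)<\varepsilon_i(b_1)$ and on $b_2$ otherwise; $f_i$ acts on $b_1$ if $\varphi_i(b_2)\le\varepsilon_i(b_1)$ and on $b_2$ otherwise; * for $i=0$: $\varepsilon_0,\varphi_0,e_0,f_0$ are those of $b_1$ if $h_0(b_1)>0$ and those of $b_2$ if $h_0(b_1)=0$. The set $\mathcal W_{m|n}$ of finite words in $\mathbf B_{m|n}$ carries the structure obtained from $w_1\cdots w_r=w_1\otimes\cdots\otimes w_r$; the empty word has weight $0$ and is killed by all $e_i,f_i$, with $\varepsilon_i=\varphi_i=0$. **Tableaux.** $\mathcal P_{m|n}$ is the set of partitions $\lambda$ with $\lambda_{m+1}\le n$. For $\lambda\in\mathcal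 P_{m|n}$, $\mathbf B_{m|n}(\lambda)$ is the set of fillings of the Young diagram of $\lambda$ with letters of $\mathbf B_{m|n}$ whose rows and columns increase weakly, with letters of $\mathbf B^+_{m|n}$ strictly increasing in columns and letters of $\mathbf B^-_{m|n}$ strictly increasing in rows. Its crystal structure comes from $\mathcal W_{m|n}$ through the reading of a tableau column by column from right to left, each column from top to bottom. On $\mathbf B_{m|n}(\lambda)\times\mathbf B_{u|v}(\mu)$, the maps for $\mathfrak{gl}_{m|n}$ are those of the first factor and the maps for $\mathfrak{gl}_{u|v}$ those of the second. The tableau $T\leftarrow b$ is obtained by column bumping: in the first column, $b$ replaces the smallest entry $b'$ with $b'\ge b$ (if $|b|=0$) or $b'>b$ (if $|b|=1$), in its highest position, and $b'$ is inserted in the same way into the next column; if there is no such entry, $b$ is put at the bottom of the column. Put $P(w_1\cdots w_r)=(\cdots(w_1\leftarrow w_2)\cdots)\leftarrow w_r$, with $P(\emptyset)=\emptyset$. **Matrices.** Let $\mathbf M^\sharp$ be the set of matrices $A=(a_{bb'})_{b\in\mathbf B_{m|n},\,b'\in\mathbf B_{u|v}}$ of non-negative integers with $a_{bb'}\le1$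 whenever $|b|=|b'|$. Consider the strict linear orders on $\mathbf B_{m|n}\times\mathbf B_{u|v}$ * $(i,j)\prec(k,l)$ iff $j<l$, or $j=l\in\mathbf B^+_{u|v}$ and $i<k$, or $j=l\in\mathbf B^-_{u|v}$ and $i>k$; * $(i,j)\prec'(k,l)$ iff $i>k$, or $i=k\in\mathbf B^+_{m|n}$ and $j<l$, or $i=k\in\mathbf B^-_{m|n}$ and $j>l$. Let $\Omega^\sharp$ (resp. $(\Omega^\sharp)^*$) be the set of pairs $(\mathbf i,\mathbf j)\in\mathcal W_{m|n}\times\mathcal W_{u|v}$ of words of equal length for which the sequence $(i_1,j_1),\dots,(i_r,j_r)$ increases weakly for $\prec$ (resp. $\prec'$) and pairs with $|i_k|=|j_k|$ are not repeated. Counting the occurrences of each pair $(b,b')$ gives bijections $\Omega^\sharp\to\mathbf M^\sharp$ and $(\Omega^\sharp)^*\to\mathbf M^\sharp$, both written $(\mathbf i,\mathbf j)\mapsto A(\mathbf i,\mathbf j)$. Through the first one, $\mathbf M^\sharp$ gets operators $e_i,f_i$ with $x_i(\mathbf i,\mathbf j)=(x_i\mathbf i,\mathbf j)$ and the functions $\mathrm{wt},\varepsilon_i,\varphi_i$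 of $\mathbf i$, for $i\in I_{m|n}$; through the second one it gets operators $e^*_j,f^*_j$ with $x^*_j(\mathbf k,\mathbf l)=(\mathbf k,x_j\mathbf l)$ and the functions $\mathrm{wt},\varepsilon_j,\varphi_j$ of $\mathbf l$, for $j\in I_{u|v}$. For $A=A(\mathbf i,\mathbf j)=A(\mathbf k,\mathbf l)$ with $(\mathbf i,\mathbf j)\in\Omega^\sharp$ and $(\mathbf k,\mathbf l)\in(\Omega^\sharp)^*$, put $\pi^\sharp(A)=(P(\mathbf i),P(\mathbf l))$. **Proposition.** $\mathbf M^\sharp$ is a $(\mathfrak{gl}_{m|n},\mathfrak{gl}_{u|v})$-bicrystal, and for each connected component $\mathbf C$ of $\mathbf M^\sharp$ there are $\lambda\in\mathcal P_{m|n}$ and $\mu\in\mathcal P_{u|v}$ such that $\pi^\sharp$ restricts to an isomorphism of $(\mathfrak{gl}_{m|n},\mathfrak{gl}_{u|v})$-bicrystals $$\pi^\sharp:\mathbf C\longrightarrow\mathbf B_{m|n}(\lambda)\times\mathbf B_{u|v}(\mu).$$ -/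

import Mathlib

/-! Crystal graphs for the general linear Lie superalgebra `gl_{m|n}`, words, hook tableaux, and the
two crystal structures on the matrices that index the super exterior algebra. -/

namespace SuperCrystal

section Letters

/-- The letters `m̄ < ⋯ < 1̄ < 1 < ⋯ < n`, numbered increasingly: `p̄` is the letter `m - p`
and `p` is the letter `m + p - 1`. -/
abbrev Letter (m n : ℕ) : Type := Fin (m + n)

/-- The Dynkin nodes: `i` joins the consecutive letters `i` and `i + 1`. It is a barred node
if `i + 1 < m`, the odd node `0` if `i + 1 = m`, and an unbarred positive node if `m < i + 1`.
(The node `0` is present only if `m` and `n` are both positive.) -/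
abbrev Node (m n : ℕ) : Type := Fin (m + n - 1)

/-- The weight lattice, with `ε_b = Pi.single b 1`. -/
abbrev Weight (m n : ℕ) : Type := Letter m n → ℤ

variable {m n : ℕ}

/-- The degree `|b|`: `0` for barred letters and `1` for the others. -/
def deg (b : Letter m n) : ℕ := if b.val < m then 0 else 1

/-- The left end of the arrow of colour `i` in the crystal of letters. -/
def src (i : Node m n) : Letter m n := ⟨i.val, by omega⟩

/-- The right end of the arrow of colour `i` in the crystal of letters. -/
def tgt (i : Node m n) : Letter m n := ⟨i.val + 1, by omega⟩

/-- The symmetric form with `(ε_b, ε_{b'}) = (-1)^{|b|} δ_{b b'}`. -/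
def form (x y : Weight m n) : ℤ := ∑ b, (-1) ^ deg b * x b * y b

/-- The simple root `α_i`. -/
def root (i : Node m n) : Weight m n := Pi.single (src i) 1 - Pi.single (tgt i) 1

/-- The pairing `⟨h_i, x⟩` with the simple coroot `h_i`. -/
def coroot (i : Node m n) (x : Weight m n) : ℤ :=
  if m < i.val + 1 then -form (root i) x else form (root i) x

end Letters

section Crystals

/-- The maps of a crystal graph; `none` is the formal symbol `0`. -/
structure CrystalData (m n : ℕ) (B : Type*) where
  wt : B → Weight m n
  eps : Node m n → B → ℕ
  phi : Node m n → B → ℕ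
  e : Node m n → B → Option B
  f : Node m n → B → Option B

variable {m n u v : ℕ} {B B' : Type*}

/-- The axioms of a crystal graph for `gl_{m|n}`. -/
structure CrystalData.IsCrystal (X : CrystalData m n B) : Prop where
  phi_sub_eps : ∀ i b, i.val + 1 ≠ m → (X.phi i b : ℤ) - X.eps i b = coroot i (X.wt b)
  coroot_zero_nonneg : ∀ i b, i.val + 1 = m → 0 ≤ coroot i (X.wt b)
  phi_add_eps_of_eq : ∀ i b, i.val + 1 = m → coroot i (X.wt b) = 0 → X.phi i b + X.eps i b = 0
  phi_add_eps_of_pos : ∀ i b, i.val + 1 = m → 0 < coroot i (X.wt b) → X.phi i b + X.eps i b = 1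
  eps_e : ∀ i b b', X.e i b = some b' → (X.eps i b' : ℤ) = X.eps i b - 1
  phi_e : ∀ i b b', X.e i b = some b' → X.phi i b' = X.phi i b + 1
  wt_e : ∀ i b b', X.e i b = some b' → X.wt b' = X.wt b + root i
  eps_f : ∀ i b b', X.f i b = some b' → X.eps i b' = X.eps i b + 1
  phi_f : ∀ i b b', X.f i b = some b' → (X.phi i b' : ℤ) = X.phi i b - 1
  wt_f : ∀ i b b', X.f i b = some b' → X.wt b' = X.wt b - root i
  f_iff_e : ∀ i b b', X.f i b = some b' ↔ X.e i b' = some b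

/-- The tensor product of crystal graphs. -/
def CrystalData.tensor (X : CrystalData m n B) (Y : CrystalData m n B') :
    CrystalData m n (B × B') where
  wt p := X.wt p.1 + Y.wt p.2
  eps i p :=
    if i.val + 1 < m then (max (X.eps i p.1 : ℤ) (Y.eps i p.2 - coroot i (X.wt p.1))).toNat
    else if m < i.val + 1 then (max (X.eps i p.1 - coroot i (Y.wt p.2)) (Y.eps i p.2 : ℤ)).toNat
    else if 0 < coroot i (X.wt p.1) then X.eps i p.1 else Y.eps i p.2
  phi i p :=
    if i.val + 1 < m then (max (X.phi i p.1 + coroot i (Y.wt p.2)) (Y.phi i p.2 : ℤ)).toNat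
    else if m < i.val + 1 then (max (X.phi i p.1 : ℤ) (Y.phi i p.2 + coroot i (X.wt p.1))).toNat
    else if 0 < coroot i (X.wt p.1) then X.phi i p.1 else Y.phi i p.2
  e i p :=
    if (i.val + 1 < m ∧ Y.eps i p.2 ≤ X.phi i p.1) ∨ (m < i.val + 1 ∧ Y.phi i p.2 < X.eps i p.1) ∨
        (i.val + 1 = m ∧ 0 < coroot i (X.wt p.1))
    then (X.e i p.1).map (fun b => (b, p.2))
    else (Y.e i p.2).map (fun b => (p.1, b))
  f i p :=
    if (i.val + 1 < m ∧ Y.eps i p.2 < X.phi i p.1) ∨ (m < i.val + 1 ∧ Y.phi i p.2 ≤ X.eps i p.1) ∨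
        (i.val + 1 = m ∧ 0 < coroot i (X.wt p.1))
    then (X.f i p.1).map (fun b => (b, p.2))
    else (Y.f i p.2).map (fun b => (p.1, b))

/-- Transport of structure along a bijection. -/
def CrystalData.transport (X : CrystalData m n B) (φ : B ≃ B') : CrystalData m n B' where
  wt b := X.wt (φ.symm b)
  eps i b := X.eps i (φ.symm b)
  phi i b := X.phi i (φ.symm b)
  e i b := (X.e i (φ.symm b)).map φ
  f i b := (X.f i (φ.symm b)).map φ

/-- The operators of the first factor, acting on `B × B'`. -/
def CrystalData.onFst (X : CrystalData m n B) (B' : Type*) : CrystalData m n (B × B') where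
  wt p := X.wt p.1
  eps i p := X.eps i p.1
  phi i p := X.phi i p.1
  e i p := (X.e i p.1).map (fun b => (b, p.2))
  f i p := (X.f i p.1).map (fun b => (b, p.2))

/-- The operators of the second factor, acting on `B × B'`. -/
def CrystalData.onSnd (B : Type*) (Y : CrystalData u v B') : CrystalData u v (B × B') where
  wt p := Y.wt p.2
  eps i p := Y.eps i p.2
  phi i p := Y.phi i p.2
  e i p := (Y.e i p.2).map (fun b => (p.1, b))
  f i p := (Y.f i p.2).map (fun b => (p.1, b))

/-- Two partial maps commute as maps of `B ∪ {0}` that fix `0`. -/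
def PartialCommute (p q : B → Option B) : Prop := ∀ b, (p b).bind q = (q b).bind p

/-- `B` is a `(gl_{m|n}, gl_{u|v})`-bicrystal. -/
structure IsBicrystal (X : CrystalData m n B) (Y : CrystalData u v B) : Prop where
  fst : X.IsCrystal
  snd : Y.IsCrystal
  e_e : ∀ i j, PartialCommute (X.e i) (Y.e j)
  e_f : ∀ i j, PartialCommute (X.e i) (Y.f j)
  f_e : ∀ i j, PartialCommute (X.f i) (Y.e j)
  f_f : ∀ i j, PartialCommute (X.f i) (Y.f j)

/-- The arrows of the coloured graph of a bicrystal, with the colours forgotten. -/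
def Arrow (X : CrystalData m n B) (Y : CrystalData u v B) (b b' : B) : Prop :=
  (∃ i, X.f i b = some b') ∨ ∃ j, Y.f j b = some b'

/-- `C` is a connected component of the graph of a bicrystal (arrows may be followed in both
directions). -/
def IsComponent (X : CrystalData m n B) (Y : CrystalData u v B) (C : Set B) : Prop :=
  ∃ b, C = {b' | Relation.EqvGen (Arrow X Y) b b'}

/-- `ψ` restricts to an isomorphism of crystal graphs from `S` to `T`: a bijection that preserves
the weights and the functions `ε_i`, `φ_i` and carries the operators `e_i`, `f_i` of `S` to those
of `T`. -/
structure IsCrystalIso (X : CrystalData m n B) (X' : CrystalData m n B') (S : Set B) (T : Set B')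
    (ψ : B → B') : Prop where
  bijOn : Set.BijOn ψ S T
  wt : ∀ b ∈ S, X'.wt (ψ b) = X.wt b
  eps : ∀ i, ∀ b ∈ S, X'.eps i (ψ b) = X.eps i b
  phi : ∀ i, ∀ b ∈ S, X'.phi i (ψ b) = X.phi i b
  e : ∀ i, ∀ b ∈ S, X'.e i (ψ b) = (X.e i b).map ψ
  f : ∀ i, ∀ b ∈ S, X'.f i (ψ b) = (X.f i b).map ψ

end Crystals

section Words

variable {m n : ℕ}

/-- The crystal of letters, the crystal of the natural representation. -/
def letterCrystal (m n : ℕ) : CrystalData m n (Letter m n) where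
  wt b := Pi.single b 1
  eps i b := if b = tgt i then 1 else 0
  phi i b := if b = src i then 1 else 0
  e i b := if b = tgt i then some (src i) else none
  f i b := if b = src i then some (tgt i) else none

/-- From a structure on shorter words: the empty word is trivial and `b w` is `b ⊗ w`. -/
def consCrystal (X : CrystalData m n (List (Letter m n))) :
    CrystalData m n (List (Letter m n)) where
  wt
    | [] => 0
    | b :: w => ((letterCrystal m n).tensor X).wt (b, w)
  eps i
    | [] => 0
    | b :: w => ((letterCrystal m n).tensor X).eps i (b, w)
  phi i
    | [] => 0
    | b :: w => ((letterCrystal m n).tensor X).phi i (b, w)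
  e i
    | [] => none
    | b :: w => (((letterCrystal m n).tensor X).e i (b, w)).map (fun p => p.1 :: p.2)
  f i
    | [] => none
    | b :: w => (((letterCrystal m n).tensor X).f i (b, w)).map (fun p => p.1 :: p.2)

/-- The crystal structure on words of length at most `r` (the values on longer words are
irrelevant). -/
def wordCrystalAux (m n : ℕ) : ℕ → CrystalData m n (List (Letter m n))
  | 0 => ⟨fun _ => 0, fun _ _ => 0, fun _ _ => 0, fun _ _ => none, fun _ _ => none⟩
  | r + 1 => consCrystal (wordCrystalAux m n r)

/-- The crystal of words: `w₁ ⋯ w_r` is `w₁ ⊗ ⋯ ⊗ w_r`. -/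
def wordCrystal (m n : ℕ) : CrystalData m n (List (Letter m n)) where
  wt w := (wordCrystalAux m n w.length).wt w
  eps i w := (wordCrystalAux m n w.length).eps i w
  phi i w := (wordCrystalAux m n w.length).phi i w
  e i w := (wordCrystalAux m n w.length).e i w
  f i w := (wordCrystalAux m n w.length).f i w

theorem wordCrystal_wt_cons (b : Letter m n) (w : List (Letter m n)) :
    (wordCrystal m n).wt (b :: w) = ((letterCrystal m n).tensor (wordCrystal m n)).wt (b, w) := rfl

theorem wordCrystal_eps_cons (i : Node m n) (b : Letter m n) (w : List (Letter m n)) :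
    (wordCrystal m n).eps i (b :: w) =
      ((letterCrystal m n).tensor (wordCrystal m n)).eps i (b, w) := rfl

theorem wordCrystal_phi_cons (i : Node m n) (b : Letter m n) (w : List (Letter m n)) :
    (wordCrystal m n).phi i (b :: w) =
      ((letterCrystal m n).tensor (wordCrystal m n)).phi i (b, w) := rfl

theorem wordCrystal_e_cons (i : Node m n) (b : Letter m n) (w : List (Letter m n)) :
    (wordCrystal m n).e i (b :: w) =
      (((letterCrystal m n).tensor (wordCrystal m n)).e i (b, w)).map (fun p => p.1 :: p.2) := rfl

theorem wordCrystal_f_cons (i : Node m n) (b : Letter m n) (w : List (Letter m n)) :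
    (wordCrystal m n).f i (b :: w) =
      (((letterCrystal m n).tensor (wordCrystal m n)).f i (b, w)).map (fun p => p.1 :: p.2) := rfl

end Words

section Tableaux

variable {m n : ℕ}

/-- A filling of a diagram, as the list of its columns from left to right; each column lists its
entries from top to bottom. -/
abbrev Filling (m n : ℕ) : Type := List (List (Letter m n))

/-- `(m,n)`-hook partitions: the `(m+1)`-st row has length at most `n`. -/
def IsHook (m n : ℕ) (lam : YoungDiagram) : Prop := lam.rowLen m ≤ n

/-- The `(m,n)`-hook semistandard tableaux of shape `lam`. -/
structure IsHookTableau (lam : YoungDiagram) (T : Filling m n) : Prop where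
  shape : T.map List.length = lam.transpose.rowLens
  col : ∀ c ∈ T, c.IsChain (fun a b => a < b ∨ (a = b ∧ deg a = 1))
  row : T.IsChain (fun x y => ∀ (r : ℕ) (a b : Letter m n), x[r]? = some a → y[r]? = some b →
    a < b ∨ (a = b ∧ deg a = 0))

/-- The set `B_{m|n}(lam)`. -/
def hookTableaux (m n : ℕ) (lam : YoungDiagram) : Set (Filling m n) := {T | IsHookTableau lam T}

/-- The column reading: the columns from right to left, each from top to bottom. -/
def reading (T : Filling m n) : List (Letter m n) := T.reverse.flatten

/-- The filling with the same column lengths as `T` and with column reading `w`. -/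
def refill (T : Filling m n) (w : List (Letter m n)) : Filling m n :=
  ((T.reverse.map List.length).splitLengths w).reverse

/-- The crystal structure on fillings that the column reading induces from the one on words. -/
def tableauCrystal (m n : ℕ) : CrystalData m n (Filling m n) where
  wt T := (wordCrystal m n).wt (reading T)
  eps i T := (wordCrystal m n).eps i (reading T)
  phi i T := (wordCrystal m n).phi i (reading T)
  e i T := ((wordCrystal m n).e i (reading T)).map (refill T)
  f i T := ((wordCrystal m n).f i (reading T)).map (refill T)

/-- Insert `b` into one column. It replaces the topmost entry `x` with `b ≤ x` (if `|b| = 0`) or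
`b < x` (if `|b| = 1`), and `x` is returned; if there is none, `b` is put at the bottom. (As columns
increase weakly, this `x` is the smallest such entry, in its highest position.) -/
def columnInsert (b : Letter m n) : List (Letter m n) → List (Letter m n) × Option (Letter m n)
  | [] => ([b], none)
  | x :: c =>
    if b < x ∨ (b = x ∧ deg b = 0) then (b :: c, some x)
    else (x :: (columnInsert b c).1, (columnInsert b c).2)

/-- Schensted's column bumping `T ← b`. -/
def bump : Filling m n → Letter m n → Filling m n
  | [], b => [[b]]
  | c :: T, b =>
    match columnInsert b c with
    | (c', none) => c' :: T
    | (c', some x) => c' :: bump T x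

/-- The tableau `P(w) = (⋯(w₁ ← w₂) ⋯) ← w_r`. -/
def P (w : List (Letter m n)) : Filling m n := w.foldl bump []

end Tableaux

section Matrices

variable {m n u v : ℕ}

/-- The strict linear order `≺` on pairs of letters. -/
def Prec (x y : Letter m n × Letter u v) : Prop :=
  x.2 < y.2 ∨ (x.2 = y.2 ∧ deg x.2 = 0 ∧ x.1 < y.1) ∨ (x.2 = y.2 ∧ deg x.2 = 1 ∧ y.1 < x.1)

/-- The strict linear order `≺'` on pairs of letters. -/
def Prec' (x y : Letter m n × Letter u v) : Prop :=
  y.1 < x.1 ∨ (x.1 = y.1 ∧ deg x.1 = 0 ∧ x.2 < y.2) ∨ (x.1 = y.1 ∧ deg x.1 = 1 ∧ y.2 < x.2)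

/-- A biword `w` increases weakly for the strict order `s`, and a pair of letters of the same
degree is not repeated in adjacent positions. -/
def SharpSorted (s : Letter m n × Letter u v → Letter m n × Letter u v → Prop)
    (w : List (Letter m n × Letter u v)) : Prop :=
  w.IsChain (fun x y => s x y ∨ x = y) ∧ w.IsChain (fun x y => deg x.1 = deg x.2 → x ≠ y)

/-- The biwords `Ω♯_{m|n,u|v}`. -/
def OmegaSharp (m n u v : ℕ) : Type :=
  {p : List (Letter m n) × List (Letter u v) //
    p.1.length = p.2.length ∧ SharpSorted Prec (p.1.zip p.2)}

/-- The biwords `(Ω♯_{m|n,u|v})*`. -/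
def OmegaSharpStar (m n u v : ℕ) : Type :=
  {p : List (Letter m n) × List (Letter u v) //
    p.1.length = p.2.length ∧ SharpSorted Prec' (p.1.zip p.2)}

/-- The matrices `M♯_{m|n,u|v}`. -/
def MSharp (m n u v : ℕ) : Type :=
  {A : Matrix (Letter m n) (Letter u v) ℕ // ∀ b b', deg b = deg b' → A b b' ≤ 1}

end Matrices

section Stability

variable {m n u v : ℕ}

theorem coroot_single_src (i : Node m n) : coroot i (Pi.single (src i) 1) = 1 := by
  have h : src i ≠ tgt i := by simp [src, tgt]
  simp only [coroot, form, root]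
  rw [Finset.sum_eq_single (src i)]
  · have : (src i).val = i.val := rfl
    simp only [deg, this]
    split_ifs <;> first | omega | simp [h]
  · intro b _ hb; simp [hb]
  · simp

theorem coroot_single_tgt (i : Node m n) :
    coroot i (Pi.single (tgt i) 1) = if i.val + 1 = m then 1 else -1 := by
  have h : tgt i ≠ src i := by simp [src, tgt]
  simp only [coroot, form, root]
  rw [Finset.sum_eq_single (tgt i)]
  · have : (tgt i).val = i.val + 1 := rfl
    simp only [deg, this]
    split_ifs <;> first | omega | simp [h]
  · intro b _ hb; simp [hb]
  · simp

/-- The shape of a letterwise change by `e_i`. -/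
theorem word_e_cons (i : Node m n) (b : Letter m n) (t w' : List (Letter m n))
    (h : (wordCrystal m n).e i (b :: t) = some w') :
    (b = tgt i ∧ w' = src i :: t ∧ (i.val + 1 < m → (wordCrystal m n).eps i t = 0) ∧
      (m < i.val + 1 → (wordCrystal m n).phi i t = 0)) ∨
    ∃ t', (wordCrystal m n).e i t = some t' ∧ w' = b :: t' ∧
      (i.val + 1 < m → b = src i → 1 < (wordCrystal m n).eps i t) ∧
      (m < i.val + 1 → b = tgt i → 0 < (wordCrystal m n).phi i t) ∧
      (i.val + 1 = m → b ≠ src i ∧ b ≠ tgt i) := by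
  have hne : src i ≠ tgt i := by simp [src, tgt]
  rw [wordCrystal_e_cons] at h
  simp only [CrystalData.tensor] at h
  split at h
  all_goals
    rename_i h1
    simp only [letterCrystal] at h h1
  · left
    split_ifs at h with h2
    swap
    · simp at h
    simp only [Option.map_some, Option.some.injEq] at h
    refine ⟨h2, h.symm, ?_, ?_⟩
    · intro h3
      simp only [h2, hne.symm, if_false] at h1
      omega
    · intro h3
      simp only [h2, if_true] at h1
      omega
  · right
    simp only [Option.map_map, Option.map_eq_some_iff] at h
    obtain ⟨t', ht, hw⟩ := h
    refine ⟨t', ht, hw.symm, ?_, ?_, ?_⟩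
    · rintro h3 rfl
      simp only [if_true, hne, if_false] at h1
      omega
    · rintro h3 rfl
      simp only [if_true] at h1
      omega
    · intro h3
      constructor
      · rintro rfl
        rw [coroot_single_src] at h1
        omega
      · rintro rfl
        rw [coroot_single_tgt] at h1
        rw [if_pos h3] at h1
        omega

/-- The shape of a letterwise change by `f_i`. -/
theorem word_f_cons (i : Node m n) (b : Letter m n) (t w' : List (Letter m n))
    (h : (wordCrystal m n).f i (b :: t) = some w') :
    (b = src i ∧ w' = tgt i :: t ∧ (i.val + 1 < m → (wordCrystal m n).eps i t = 0) ∧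
      (m < i.val + 1 → (wordCrystal m n).phi i t = 0)) ∨
    ∃ t', (wordCrystal m n).f i t = some t' ∧ w' = b :: t' ∧
      (i.val + 1 < m → b = src i → 0 < (wordCrystal m n).eps i t) ∧
      (m < i.val + 1 → b = tgt i → 1 < (wordCrystal m n).phi i t) ∧
      (i.val + 1 = m → b ≠ src i ∧ b ≠ tgt i) := by
  have hne : src i ≠ tgt i := by simp [src, tgt]
  rw [wordCrystal_f_cons] at h
  simp only [CrystalData.tensor] at h
  split at h
  all_goals
    rename_i h1
    simp only [letterCrystal] at h h1
  · left
    split_ifs at h with h2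
    swap
    · simp at h
    simp only [Option.map_some, Option.some.injEq] at h
    refine ⟨h2, h.symm, ?_, ?_⟩
    · intro h3
      simp only [h2, if_true] at h1
      omega
    · intro h3
      simp only [h2, hne, if_false] at h1
      omega
  · right
    simp only [Option.map_map, Option.map_eq_some_iff] at h
    obtain ⟨t', ht, hw⟩ := h
    refine ⟨t', ht, hw.symm, ?_, ?_, ?_⟩
    · rintro h3 rfl
      simp only [if_true] at h1
      omega
    · rintro h3 rfl
      simp only [if_true, hne.symm, if_false] at h1
      omega
    · intro h3
      constructor
      · rintro rfl
        rw [coroot_single_src] at h1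
        omega
      · rintro rfl
        rw [coroot_single_tgt] at h1
        rw [if_pos h3] at h1
        omega

theorem word_eps (i : Node m n) (h : i.val + 1 < m) (t : List (Letter m n)) :
    0 < (wordCrystal m n).eps i (tgt i :: t) ∧
    ((wordCrystal m n).eps i t = 0 → (wordCrystal m n).eps i (tgt i :: t) = 1) ∧
    ((wordCrystal m n).eps i t = 0 → (wordCrystal m n).eps i (src i :: t) = 0) := by
  have hne : src i ≠ tgt i := by simp [src, tgt]
  rw [wordCrystal_eps_cons, wordCrystal_eps_cons]
  simp only [CrystalData.tensor, letterCrystal, h, if_true, coroot_single_src, coroot_single_tgt,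
    hne, if_false]
  rw [if_neg (by omega)]
  omega

theorem word_phi (i : Node m n) (h : m < i.val + 1) (t : List (Letter m n)) :
    0 < (wordCrystal m n).phi i (src i :: t) ∧
    ((wordCrystal m n).phi i t = 0 → (wordCrystal m n).phi i (src i :: t) = 1) ∧
    ((wordCrystal m n).phi i t = 0 → (wordCrystal m n).phi i (tgt i :: t) = 0) := by
  have hne : src i ≠ tgt i := by simp [src, tgt]
  rw [wordCrystal_phi_cons, wordCrystal_phi_cons]
  simp only [CrystalData.tensor, letterCrystal, h, if_true, coroot_single_src, coroot_single_tgt,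
    hne.symm, if_false]
  rw [if_neg (by omega), if_neg (by omega), if_neg (by omega)]
  omega

theorem word_e_nil (i : Node m n) : (wordCrystal m n).e i [] = none := rfl

theorem word_f_nil (i : Node m n) : (wordCrystal m n).f i [] = none := rfl

/-- `e_i` preserves the lengths of words. -/
theorem length_word_e (i : Node m n) (w w' : List (Letter m n))
    (h : (wordCrystal m n).e i w = some w') : w'.length = w.length := by
  induction w generalizing w' with
  | nil => simp [word_e_nil] at h
  | cons b t ih =>
    rcases word_e_cons i b t w' h with ⟨_, rfl, _⟩ | ⟨t', ht, rfl, _⟩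
    · simp
    · simp [ih t' ht]

/-- `f_i` preserves the lengths of words. -/
theorem length_word_f (i : Node m n) (w w' : List (Letter m n))
    (h : (wordCrystal m n).f i w = some w') : w'.length = w.length := by
  induction w generalizing w' with
  | nil => simp [word_f_nil] at h
  | cons b t ih =>
    rcases word_f_cons i b t w' h with ⟨_, rfl, _⟩ | ⟨t', ht, rfl, _⟩
    · simp
    · simp [ih t' ht]

/-- The relation between adjacent letters with the same label, of degree `d`. -/
def Adj (d : ℕ) (b b' : Letter m n) : Prop :=
  (d = 0 ∧ (b < b' ∨ (b = b' ∧ deg b = 1))) ∨ (d = 1 ∧ (b' < b ∨ (b = b' ∧ deg b = 0)))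

theorem deg_eq_zero_iff (b : Letter m n) : deg b = 0 ↔ b.val < m := by
  unfold deg; split_ifs <;> simp [*]

theorem deg_eq_one_iff (b : Letter m n) : deg b = 1 ↔ m ≤ b.val := by
  unfold deg; split_ifs <;> simp <;> omega

theorem chain_e {T : Type*} (L : T → T → Prop) (par : T → ℕ)
    (i : Node m n) (w w' : List (Letter m n)) (ts : List T)
    (h : (wordCrystal m n).e i w = some w')
    (hc : (w.zip ts).IsChain (fun x y => L x.2 y.2 ∨ (x.2 = y.2 ∧ Adj (par x.2) x.1 y.1))) :
    (w'.zip ts).IsChain (fun x y => L x.2 y.2 ∨ (x.2 = y.2 ∧ Adj (par x.2) x.1 y.1)) := by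
  have hsv : (src i).val = i.val := rfl
  have htv : (tgt i).val = i.val + 1 := rfl
  induction w generalizing w' ts with
  | nil => simp [word_e_nil] at h
  | cons a t ih =>
    cases ts with
    | nil => simp
    | cons s ts =>
      rcases word_e_cons i a t w' h with ⟨rfl, rfl, h1, h2⟩ | ⟨t', ht, rfl, h1, h2, h3⟩
      · cases t with
        | nil => simp
        | cons b t =>
          cases ts with
          | nil => simp
          | cons s' ts =>
            simp only [List.zip_cons_cons, List.isChain_cons_cons] at hc ⊢
            refine ⟨?_, hc.2⟩
            rcases hc.1 with hL | ⟨rfl, hA⟩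
            · exact Or.inl hL
            refine Or.inr ⟨rfl, ?_⟩
            unfold Adj at hA ⊢
            have k1 : i.val + 1 < m → b ≠ tgt i := by
              rintro hm rfl
              have := (word_eps i hm t).1
              have := h1 hm
              omega
            have k2 : m < i.val + 1 → b ≠ src i := by
              rintro hm rfl
              have := (word_phi i hm t).1
              have := h2 hm
              omega
            simp only [deg_eq_zero_iff, deg_eq_one_iff, Fin.lt_def, Fin.ext_iff, ne_eq, hsv, htv]
              at hA k1 k2 ⊢
            omega
      · cases ts with
        | nil => simp
        | cons s' ts =>
          cases t with
          | nil => simp [word_e_nil] at ht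
          | cons b t =>
            simp only [List.zip_cons_cons, List.isChain_cons_cons] at hc
            have hrec := ih t' (s' :: ts) ht hc.2
            rcases word_e_cons i b t t' ht with ⟨rfl, rfl, g1, g2⟩ | ⟨t'', ht', rfl, _⟩
            · simp only [List.zip_cons_cons, List.isChain_cons_cons] at hrec ⊢
              refine ⟨?_, hrec⟩
              rcases hc.1 with hL | ⟨rfl, hA⟩
              · exact Or.inl hL
              refine Or.inr ⟨rfl, ?_⟩
              unfold Adj at hA ⊢
              have k1 : i.val + 1 < m → a ≠ src i := by
                rintro hm rfl
                have := (word_eps i hm t).2.1 (g1 hm)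
                have := h1 hm rfl
                omega
              have k2 : m < i.val + 1 → a ≠ tgt i := by
                rintro hm rfl
                have := (word_phi i hm t).2.2 (g2 hm)
                have := h2 hm rfl
                omega
              simp only [deg_eq_zero_iff, deg_eq_one_iff, Fin.lt_def, Fin.ext_iff, ne_eq, hsv, htv]
                at hA k1 k2 h3 ⊢
              omega
            · simp only [List.zip_cons_cons, List.isChain_cons_cons] at hrec ⊢
              exact ⟨hc.1, hrec⟩

theorem chain_f {T : Type*} (L : T → T → Prop) (par : T → ℕ)
    (i : Node m n) (w w' : List (Letter m n)) (ts : List T)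
    (h : (wordCrystal m n).f i w = some w')
    (hc : (w.zip ts).IsChain (fun x y => L x.2 y.2 ∨ (x.2 = y.2 ∧ Adj (par x.2) x.1 y.1))) :
    (w'.zip ts).IsChain (fun x y => L x.2 y.2 ∨ (x.2 = y.2 ∧ Adj (par x.2) x.1 y.1)) := by
  have hsv : (src i).val = i.val := rfl
  have htv : (tgt i).val = i.val + 1 := rfl
  induction w generalizing w' ts with
  | nil => simp [word_f_nil] at h
  | cons a t ih =>
    cases ts with
    | nil => simp
    | cons s ts =>
      rcases word_f_cons i a t w' h with ⟨rfl, rfl, h1, h2⟩ | ⟨t', ht, rfl, h1, h2, h3⟩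
      · cases t with
        | nil => simp
        | cons b t =>
          cases ts with
          | nil => simp
          | cons s' ts =>
            simp only [List.zip_cons_cons, List.isChain_cons_cons] at hc ⊢
            refine ⟨?_, hc.2⟩
            rcases hc.1 with hL | ⟨rfl, hA⟩
            · exact Or.inl hL
            refine Or.inr ⟨rfl, ?_⟩
            unfold Adj at hA ⊢
            have k1 : i.val + 1 < m → b ≠ tgt i := by
              rintro hm rfl
              have := (word_eps i hm t).1
              have := h1 hm
              omega
            have k2 : m < i.val + 1 → b ≠ src i := by
              rintro hm rfl
              have := (word_phi i hm t).1
              have := h2 hm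
              omega
            simp only [deg_eq_zero_iff, deg_eq_one_iff, Fin.lt_def, Fin.ext_iff, ne_eq, hsv, htv]
              at hA k1 k2 ⊢
            omega
      · cases ts with
        | nil => simp
        | cons s' ts =>
          cases t with
          | nil => simp [word_f_nil] at ht
          | cons b t =>
            simp only [List.zip_cons_cons, List.isChain_cons_cons] at hc
            have hrec := ih t' (s' :: ts) ht hc.2
            rcases word_f_cons i b t t' ht with ⟨rfl, rfl, g1, g2⟩ | ⟨t'', ht', rfl, _⟩
            · simp only [List.zip_cons_cons, List.isChain_cons_cons] at hrec ⊢
              refine ⟨?_, hrec⟩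
              rcases hc.1 with hL | ⟨rfl, hA⟩
              · exact Or.inl hL
              refine Or.inr ⟨rfl, ?_⟩
              unfold Adj at hA ⊢
              have k1 : i.val + 1 < m → a ≠ src i := by
                rintro hm rfl
                have := (word_eps i hm t).2.2 (g1 hm)
                have := h1 hm rfl
                omega
              have k2 : m < i.val + 1 → a ≠ tgt i := by
                rintro hm rfl
                have := (word_phi i hm t).2.1 (g2 hm)
                have := h2 hm rfl
                omega
              simp only [deg_eq_zero_iff, deg_eq_one_iff, Fin.lt_def, Fin.ext_iff, ne_eq, hsv, htv]
                at hA k1 k2 h3 ⊢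
              omega
            · simp only [List.zip_cons_cons, List.isChain_cons_cons] at hrec ⊢
              exact ⟨hc.1, hrec⟩

theorem isChain_and_iff {α : Type*} (R S : α → α → Prop) (l : List α) :
    l.IsChain R ∧ l.IsChain S ↔ l.IsChain (fun x y => R x y ∧ S x y) := by
  induction l with
  | nil => simp
  | cons a l ih =>
    cases l with
    | nil => simp
    | cons b l => simp only [List.isChain_cons_cons, ← ih]; tauto

theorem isChain_congr {α : Type*} {R S : α → α → Prop} (h : ∀ x y, R x y ↔ S x y)
    (l : List α) : l.IsChain R ↔ l.IsChain S :=
  ⟨fun k => k.imp fun x y => (h x y).1, fun k => k.imp fun x y => (h x y).2⟩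

theorem deg_eq_iff (b : Letter m n) (b' : Letter u v) :
    deg b = deg b' ↔ (b.val < m ↔ b'.val < u) := by
  unfold deg; split_ifs <;> simp [*]

theorem sharpSorted_prec_iff (w : List (Letter m n × Letter u v)) :
    SharpSorted Prec w ↔
      w.IsChain (fun x y => x.2 < y.2 ∨ (x.2 = y.2 ∧ Adj (deg x.2) x.1 y.1)) := by
  unfold SharpSorted
  rw [isChain_and_iff]
  refine isChain_congr ?_ w
  rintro ⟨a, b⟩ ⟨a', b'⟩
  simp only [Prec, Adj, deg_eq_iff, deg_eq_zero_iff, deg_eq_one_iff, Prod.mk.injEq, ne_eq,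
    Fin.lt_def, Fin.ext_iff]
  omega

theorem sharpSorted_prec'_iff (w : List (Letter m n × Letter u v)) :
    SharpSorted Prec' w ↔
      w.IsChain (fun x y => y.1 < x.1 ∨ (x.1 = y.1 ∧ Adj (deg x.1) x.2 y.2)) := by
  unfold SharpSorted
  rw [isChain_and_iff]
  refine isChain_congr ?_ w
  rintro ⟨a, b⟩ ⟨a', b'⟩
  simp only [Prec', Adj, deg_eq_iff, deg_eq_zero_iff, deg_eq_one_iff, Prod.mk.injEq, ne_eq,
    Fin.lt_def, Fin.ext_iff]
  omega

theorem sharpSorted_prec'_iff_zip (k : List (Letter m n)) (l : List (Letter u v)) :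
    SharpSorted Prec' (k.zip l) ↔
      (l.zip k).IsChain (fun x y => y.2 < x.2 ∨ (x.2 = y.2 ∧ Adj (deg x.2) x.1 y.1)) := by
  rw [sharpSorted_prec'_iff, ← List.zip_swap l k, List.isChain_map]
  rfl

/-- `e_i` and `f_i` act on the first words of the biwords in `Ω♯`. -/
theorem omegaSharp_e (i : Node m n) (p : OmegaSharp m n u v) (w : List (Letter m n))
    (h : (wordCrystal m n).e i p.1.1 = some w) :
    w.length = p.1.2.length ∧ SharpSorted Prec (w.zip p.1.2) :=
  ⟨(length_word_e i _ _ h).trans p.2.1,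
    (sharpSorted_prec_iff _).2 (chain_e _ _ i _ _ _ h ((sharpSorted_prec_iff _).1 p.2.2))⟩

theorem omegaSharp_f (i : Node m n) (p : OmegaSharp m n u v) (w : List (Letter m n))
    (h : (wordCrystal m n).f i p.1.1 = some w) :
    w.length = p.1.2.length ∧ SharpSorted Prec (w.zip p.1.2) :=
  ⟨(length_word_f i _ _ h).trans p.2.1,
    (sharpSorted_prec_iff _).2 (chain_f _ _ i _ _ _ h ((sharpSorted_prec_iff _).1 p.2.2))⟩

/-- `e_j` and `f_j` act on the second words of the biwords in `(Ω♯)*`. -/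
theorem omegaSharpStar_e (j : Node u v) (p : OmegaSharpStar m n u v) (w : List (Letter u v))
    (h : (wordCrystal u v).e j p.1.2 = some w) :
    p.1.1.length = w.length ∧ SharpSorted Prec' (p.1.1.zip w) :=
  ⟨p.2.1.trans (length_word_e j _ _ h).symm, (sharpSorted_prec'_iff_zip _ _).2
    (chain_e (fun x y => y < x) _ j _ _ _ h ((sharpSorted_prec'_iff_zip _ _).1 p.2.2))⟩

theorem omegaSharpStar_f (j : Node u v) (p : OmegaSharpStar m n u v) (w : List (Letter u v))
    (h : (wordCrystal u v).f j p.1.2 = some w) :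
    p.1.1.length = w.length ∧ SharpSorted Prec' (p.1.1.zip w) :=
  ⟨p.2.1.trans (length_word_f j _ _ h).symm, (sharpSorted_prec'_iff_zip _ _).2
    (chain_f (fun x y => y < x) _ j _ _ _ h ((sharpSorted_prec'_iff_zip _ _).1 p.2.2))⟩

end Stability

section Bijections

variable {m n u v : ℕ}

/-- The number of times each pair of letters occurs in a biword. -/
def countMatrix (w : List (Letter m n × Letter u v)) : Matrix (Letter m n) (Letter u v) ℕ :=
  fun b b' => w.count (b, b')

theorem sharpSorted_pairwise (s : Letter m n × Letter u v → Letter m n × Letter u v → Prop)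
    [IsTrans _ s] [Std.Irrefl s] (w : List (Letter m n × Letter u v)) (h : SharpSorted s w) :
    w.Pairwise (fun x y => s x y ∨ (x = y ∧ deg x.1 ≠ deg x.2)) := by
  unfold SharpSorted at h
  rw [isChain_and_iff] at h
  have : IsTrans _ (fun x y => s x y ∨ (x = y ∧ deg x.1 ≠ deg x.2)) := ⟨by
    rintro x y z (h1 | ⟨rfl, h1⟩) (h2 | ⟨rfl, h2⟩)
    · exact Or.inl (_root_.trans h1 h2)
    · exact Or.inl h1
    · exact Or.inl h2
    · exact Or.inr ⟨rfl, h1⟩⟩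
  refine List.isChain_iff_pairwise.1 (h.imp ?_)
  rintro x y ⟨h1 | rfl, h2⟩
  · exact Or.inl h1
  · exact Or.inr ⟨rfl, fun k => h2 k rfl⟩

theorem count_le_one (s : Letter m n × Letter u v → Letter m n × Letter u v → Prop)
    [IsTrans _ s] [Std.Irrefl s] (w : List (Letter m n × Letter u v)) (h : SharpSorted s w)
    (b : Letter m n) (b' : Letter u v) (hd : deg b = deg b') : w.count (b, b') ≤ 1 := by
  have hp := sharpSorted_pairwise s w h
  by_contra hc
  have h2 : [(b, b'), (b, b')].Sublist w := by
    have := List.replicate_sublist_iff.2 (show 2 ≤ w.count (b, b') by omega)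
    simpa using this
  have := hp.sublist h2
  simp only [List.pairwise_cons, List.mem_singleton, forall_eq] at this
  rcases this.1 with h3 | h3
  · exact irrefl _ h3
  · exact h3.2 hd

theorem eq_of_countMatrix (s : Letter m n × Letter u v → Letter m n × Letter u v → Prop)
    [IsTrans _ s] [Std.Irrefl s] (w w' : List (Letter m n × Letter u v)) (h : SharpSorted s w)
    (h' : SharpSorted s w') (hc : countMatrix w = countMatrix w') : w = w' := by
  refine List.Perm.eq_of_pairwise ?_ (sharpSorted_pairwise s w h) (sharpSorted_pairwise s w' h') ?_
  · rintro x y _ _ (h1 | ⟨rfl, h1⟩) (h2 | ⟨h2, _⟩)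
    · exact absurd (_root_.trans h1 h2) (irrefl _)
    · exact h2.symm
    · rfl
    · rfl
  · rw [List.perm_iff_count]
    rintro ⟨b, b'⟩
    exact congrFun (congrFun hc b) b'

theorem exists_countMatrix
    (s : Letter m n × Letter u v → Letter m n × Letter u v → Prop)
    [IsTrans _ s] [Std.Irrefl s] [Std.Trichotomous s] (A : Matrix (Letter m n) (Letter u v) ℕ)
    (hA : ∀ b b', deg b = deg b' → A b b' ≤ 1) :
    ∃ w, SharpSorted s w ∧ countMatrix w = A := by
  classical
  have : IsTrans _ (fun x y => s x y ∨ x = y) := ⟨by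
    rintro x y z (h1 | rfl) (h2 | rfl)
    · exact Or.inl (_root_.trans h1 h2)
    · exact Or.inl h1
    · exact Or.inl h2
    · exact Or.inr rfl⟩
  have : Std.Total (fun x y => s x y ∨ x = y) := ⟨by
    intro x y
    rcases trichotomous_of s x y with h | h | h
    · exact Or.inl (Or.inl h)
    · exact Or.inl (Or.inr h)
    · exact Or.inr (Or.inl h)⟩
  set M : Multiset (Letter m n × Letter u v) := ∑ x, Multiset.replicate (A x.1 x.2) x with hM
  set w := M.toList.insertionSort (fun x y => s x y ∨ x = y) with hw
  have hcount : ∀ x, w.count x = A x.1 x.2 := by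
    intro x
    have h1 : w.count x = M.toList.count x := (List.perm_insertionSort _ M.toList).count_eq x
    have h2 : M.toList.count x = M.count x := by
      conv_rhs => rw [← Multiset.coe_toList M]
      convert (Multiset.coe_count x M.toList).symm using 1
      congr 1
      exact lawful_beq_subsingleton _ _
    rw [h1, h2, hM, Multiset.count_sum']
    simp [Multiset.count_replicate]
  refine ⟨w, ⟨(List.pairwise_insertionSort _ _).isChain, ?_⟩, ?_⟩
  · rw [List.isChain_iff_getElem]
    intro k hk hd heq
    have h2 : [w[k], w[k + 1]].Sublist w := by
      have h3 : (w.drop k).take 2 = [w[k], w[k + 1]] := by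
        rw [List.drop_eq_getElem_cons (Nat.lt_of_succ_lt hk), List.drop_eq_getElem_cons hk]
        rfl
      rw [← h3]
      exact (List.take_sublist _ _).trans (List.drop_sublist _ _)
    rw [← heq] at h2
    have h4 : 2 ≤ w.count w[k] := by
      simpa using h2.count_le w[k]
    rw [hcount] at h4
    have := hA _ _ hd
    omega
  · funext b b'
    exact hcount (b, b')

instance : IsTrans (Letter m n × Letter u v) Prec := ⟨by
  rintro ⟨a, b⟩ ⟨a', b'⟩ ⟨a'', b''⟩
  simp only [Prec, deg_eq_zero_iff, deg_eq_one_iff, Fin.lt_def, Fin.ext_iff]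
  omega⟩

instance : Std.Irrefl (Prec (m := m) (n := n) (u := u) (v := v)) := ⟨by
  rintro ⟨a, b⟩; simp [Prec]⟩

instance : Std.Trichotomous (Prec (m := m) (n := n) (u := u) (v := v)) := ⟨by
  rintro ⟨a, b⟩ ⟨a', b'⟩
  simp only [Prec, deg_eq_zero_iff, deg_eq_one_iff, Fin.lt_def, Fin.ext_iff, Prod.mk.injEq]
  omega⟩

instance : IsTrans (Letter m n × Letter u v) Prec' := ⟨by
  rintro ⟨a, b⟩ ⟨a', b'⟩ ⟨a'', b''⟩
  simp only [Prec', deg_eq_zero_iff, deg_eq_one_iff, Fin.lt_def, Fin.ext_iff]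
  omega⟩

instance : Std.Irrefl (Prec' (m := m) (n := n) (u := u) (v := v)) := ⟨by
  rintro ⟨a, b⟩; simp [Prec']⟩

instance : Std.Trichotomous (Prec' (m := m) (n := n) (u := u) (v := v)) := ⟨by
  rintro ⟨a, b⟩ ⟨a', b'⟩
  simp only [Prec', deg_eq_zero_iff, deg_eq_one_iff, Fin.lt_def, Fin.ext_iff, Prod.mk.injEq]
  omega⟩

theorem zip_inj {α β : Type*} {p q : List α × List β} (hp : p.1.length = p.2.length)
    (hq : q.1.length = q.2.length) (h : p.1.zip p.2 = q.1.zip q.2) : p = q := by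
  have h1 := congrArg (List.map Prod.fst) h
  have h2 := congrArg (List.map Prod.snd) h
  rw [List.map_fst_zip (by omega), List.map_fst_zip (by omega)] at h1
  rw [List.map_snd_zip (by omega), List.map_snd_zip (by omega)] at h2
  exact Prod.ext h1 h2

/-- The matrix `A(i, j)` of a biword in `Ω♯`. -/
def OmegaSharp.matrix (p : OmegaSharp m n u v) : MSharp m n u v :=
  ⟨countMatrix (p.1.1.zip p.1.2), count_le_one Prec _ p.2.2⟩

/-- The matrix `A(k, l)` of a biword in `(Ω♯)*`. -/
def OmegaSharpStar.matrix (p : OmegaSharpStar m n u v) : MSharp m n u v :=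
  ⟨countMatrix (p.1.1.zip p.1.2), count_le_one Prec' _ p.2.2⟩

theorem OmegaSharp.matrix_bijective :
    Function.Bijective (OmegaSharp.matrix : OmegaSharp m n u v → MSharp m n u v) := by
  constructor
  · intro p q h
    exact Subtype.ext (zip_inj p.2.1 q.2.1
      (eq_of_countMatrix Prec _ _ p.2.2 q.2.2 (congrArg Subtype.val h)))
  · intro A
    obtain ⟨w, hw, hA⟩ := exists_countMatrix Prec A.1 A.2
    refine ⟨⟨(w.map Prod.fst, w.map Prod.snd), by simp, ?_⟩, Subtype.ext ?_⟩
    · rwa [List.zip_map', List.map_id']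
    · rw [← hA]
      change countMatrix ((w.map Prod.fst).zip (w.map Prod.snd)) = countMatrix w
      rw [List.zip_map', List.map_id']

theorem OmegaSharpStar.matrix_bijective :
    Function.Bijective (OmegaSharpStar.matrix : OmegaSharpStar m n u v → MSharp m n u v) := by
  constructor
  · intro p q h
    exact Subtype.ext (zip_inj p.2.1 q.2.1
      (eq_of_countMatrix Prec' _ _ p.2.2 q.2.2 (congrArg Subtype.val h)))
  · intro A
    obtain ⟨w, hw, hA⟩ := exists_countMatrix Prec' A.1 A.2
    refine ⟨⟨(w.map Prod.fst, w.map Prod.snd), by simp, ?_⟩, Subtype.ext ?_⟩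
    · rwa [List.zip_map', List.map_id']
    · rw [← hA]
      change countMatrix ((w.map Prod.fst).zip (w.map Prod.snd)) = countMatrix w
      rw [List.zip_map', List.map_id']

/-- The bijection of `Ω♯` with `M♯`. -/
noncomputable def omegaSharpEquiv (m n u v : ℕ) : OmegaSharp m n u v ≃ MSharp m n u v :=
  Equiv.ofBijective _ OmegaSharp.matrix_bijective

/-- The bijection of `(Ω♯)*` with `M♯`. -/
noncomputable def omegaSharpStarEquiv (m n u v : ℕ) : OmegaSharpStar m n u v ≃ MSharp m n u v :=
  Equiv.ofBijective _ OmegaSharpStar.matrix_bijective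

end Bijections

section SharpCrystals

variable {m n u v : ℕ}

/-- The `gl_{m|n}`-crystal `Ω♯`: `x_i (i, j) = (x_i i, j)` for `x = e, f`. -/
def omegaSharpCrystal (m n u v : ℕ) : CrystalData m n (OmegaSharp m n u v) where
  wt p := (wordCrystal m n).wt p.1.1
  eps i p := (wordCrystal m n).eps i p.1.1
  phi i p := (wordCrystal m n).phi i p.1.1
  e i p := ((wordCrystal m n).e i p.1.1).pmap (fun w h => ⟨(w, p.1.2), h⟩) (omegaSharp_e i p)
  f i p := ((wordCrystal m n).f i p.1.1).pmap (fun w h => ⟨(w, p.1.2), h⟩) (omegaSharp_f i p)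

/-- The `gl_{u|v}`-crystal `(Ω♯)*`: `x*_j (k, l) = (k, x_j l)` for `x = e, f`. -/
def omegaSharpStarCrystal (m n u v : ℕ) : CrystalData u v (OmegaSharpStar m n u v) where
  wt p := (wordCrystal u v).wt p.1.2
  eps j p := (wordCrystal u v).eps j p.1.2
  phi j p := (wordCrystal u v).phi j p.1.2
  e j p := ((wordCrystal u v).e j p.1.2).pmap (fun w h => ⟨(p.1.1, w), h⟩) (omegaSharpStar_e j p)
  f j p := ((wordCrystal u v).f j p.1.2).pmap (fun w h => ⟨(p.1.1, w), h⟩) (omegaSharpStar_f j p)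

/-- The `gl_{m|n}`-crystal structure on `M♯`. -/
noncomputable def sharpCrystal (m n u v : ℕ) : CrystalData m n (MSharp m n u v) :=
  (omegaSharpCrystal m n u v).transport (omegaSharpEquiv m n u v)

/-- The `gl_{u|v}`-crystal structure on `M♯`, with operators `e*_j`, `f*_j`. -/
noncomputable def sharpStarCrystal (m n u v : ℕ) : CrystalData u v (MSharp m n u v) :=
  (omegaSharpStarCrystal m n u v).transport (omegaSharpStarEquiv m n u v)

/-- The map `π♯(A) = (P(i), P(l))`, where `A = A(i, j) = A(k, l)` with `(i, j)` in `Ω♯` and `(k, l)`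
in `(Ω♯)*`. -/
noncomputable def piSharp (A : MSharp m n u v) : Filling m n × Filling u v :=
  (P ((omegaSharpEquiv m n u v).symm A).1.1, P ((omegaSharpStarEquiv m n u v).symm A).1.2)

end SharpCrystals

end SuperCrystal

/-! The proof is the Robinson–Schensted–Knuth correspondence seen through the plactic congruence.
For the relation `col` between successive entries of a column, two words have the same tableau `P`
exactly when Knuth relations join them (`P_eq_iff`). The operators e_i, f_i, the functions ε_i, φ_i
and the weight respect this congruence (`Plac.compat`, `Plac.wt_eq`), and the operators send
readings of tableaux to readings of tableaux of the same shape (`isTab_replace`). Hence `P` is a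
morphism from words to tableaux.

The two structures on matrices meet in one fact: when e_i acts on the first word of a biword in Ω♯,
the plactic class of the second word, read in (Ω♯)*, does not change (`rowsIn_plac`). That second
word is a concatenation of blocks, one for each letter b, which list the labels paired with b. A
block is a column if b is even and a row read backwards if b is odd. The operator e_i moves one
label from the block of `tgt i` to the block of `src i`. At an even or odd pair of letters, the
signature rule that selects this label says that the parts of the two blocks on either side of it
dominate one another, and this is the hypothesis of the exchange lemma `Plac.exchange`; at the node
0 the word of labels does not change at all. The statement is proved for an arbitrary order of the
labels, so that it also gives the invariance of the class of the first word under the starred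
operators. Thus e_i changes only the first component of π♯, and e_j^* only the second.

For injectivity, any two tableaux of one shape are joined by arrows (`linked_of_shape`). Such paths
lift to matrices and can be reversed there (`WordModel.exists_lift`), so it suffices to separate
matrices whose first word is extremal. By the duality between rows of one word of a biword and
columns of the other, extremality makes the label blocks longest rows or longest columns. Each block
can then be stripped from the insertion tableau as its first row or first column, and the blocks are
recovered one by one (`labels_eq`).

The rest is formal. Operators on different factors of a product commute, and injectivity carries
this back to matrices. Inside a component, the two shapes are constant, and every pair of tableaux
of these shapes is reached by moving the first tableau and then the second
(`WordModel.exists_reach`). Connectedness is proved directly, without highest weight elements: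
tableaux are encoded by the numbers of letters below each threshold in each column, and these
numbers are brought to a canonical form one threshold at a time. -/

namespace SuperCrystal

/-! ### Column orders, Knuth relations, and the exchange of letters between columns -/

section Plactic

variable {α : Type*} {r : α → α → Prop}

/-- A transitive and negatively transitive relation: the relation between consecutive entries of a
column. The relation between consecutive entries of a row is then `fun a b => ¬ r b a`. -/
structure IsColumnOrder (r : α → α → Prop) : Prop where
  trans : ∀ {a b c}, r a b → r b c → r a c
  cotrans : ∀ {a b c}, r a c → r a b ∨ r b c

/-- The relation obtained by exchanging the roles of rows and columns. -/
def rowRel (r : α → α → Prop) : α → α → Prop := fun a b => ¬ r b a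

/-- Negating the opposite relation interchanges the two axioms, so every statement about columns has
a version for rows. -/
theorem IsColumnOrder.rowRel (h : IsColumnOrder r) : IsColumnOrder (rowRel r) where
  trans := fun h1 h2 h3 => (h.cotrans h3).elim h2 h1
  cotrans := fun {a b c} h1 => by
    by_contra hc
    simp only [SuperCrystal.rowRel, not_or, not_not] at hc h1
    exact h1 (h.trans hc.2 hc.1)

theorem IsColumnOrder.flip (h : IsColumnOrder r) : IsColumnOrder (flip r) where
  trans := fun h1 h2 => h.trans h2 h1
  cotrans := fun h1 => (h.cotrans h1).symm

/-- The plactic congruence on words. -/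
inductive Plac (r : α → α → Prop) : List α → List α → Prop
  | refl (w) : Plac r w w
  | symm {w w'} : Plac r w w' → Plac r w' w
  | trans {w w' w''} : Plac r w w' → Plac r w' w'' → Plac r w w''
  | acb (p q : List α) {a b c} : r a b → ¬ r c b →
      Plac r (p ++ c :: a :: b :: q) (p ++ a :: c :: b :: q)
  | bac (p q : List α) {a b c} : ¬ r b a → r b c →
      Plac r (p ++ b :: a :: c :: q) (p ++ b :: c :: a :: q)

theorem Plac.append_left {w w' : List α} (h : Plac r w w') (u : List α) :
    Plac r (u ++ w) (u ++ w') := by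
  induction h with
  | refl w => exact .refl _
  | symm _ ih => exact ih.symm
  | trans _ _ ih1 ih2 => exact ih1.trans ih2
  | acb p q h1 h2 => simpa using Plac.acb (u ++ p) q h1 h2
  | bac p q h1 h2 => simpa using Plac.bac (u ++ p) q h1 h2

theorem Plac.append_right {w w' : List α} (h : Plac r w w') (u : List α) :
    Plac r (w ++ u) (w' ++ u) := by
  induction h with
  | refl w => exact .refl _
  | symm _ ih => exact ih.symm
  | trans _ _ ih1 ih2 => exact ih1.trans ih2
  | acb p q h1 h2 => simpa using Plac.acb p (q ++ u) h1 h2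
  | bac p q h1 h2 => simpa using Plac.bac p (q ++ u) h1 h2

theorem Plac.append {u u' w w' : List α} (h : Plac r u u') (h' : Plac r w w') :
    Plac r (u ++ w) (u' ++ w') := (h.append_right w).trans (h'.append_left u')

theorem Plac.cons {w w' : List α} (a : α) (h : Plac r w w') : Plac r (a :: w) (a :: w') :=
  h.append_left [a]

/-- Read backwards, `acb` for `rowRel r` is `bac` for `r`, and conversely. This turns facts about
columns into facts about rows. -/
theorem Plac.reverse_of_rowRel {w w' : List α} (h : Plac (rowRel r) w w') :
    Plac r w.reverse w'.reverse := by
  induction h with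
  | refl w => exact .refl _
  | symm _ ih => exact ih.symm
  | trans _ _ ih1 ih2 => exact ih1.trans ih2
  | acb p q h1 h2 => simpa using Plac.bac q.reverse p.reverse h1 (not_not.1 h2)
  | bac p q h1 h2 => simpa using Plac.acb q.reverse p.reverse (not_not.1 h1) h2

theorem Plac.reverse_of_flip {w w' : List α} (h : Plac (flip r) w w') :
    Plac r w.reverse w'.reverse := by
  induction h with
  | refl w => exact .refl _
  | symm _ ih => exact ih.symm
  | trans _ _ ih1 ih2 => exact ih1.trans ih2
  | acb p q h1 h2 => simpa using (Plac.bac q.reverse p.reverse (r := r) h2 h1).symm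
  | bac p q h1 h2 => simpa using (Plac.acb q.reverse p.reverse (r := r) h2 h1).symm

theorem Plac.length_eq {w w' : List α} (h : Plac r w w') : w.length = w'.length := by
  induction h with
  | refl w => rfl
  | symm _ ih => exact ih.symm
  | trans _ _ ih1 ih2 => exact ih1.trans ih2
  | acb p q h1 h2 => simp
  | bac p q h1 h2 => simp

theorem Plac.perm {w w' : List α} (h : Plac r w w') : w.Perm w' := by
  induction h with
  | refl w => exact .refl _
  | symm _ ih => exact ih.symm
  | trans _ _ ih1 ih2 => exact ih1.trans ih2
  | acb p q h1 h2 => exact (List.Perm.swap _ _ _).append_left p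
  | bac p q h1 h2 => exact ((List.Perm.swap _ _ _).cons _).append_left p

/-- Restriction to an interval of letters respects the plactic congruence. -/
theorem Plac.filter {w w' : List α} (h : Plac r w w') (p : α → Bool)
    (h1 : ∀ a b c, r a b → ¬ r c b → p a → p c → p b)
    (h2 : ∀ a b c, ¬ r b a → r b c → p a → p c → p b) :
    Plac r (w.filter p) (w'.filter p) := by
  induction h with
  | refl w => exact .refl _
  | symm _ ih => exact ih.symm
  | trans _ _ ih1 ih2 => exact ih1.trans ih2
  | @acb u v a b c k1 k2 =>
    have := h1 a b c k1 k2
    by_cases ha : p a <;> by_cases hb : p b <;> by_cases hc : p c <;>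
      simp_all [List.filter_append, Plac.refl, Plac.acb _ _ k1 k2]
  | @bac u v a b c k1 k2 =>
    have := h2 a b c k1 k2
    by_cases ha : p a <;> by_cases hb : p b <;> by_cases hc : p c <;>
      simp_all [List.filter_append, Plac.refl, Plac.bac _ _ k1 k2]

/-- `w` has a subword of length `k` that is a column. -/
def HasColumn (r : α → α → Prop) (w : List α) (k : ℕ) : Prop :=
  ∃ s : List α, s.Sublist w ∧ s.Pairwise r ∧ s.length = k

/-- A column subword splits into its parts in `p`, `t` and `q`. The middle part may be exchanged for
any `s'` that keeps the relations to letters before and after it, so a Knuth relation needs checking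
on its three letters only. -/
theorem HasColumn.replace {p q t t' : List α} {k : ℕ}
    (ht : ∀ s : List α, s.Sublist t → s.Pairwise r → ∃ s' : List α, s'.Sublist t' ∧ s'.Pairwise r ∧
      s'.length = s.length ∧ (∀ z, (∀ x ∈ s, r z x) → ∀ x ∈ s', r z x) ∧
      (∀ z, (∀ x ∈ s, r x z) → ∀ x ∈ s', r x z))
    (h : HasColumn r (p ++ (t ++ q)) k) : HasColumn r (p ++ (t' ++ q)) k := by
  obtain ⟨s, hs, hp, hk⟩ := h
  obtain ⟨s1, s2, rfl, hs1, hs2⟩ := List.sublist_append_iff.1 hs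
  obtain ⟨s2, s3, rfl, hs2, hs3⟩ := List.sublist_append_iff.1 hs2
  simp only [List.pairwise_append, List.mem_append] at hp
  obtain ⟨s', h1, h2, h3, h4, h5⟩ := ht s2 hs2 hp.2.1.1
  refine ⟨s1 ++ (s' ++ s3), hs1.append (h1.append hs3), ?_, by simp_all⟩
  simp only [List.pairwise_append, List.mem_append]
  refine ⟨hp.1, ⟨h2, hp.2.1.2.1, fun a ha b hb => ?_⟩, fun a ha b hb => ?_⟩
  · exact h5 b (fun x hx => hp.2.1.2.2 x hx b hb) a ha
  · rcases hb with hb | hb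
    · exact h4 a (fun x hx => hp.2.2 a ha x (Or.inl hx)) b hb
    · exact hp.2.2 a ha b (Or.inr hb)

theorem sublist_three {a b c : α} {s : List α} (h : s.Sublist [a, b, c]) :
    s = [] ∨ s = [a] ∨ s = [b] ∨ s = [c] ∨ s = [a, b] ∨ s = [a, c] ∨ s = [b, c] ∨
      s = [a, b, c] := by
  rw [← List.mem_sublists] at h
  simp [List.sublists] at h
  tauto

/-- The one-column case of Greene's theorem. In each direction a Knuth relation destroys at most one
column subword of its three letters, a pair, and the axioms of a column order supply a substitute
pair. -/
theorem Plac.hasColumn_iff (hr : IsColumnOrder r) {w w' : List α} (h : Plac r w w') (k : ℕ) :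
    HasColumn r w k ↔ HasColumn r w' k := by
  induction h with
  | refl w => rfl
  | symm _ ih => exact ih.symm
  | trans _ _ ih1 ih2 => exact ih1.trans ih2
  | @acb p q a b c h1 h2 =>
    constructor
    · refine HasColumn.replace (t := [c, a, b]) (t' := [a, c, b]) ?_
      intro s hs hp
      have h3 : ¬ r c a := fun h => h2 (hr.trans h h1)
      refine ⟨s, ?_, hp, rfl, fun z h => h, fun z h => h⟩
      rcases sublist_three hs with rfl | rfl | rfl | rfl | rfl | rfl | rfl | rfl <;>
        simp_all
    · refine HasColumn.replace (t := [a, c, b]) (t' := [c, a, b]) ?_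
      intro s hs hp
      -- Only `[a, c]` is lost, and `[a, b]` replaces it. For a later letter `z`, cotransitivity
      -- applied to `r c z` and `¬ r c b` gives `r b z`.
      by_cases hac : s = [a, c]
      · subst hac
        refine ⟨[a, b], by simp, by simpa using h1, rfl, fun z hz => ?_, fun z hz => ?_⟩
        · simp only [List.mem_cons, List.not_mem_nil, or_false, forall_eq_or_imp, forall_eq] at hz ⊢
          exact ⟨hz.1, hr.trans hz.1 h1⟩
        · simp only [List.mem_cons, List.not_mem_nil, or_false, forall_eq_or_imp, forall_eq] at hz ⊢
          exact ⟨hz.1, (hr.cotrans hz.2).resolve_left h2⟩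
      · refine ⟨s, ?_, hp, rfl, fun z h => h, fun z h => h⟩
        rcases sublist_three hs with rfl | rfl | rfl | rfl | rfl | rfl | rfl | rfl <;>
          simp_all
  | @bac p q a b c h1 h2 =>
    constructor
    · refine HasColumn.replace (t := [b, a, c]) (t' := [b, c, a]) ?_
      intro s hs hp
      by_cases hac : s = [a, c]
      · subst hac
        refine ⟨[b, c], by simp, by simpa using h2, rfl, fun z hz => ?_, fun z hz => ?_⟩
        · simp only [List.mem_cons, List.not_mem_nil, or_false, forall_eq_or_imp, forall_eq] at hz ⊢
          exact ⟨(hr.cotrans hz.1).resolve_right h1, hz.2⟩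
        · simp only [List.mem_cons, List.not_mem_nil, or_false, forall_eq_or_imp, forall_eq] at hz ⊢
          exact ⟨hr.trans h2 hz.2, hz.2⟩
      · refine ⟨s, ?_, hp, rfl, fun z h => h, fun z h => h⟩
        rcases sublist_three hs with rfl | rfl | rfl | rfl | rfl | rfl | rfl | rfl <;>
          simp_all
    · refine HasColumn.replace (t := [b, c, a]) (t' := [b, a, c]) ?_
      intro s hs hp
      have h3 : ¬ r c a := fun h => h1 (hr.trans h2 h)
      refine ⟨s, ?_, hp, rfl, fun z h => h, fun z h => h⟩
      rcases sublist_three hs with rfl | rfl | rfl | rfl | rfl | rfl | rfl | rfl <;>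
        simp_all

/-- The column `x` may stand immediately to the right of the column `y`. -/
def Dom (r : α → α → Prop) : List α → List α → Prop
  | _, [] => True
  | [], _ :: _ => False
  | y :: ys, x :: xs => ¬ r x y ∧ Dom r ys xs

@[simp] theorem Dom.nil_right (y : List α) : Dom r y [] := by cases y <;> trivial

@[simp] theorem dom_nil_cons (x : α) (xs : List α) : ¬ Dom r [] (x :: xs) := id

@[simp] theorem dom_cons_cons (x y : α) (xs ys : List α) :
    Dom r (y :: ys) (x :: xs) ↔ ¬ r x y ∧ Dom r ys xs := Iff.rfl

theorem Dom.cons_left (hr : IsColumnOrder r) {w : α} {y x : List α} (h : Dom r y x)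
    (hc : (w :: y).Pairwise r) : Dom r (w :: y) x := by
  induction x generalizing w y with
  | nil => simp
  | cons a x ih =>
    cases y with
    | nil => simp at h
    | cons b y =>
      rw [dom_cons_cons] at h ⊢
      rw [List.pairwise_cons] at hc
      exact ⟨fun k => h.1 (hr.trans k (hc.1 b (by simp))), ih h.2 hc.2⟩

theorem Dom.append_left (hr : IsColumnOrder r) {z y x : List α} (h : Dom r y x)
    (hc : (z ++ y).Pairwise r) : Dom r (z ++ y) x := by
  induction z with
  | nil => exact h
  | cons a z ih => exact (ih (List.pairwise_cons.1 hc).2).cons_left hr hc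

/-- A small letter moves left through a column, up to the second place. -/
theorem Plac.column_snoc (hr : IsColumnOrder r) {x : α} {xs : List α} {y : α}
    (hc : (x :: xs).Pairwise r) (h : ¬ r x y) : Plac r (x :: xs ++ [y]) (x :: y :: xs) := by
  induction xs generalizing x with
  | nil => exact .refl _
  | cons z xs ih =>
    have hxz : r x z := (List.pairwise_cons.1 hc).1 z (by simp)
    have h' : ¬ r z y := fun k => h (hr.trans hxz k)
    exact ((ih (List.pairwise_cons.1 hc).2 h').cons x).trans (Plac.bac [] xs h hxz).symm

/-- Induction on `x`. The head `b` of `y` passes left through the column `a :: x`. It is then the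
witness for `j` to jump over `a`, because `r j b` and `¬ r a b`. The induction hypothesis, with `b`
in the role of `j`, carries `b` back through `x`, and `j` follows it by `Plac.column_snoc`. -/
theorem Plac.exchange_first (hr : IsColumnOrder r) {j : α} {x y : List α}
    (hx : (j :: x).Pairwise r) (hy : (j :: y).Pairwise r) (h : Dom r y x) :
    Plac r (j :: (x ++ y)) (x ++ j :: y) := by
  induction x generalizing j y with
  | nil => exact .refl _
  | cons a x ih =>
    cases y with
    | nil => simp at h
    | cons b y =>
      rw [dom_cons_cons] at h
      simp only [List.pairwise_cons] at hx hy
      have hjb : r j b := hy.1 b (by simp)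
      have haj : ¬ r a j := fun k => h.1 (hr.trans k hjb)
      have hax : (a :: x).Pairwise r := List.pairwise_cons.2 hx.2
      have hbx : (b :: x).Pairwise r := by
        refine List.pairwise_cons.2 ⟨fun c hc => ?_, hx.2.2⟩
        exact (hr.cotrans (hx.2.1 c hc)).resolve_left h.1
      have s1 : Plac r (j :: (a :: x ++ b :: y)) (j :: a :: b :: (x ++ y)) := by
        have := (Plac.column_snoc hr hax h.1).append_right y
        simpa using this.cons j
      have s2 : Plac r (j :: a :: b :: (x ++ y)) (a :: j :: b :: (x ++ y)) :=
        (Plac.acb [] (x ++ y) hjb h.1).symm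
      have s3 : Plac r (a :: j :: b :: (x ++ y)) (a :: j :: (x ++ b :: y)) :=
        ((ih hbx (List.pairwise_cons.2 hy.2) h.2).cons j).cons a
      have s4 : Plac r (a :: j :: (x ++ b :: y)) (a :: x ++ j :: b :: y) := by
        have := (Plac.column_snoc hr hax haj).symm.append_right (b :: y)
        simpa using this
      exact s1.trans (s2.trans (s3.trans s4))

/-- The image of `Plac.exchange_first` when words and order are both reversed; the columns are now
compared from the bottom. -/
theorem Plac.exchange_last (hr : IsColumnOrder r) {j : α} {x y : List α}
    (hx : (x ++ [j]).Pairwise r) (hy : (y ++ [j]).Pairwise r)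
    (h : Dom (flip r) x.reverse y.reverse) :
    Plac r (x ++ j :: y) (x ++ y ++ [j]) := by
  have hx' : (j :: x.reverse).Pairwise (flip r) := by
    have : (x ++ [j]).reverse.Pairwise (flip r) := List.pairwise_reverse.2 hx
    rwa [List.reverse_append] at this
  have hy' : (j :: y.reverse).Pairwise (flip r) := by
    have : (y ++ [j]).reverse.Pairwise (flip r) := List.pairwise_reverse.2 hy
    rwa [List.reverse_append] at this
  have := (Plac.exchange_first hr.flip hy' hx' h).reverse_of_flip.symm
  simpa using this

/-- The letters of `z` pass over `y` one at a time, the last one first. The remaining part of `z`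
extends `x` at the bottom, and domination counted from the bottom survives this. -/
theorem Plac.exchange_columns (hr : IsColumnOrder r) {x y z : List α}
    (hx : (x ++ z).Pairwise r) (hy : (y ++ z).Pairwise r)
    (h : Dom (flip r) x.reverse y.reverse) :
    Plac r (x ++ z ++ y) (x ++ y ++ z) := by
  induction z using List.reverseRecOn with
  | nil => simpa using Plac.refl _
  | append_singleton z a ih =>
    have hx' : (x ++ z ++ [a]).Pairwise r := by simpa using hx
    have hy' : (y ++ z ++ [a]).Pairwise r := by simpa using hy
    have hya : (y ++ [a]).Pairwise r :=
      hy.sublist ((List.Sublist.refl y).append (List.sublist_append_right z [a]))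
    have h1 : Dom (flip r) (x ++ z).reverse y.reverse := by
      rw [List.reverse_append]
      refine h.append_left hr.flip ?_
      rw [← List.reverse_append]
      exact List.pairwise_reverse.2 (List.pairwise_append.1 hx').1
    have s1 := Plac.exchange_last hr hx' hya h1
    have s2 := (ih (List.pairwise_append.1 hx').1 (List.pairwise_append.1 hy').1).append_right [a]
    have s3 := s1.trans s2
    simpa using s3

/-- A letter of the column `x₁ j x₂` whose upper part covers `y₁` and whose lower part is covered by
`y₂` may be moved to the column `y₁ y₂`. -/
theorem Plac.exchange (hr : IsColumnOrder r) {j : α} {x₁ x₂ y₁ y₂ : List α}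
    (hx : (x₁ ++ j :: x₂).Pairwise r) (hy : (y₁ ++ j :: y₂).Pairwise r)
    (h1 : Dom (flip r) x₁.reverse y₁.reverse) (h2 : Dom r y₂ x₂) :
    Plac r (x₁ ++ j :: x₂ ++ (y₁ ++ y₂)) (x₁ ++ x₂ ++ (y₁ ++ j :: y₂)) := by
  have hyx : (y₁ ++ j :: x₂).Pairwise r := by
    simp only [List.pairwise_append, List.pairwise_cons, List.mem_cons, forall_eq_or_imp] at hx hy ⊢
    exact ⟨hy.1, hx.2.1, fun a ha => ⟨(hy.2.2 a ha).1,
      fun b hb => hr.trans (hy.2.2 a ha).1 (hx.2.1.1 b hb)⟩⟩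
  have hsub : ∀ u : List α, (u ++ x₂).Sublist (u ++ j :: x₂) := fun u =>
    (List.Sublist.refl u).append (List.sublist_cons_self j x₂)
  -- Three moves: the tail `j x₂` passes over `y₁`, then `j` goes from the front of `x₂` to the
  -- front of `y₂`, then `x₂` alone passes back over `y₁`.
  have s1 := (Plac.exchange_columns hr hx hyx h1).append_right y₂
  have s2 := (Plac.exchange_first hr (List.pairwise_append.1 hx).2.1
    (List.pairwise_append.1 hy).2.1 h2).append_left (x₁ ++ y₁)
  have s3 := (Plac.exchange_columns hr (hx.sublist (hsub _)) (hyx.sublist (hsub _)) h1).symm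
    |>.append_right (j :: y₂)
  simp only [List.append_assoc, List.cons_append] at s1 s2 s3 ⊢
  exact s1.trans (s2.trans s3)

end Plactic

end SuperCrystal

namespace SuperCrystal

/-! ### Column insertion; `P` as a complete invariant of plactic classes -/

section Insertion

variable {m n : ℕ}

/-- The relation between consecutive entries of a column. -/
def col (a b : Letter m n) : Prop := a < b ∨ (a = b ∧ deg a = 1)

instance (a b : Letter m n) : Decidable (col a b) := by unfold col; infer_instance

theorem not_col {a b : Letter m n} : ¬ col a b ↔ b < a ∨ (b = a ∧ deg b = 0) := by
  simp only [col, deg_eq_zero_iff, deg_eq_one_iff, Fin.lt_def, Fin.ext_iff]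
  omega

theorem col_iff {a b : Letter m n} : col a b ↔ a.val < b.val ∨ (a.val = b.val ∧ m ≤ a.val) := by
  simp only [col, deg_eq_one_iff, Fin.lt_def, Fin.ext_iff]

theorem isColumnOrder_col : IsColumnOrder (col (m := m) (n := n)) where
  trans := fun h1 h2 => by rw [col_iff] at *; omega
  cotrans := fun h1 => by simp only [col_iff] at *; omega

theorem col_trans {a b c : Letter m n} (h1 : col a b) (h2 : col b c) : col a c :=
  isColumnOrder_col.trans h1 h2

theorem columnInsert_bump {b x : Letter m n} (h : ¬ col x b) (c : List (Letter m n)) :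
    columnInsert b (x :: c) = (b :: c, some x) := by
  rw [columnInsert, if_pos (not_col.1 h)]

theorem columnInsert_pass {b x : Letter m n} (h : col x b) (c : List (Letter m n)) :
    columnInsert b (x :: c) = (x :: (columnInsert b c).1, (columnInsert b c).2) := by
  rw [columnInsert, if_neg (fun k => not_col.2 k h)]

theorem mem_columnInsert {b y : Letter m n} {c : List (Letter m n)}
    (h : y ∈ (columnInsert b c).1) : y = b ∨ y ∈ c := by
  induction c with
  | nil => simpa [columnInsert] using h
  | cons x c ih =>
    by_cases hx : col x b
    · rw [columnInsert_pass hx] at h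
      rcases List.mem_cons.1 h with rfl | h
      · simp
      · rcases ih h with h | h <;> simp [h]
    · rw [columnInsert_bump hx] at h
      rcases List.mem_cons.1 h with rfl | h <;> simp [*]

theorem columnInsert_some {b y : Letter m n} {c : List (Letter m n)}
    (h : (columnInsert b c).2 = some y) : y ∈ c ∧ ¬ col y b := by
  induction c with
  | nil => simp [columnInsert] at h
  | cons x c ih =>
    by_cases hx : col x b
    · rw [columnInsert_pass hx] at h
      exact ⟨List.mem_cons_of_mem _ (ih h).1, (ih h).2⟩
    · rw [columnInsert_bump hx] at h
      obtain rfl : x = y := by simpa using h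
      exact ⟨by simp, hx⟩

theorem columnInsert_none {b : Letter m n} {c : List (Letter m n)}
    (h : (columnInsert b c).2 = none) : (columnInsert b c).1 = c ++ [b] := by
  induction c with
  | nil => rfl
  | cons x c ih =>
    by_cases hx : col x b
    · rw [columnInsert_pass hx] at h ⊢
      simp [ih h]
    · rw [columnInsert_bump hx] at h
      simp at h

theorem columnInsert_pairwise {b : Letter m n} {c : List (Letter m n)} (h : c.Pairwise col) :
    (columnInsert b c).1.Pairwise col := by
  induction c with
  | nil => simp [columnInsert]
  | cons x c ih =>
    rw [List.pairwise_cons] at h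
    by_cases hx : col x b
    · rw [columnInsert_pass hx, List.pairwise_cons]
      refine ⟨fun y hy => ?_, ih h.2⟩
      rcases mem_columnInsert hy with rfl | hy
      · exact hx
      · exact h.1 y hy
    · rw [columnInsert_bump hx, List.pairwise_cons]
      exact ⟨fun y hy => (isColumnOrder_col.cotrans (h.1 y hy)).resolve_left hx, h.2⟩

theorem columnInsert_head (b : Letter m n) (c : List (Letter m n)) :
    ∃ h t, (columnInsert b c).1 = h :: t ∧ (h = b ∨ col h b) := by
  cases c with
  | nil => exact ⟨b, [], rfl, Or.inl rfl⟩
  | cons x c =>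
    by_cases hx : col x b
    · exact ⟨x, _, by rw [columnInsert_pass hx], Or.inr hx⟩
    · exact ⟨b, _, by rw [columnInsert_bump hx], Or.inl rfl⟩

/-- If `b` bumps the top entry, this is `Plac.column_snoc`. Otherwise the bumped letter `y` has
reached the place just below the top `x` by induction, and it jumps over `x` by `acb`, with the new
second entry `z` as witness: `z` is `b` or stands above `b`, so that `¬ col y z`. -/
theorem plac_columnInsert {b y : Letter m n} {c : List (Letter m n)} (hc : c.Pairwise col)
    (h : (columnInsert b c).2 = some y) : Plac col (c ++ [b]) (y :: (columnInsert b c).1) := by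
  induction c with
  | nil => simp [columnInsert] at h
  | cons x c ih =>
    by_cases hx : col x b
    · have hp := columnInsert_pairwise (b := b) hc
      have h2 := columnInsert_some h
      rw [columnInsert_pass hx] at h hp ⊢
      have h1 := (ih (List.pairwise_cons.1 hc).2 h).cons x
      obtain ⟨z, t, hz, hzb⟩ := columnInsert_head b c
      rw [hz] at h1 hp
      simp only [hz]
      refine h1.trans (Plac.acb [] t ((List.pairwise_cons.1 hp).1 z (by simp)) ?_).symm
      rcases hzb with rfl | hzb
      · exact h2.2
      · exact fun k => h2.2 (col_trans k hzb)
    · rw [columnInsert_bump hx] at h ⊢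
      obtain rfl : x = y := by simpa using h
      exact Plac.column_snoc isColumnOrder_col hc hx

/-- A list of columns that satisfies the conditions on a tableau. -/
def IsTab (T : Filling m n) : Prop :=
  (∀ c ∈ T, c.Pairwise col ∧ c ≠ []) ∧ T.IsChain (Dom col)

theorem isTab_nil : IsTab ([] : Filling m n) := ⟨by simp, by simp⟩

theorem isTab_cons {c : List (Letter m n)} {T : Filling m n} :
    IsTab (c :: T) ↔ c.Pairwise col ∧ c ≠ [] ∧ Dom col c (T.headD []) ∧ IsTab T := by
  cases T with
  | nil => simp [IsTab]
  | cons d T =>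
    simp only [IsTab, List.mem_cons, forall_eq_or_imp, List.isChain_cons_cons, List.headD_cons]
    tauto

theorem bump_cons_none {b : Letter m n} {c : List (Letter m n)} (T : Filling m n)
    (h : (columnInsert b c).2 = none) : bump (c :: T) b = (c ++ [b]) :: T := by
  rw [← columnInsert_none h]
  rw [bump]
  split <;> simp_all

theorem bump_cons_some {b y : Letter m n} {c : List (Letter m n)} (T : Filling m n)
    (h : (columnInsert b c).2 = some y) :
    bump (c :: T) b = (columnInsert b c).1 :: bump T y := by
  rw [bump]
  split <;> simp_all

theorem bump_headD (T : Filling m n) (b : Letter m n) :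
    (bump T b).headD [] = (columnInsert b (T.headD [])).1 := by
  cases T with
  | nil => rfl
  | cons c T =>
    cases h : (columnInsert b c).2 with
    | none => rw [bump_cons_none T h]; simp [columnInsert_none h]
    | some y => rw [bump_cons_some T h]; simp

theorem Dom.append_right_left {α : Type*} {r : α → α → Prop} {y x : List α} (h : Dom r y x)
    (z : List α) : Dom r (y ++ z) x := by
  induction x generalizing y with
  | nil => simp
  | cons a x ih =>
    cases y with
    | nil => simp at h
    | cons b y => exact ⟨h.1, ih h.2⟩

theorem Dom.columnInsert_left {b y : Letter m n} {c d : List (Letter m n)} (h : Dom col c d)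
    (hy : (columnInsert b c).2 = some y) : Dom col (columnInsert b c).1 d := by
  induction d generalizing c with
  | nil => simp
  | cons z d ih =>
    cases c with
    | nil => simp at h
    | cons x c =>
      by_cases hx : col x b
      · rw [columnInsert_pass hx] at hy ⊢
        exact ⟨h.1, ih h.2 hy⟩
      · rw [columnInsert_bump hx]
        exact ⟨fun k => ((isColumnOrder_col.rowRel).trans (a := b) (b := x) (c := z) hx h.1) k, h.2⟩

/-- The bumped letter `y` enters `d` in its old row or a higher one, since the entry of `d` next to
it, if there is one, does not let it pass. It therefore lands beside `b` or beside an entry that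
stood above it in `c`. -/
theorem Dom.columnInsert {b y : Letter m n} {c d : List (Letter m n)} (hc : c.Pairwise col)
    (h : Dom col c d) (hy : (columnInsert b c).2 = some y) :
    Dom col (columnInsert b c).1 (columnInsert y d).1 := by
  induction c generalizing d with
  | nil => simp [SuperCrystal.columnInsert] at hy
  | cons x c ih =>
    rw [List.pairwise_cons] at hc
    have hyb := columnInsert_some hy
    by_cases hx : col x b
    · have hxy : ¬ col y x := fun k => hyb.2 (col_trans k hx)
      rw [columnInsert_pass hx] at hy ⊢
      cases d with
      | nil => exact ⟨hxy, by simp⟩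
      | cons z d =>
        by_cases hz : col z y
        · rw [columnInsert_pass hz]
          exact ⟨h.1, ih hc.2 h.2 hy⟩
        · rw [columnInsert_bump hz]
          exact ⟨hxy, h.2.columnInsert_left hy⟩
    · rw [columnInsert_bump hx] at hy ⊢
      obtain rfl : x = y := by simpa using hy
      cases d with
      | nil => exact ⟨hx, by simp⟩
      | cons z d =>
        rw [columnInsert_bump h.1]
        exact ⟨hx, h.2⟩

theorem IsTab.bump {T : Filling m n} (h : IsTab T) (b : Letter m n) : IsTab (bump T b) := by
  induction T generalizing b with
  | nil => simp [SuperCrystal.bump, isTab_cons, isTab_nil]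
  | cons c T ih =>
    rw [isTab_cons] at h
    cases hb : (SuperCrystal.columnInsert b c).2 with
    | none =>
      rw [bump_cons_none T hb, isTab_cons, ← columnInsert_none hb]
      refine ⟨columnInsert_pairwise h.1, ?_, ?_, h.2.2.2⟩
      · simp [columnInsert_none hb]
      · rw [columnInsert_none hb]
        exact h.2.2.1.append_right_left _
    | some y =>
      rw [bump_cons_some T hb, isTab_cons, bump_headD]
      refine ⟨columnInsert_pairwise h.1, ?_, h.2.2.1.columnInsert h.1 hb, ih h.2.2.2 y⟩
      obtain ⟨z, t, hz, _⟩ := columnInsert_head b c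
      simp [hz]

@[simp] theorem reading_nil : reading ([] : Filling m n) = [] := rfl

@[simp] theorem reading_cons (c : List (Letter m n)) (T : Filling m n) :
    reading (c :: T) = reading T ++ c := by simp [reading]

theorem plac_reading_bump {T : Filling m n} (h : IsTab T) (b : Letter m n) :
    Plac col (reading T ++ [b]) (reading (bump T b)) := by
  induction T generalizing b with
  | nil => exact .refl _
  | cons c T ih =>
    rw [isTab_cons] at h
    cases hb : (columnInsert b c).2 with
    | none => rw [bump_cons_none T hb]; simpa using Plac.refl _
    | some y =>
      rw [bump_cons_some T hb, reading_cons, reading_cons]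
      have h1 := (plac_columnInsert h.1 hb).append_left (reading T)
      have h2 := (ih h.2.2.2 y).append_right (columnInsert b c).1
      simp only [List.append_assoc, List.cons_append, List.nil_append] at h1 h2 ⊢
      exact h1.trans h2

theorem isTab_foldl_bump {T : Filling m n} (h : IsTab T) (w : List (Letter m n)) :
    IsTab (w.foldl bump T) := by
  induction w generalizing T with
  | nil => exact h
  | cons b w ih => exact ih (h.bump b)

theorem plac_reading_foldl_bump {T : Filling m n} (h : IsTab T) (w : List (Letter m n)) :
    Plac col (reading T ++ w) (reading (w.foldl bump T)) := by
  induction w generalizing T with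
  | nil => simpa using Plac.refl _
  | cons b w ih =>
    have h1 := (plac_reading_bump h b).append_right w
    have h2 := ih (h.bump b)
    simp only [List.append_assoc, List.cons_append, List.nil_append] at h1
    exact h1.trans h2

theorem isTab_P (w : List (Letter m n)) : IsTab (P w) := isTab_foldl_bump isTab_nil w

/-- The reading of `P w` is plactic equivalent to `w`. -/
theorem plac_reading_P (w : List (Letter m n)) : Plac col w (reading (P w)) :=
  plac_reading_foldl_bump isTab_nil w

/-- Insert a word into a column: the new column and the word of the letters bumped. -/
def insertWord : List (Letter m n) → List (Letter m n) → List (Letter m n) × List (Letter m n)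
  | c, [] => (c, [])
  | c, b :: w => ((insertWord (columnInsert b c).1 w).1,
      (columnInsert b c).2.toList ++ (insertWord (columnInsert b c).1 w).2)

theorem insertWord_append (c w w' : List (Letter m n)) :
    insertWord c (w ++ w') = ((insertWord (insertWord c w).1 w').1,
      (insertWord c w).2 ++ (insertWord (insertWord c w).1 w').2) := by
  induction w generalizing c with
  | nil => simp [insertWord]
  | cons b w ih => simp [insertWord, ih]

theorem insertWord_pairwise {c : List (Letter m n)} (h : c.Pairwise col) (w : List (Letter m n)) :
    (insertWord c w).1.Pairwise col := by
  induction w generalizing c with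
  | nil => exact h
  | cons b w ih => exact ih (columnInsert_pairwise h)

theorem length_insertWord (c w : List (Letter m n)) : (insertWord c w).2.length ≤ w.length := by
  induction w generalizing c with
  | nil => simp [insertWord]
  | cons b w ih =>
    have := ih (columnInsert b c).1
    have h2 : (columnInsert b c).2.toList.length ≤ 1 := by cases (columnInsert b c).2 <;> simp
    simp only [insertWord, List.length_append, List.length_cons]
    omega

/-- The first column depends only on `w`, and the remaining columns receive only the word of bumped
letters. Invariance under `Plac` can thus be proved one column at a time. -/
theorem foldl_bump_cons (c : List (Letter m n)) (T : Filling m n) (w : List (Letter m n)) :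
    w.foldl bump (c :: T) = (insertWord c w).1 :: (insertWord c w).2.foldl bump T := by
  induction w generalizing c T with
  | nil => rfl
  | cons b w ih =>
    rw [List.foldl_cons]
    cases hb : (columnInsert b c).2 with
    | none =>
      rw [bump_cons_none T hb, ← columnInsert_none hb, ih]
      simp [insertWord, hb]
    | some y =>
      rw [bump_cons_some T hb, ih]
      simp [insertWord, hb]

theorem foldl_bump_nil (b : Letter m n) (w : List (Letter m n)) :
    (b :: w).foldl bump [] =
      (insertWord [] (b :: w)).1 :: (insertWord [] (b :: w)).2.foldl bump [] := by
  rw [List.foldl_cons, bump, foldl_bump_cons]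
  rfl

/-- The letter `b` cannot pass `d`, so it stops where `d` was placed or above, and it necessarily
bumps something. -/
theorem exists_some_of_not_col {b d y : Letter m n} {c : List (Letter m n)} (hc : c.Pairwise col)
    (hdb : ¬ col d b) (hy : (columnInsert d c).2 = some y) :
    ∃ z, (columnInsert b (columnInsert d c).1).2 = some z ∧ ¬ col y z ∧ (z = d ∨ z ∈ c) := by
  induction c with
  | nil => simp [columnInsert] at hy
  | cons w c ih =>
    rw [List.pairwise_cons] at hc
    have hyd := columnInsert_some hy
    by_cases hw : col w d
    · rw [columnInsert_pass hw] at hy ⊢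
      by_cases hwb : col w b
      · obtain ⟨z, hz, h1, h2⟩ := ih hc.2 hy
        exact ⟨z, by rw [columnInsert_pass hwb]; exact hz, h1, by simp; tauto⟩
      · exact ⟨w, by rw [columnInsert_bump hwb], fun k => hyd.2 (col_trans k hw), by simp⟩
    · rw [columnInsert_bump hw] at hy ⊢
      obtain rfl : w = y := by simpa using hy
      exact ⟨d, by rw [columnInsert_bump hdb], hw, by simp⟩

/-- The letter `d` passes everything that `b` passes and then `b` itself, so it stops strictly below
`b`. If it still bumps a letter, then `b` has bumped one from higher up in the same column. -/
theorem exists_some_of_col {b d z : Letter m n} {c : List (Letter m n)} (hc : c.Pairwise col)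
    (hbd : col b d) (hz : (columnInsert d (columnInsert b c).1).2 = some z) :
    ∃ y, (columnInsert b c).2 = some y ∧ col y z := by
  induction c with
  | nil =>
    simp only [columnInsert] at hz
    rw [if_neg (fun k => not_col.2 k hbd)] at hz
    simp at hz
  | cons w c ih =>
    rw [List.pairwise_cons] at hc
    by_cases hw : col w b
    · rw [columnInsert_pass hw] at hz ⊢
      rw [columnInsert_pass (col_trans hw hbd)] at hz
      exact ih hc.2 hz
    · rw [columnInsert_bump hw] at hz ⊢
      rw [columnInsert_pass hbd] at hz
      exact ⟨w, rfl, hc.1 z (columnInsert_some hz).1⟩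

/-- Entries that let `a` pass are passed by all three letters. Let `x` be the first entry that stops
`a`. If `x` lets `d` pass and `d` bumps `y`, the bumped words are `y x z` and `x y z`, related by
`acb`. If `x` stops `d` too and `w` is the entry below `x`, they are `x d w` and `x w d`, related by
`bac`: the kind of relation may change. When fewer letters are bumped the words coincide. -/
theorem insertWord_acb {c : List (Letter m n)} (hc : c.Pairwise col) {a b d : Letter m n}
    (h1 : col a b) (h2 : ¬ col d b) :
    (insertWord c [d, a, b]).1 = (insertWord c [a, d, b]).1 ∧
      Plac col (insertWord c [d, a, b]).2 (insertWord c [a, d, b]).2 := by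
  have had : col a d := (isColumnOrder_col.cotrans h1).resolve_right h2
  have hda : ¬ col d a := fun k => h2 (col_trans k h1)
  simp only [insertWord, List.append_nil]
  induction c with
  | nil =>
    have e1 : columnInsert d ([] : List (Letter m n)) = ([d], none) := rfl
    have e2 : columnInsert a ([] : List (Letter m n)) = ([a], none) := rfl
    have e3 : columnInsert b ([] : List (Letter m n)) = ([b], none) := rfl
    simp [e1, e2, e3, columnInsert_bump hda, columnInsert_pass had, columnInsert_pass h1,
      columnInsert_bump h2, Plac.refl]
  | cons x c ih =>
    rw [List.pairwise_cons] at hc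
    by_cases hxa : col x a
    · have hxb := col_trans hxa h1
      have hxd := col_trans hxa had
      simpa only [columnInsert_pass hxa, columnInsert_pass hxb, columnInsert_pass hxd,
        List.cons.injEq, true_and] using ih hc.2
    by_cases hxd : col x d
    · simp only [columnInsert_pass hxd, columnInsert_bump hxa, columnInsert_pass h1,
        columnInsert_pass had, true_and]
      cases hy : (columnInsert d c).2 with
      | none => simpa using Plac.refl _
      | some y =>
        obtain ⟨z, hz, h3, h4⟩ := exists_some_of_not_col hc.2 h2 hy
        rw [hz]
        refine Plac.acb [] [] ?_ h3
        rcases h4 with rfl | h4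
        · exact hxd
        · exact hc.1 z h4
    · have hxb : ¬ col x b := fun k => by
        rcases isColumnOrder_col.cotrans (b := d) k with k | k
        · exact hxd k
        · exact h2 k
      simp only [columnInsert_bump hxd, columnInsert_bump hda, columnInsert_pass h1,
        columnInsert_bump hxa, columnInsert_pass had]
      cases c with
      | nil =>
        have e1 : columnInsert d ([] : List (Letter m n)) = ([d], none) := rfl
        have e3 : columnInsert b ([] : List (Letter m n)) = ([b], none) := rfl
        simp [e1, e3, columnInsert_bump h2, Plac.refl]
      | cons w c =>
        have hxw : col x w := hc.1 w (by simp)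
        have hwd : ¬ col w d := fun k => hxd (col_trans hxw k)
        have hwb : ¬ col w b := fun k => hxb (col_trans hxw k)
        simp only [columnInsert_bump hwd, columnInsert_bump hwb, columnInsert_bump h2, true_and]
        exact Plac.bac [] [] hxd hxw

theorem insertWord_bac {c : List (Letter m n)} (hc : c.Pairwise col) {a b d : Letter m n}
    (h1 : ¬ col b a) (h2 : col b d) :
    (insertWord c [b, a, d]).1 = (insertWord c [b, d, a]).1 ∧
      Plac col (insertWord c [b, a, d]).2 (insertWord c [b, d, a]).2 := by
  have had : col a d := (isColumnOrder_col.cotrans h2).resolve_left h1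
  simp only [insertWord, List.append_nil]
  induction c with
  | nil =>
    have e1 : columnInsert d ([] : List (Letter m n)) = ([d], none) := rfl
    have e3 : columnInsert b ([] : List (Letter m n)) = ([b], none) := rfl
    simp [e1, e3, columnInsert_bump h1, columnInsert_pass had, columnInsert_pass h2, Plac.refl]
  | cons x c ih =>
    rw [List.pairwise_cons] at hc
    by_cases hxa : col x a
    · have hxb : col x b := (isColumnOrder_col.cotrans hxa).resolve_right h1
      have hxd := col_trans hxa had
      simpa only [columnInsert_pass hxa, columnInsert_pass hxb, columnInsert_pass hxd,
        List.cons.injEq, true_and] using ih hc.2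
    by_cases hxb : col x b
    · have hxd := col_trans hxb h2
      simp only [columnInsert_pass hxd, columnInsert_pass hxb, columnInsert_bump hxa,
        columnInsert_pass had, true_and]
      cases hz : (columnInsert d (columnInsert b c).1).2 with
      | none => simpa using Plac.refl _
      | some z =>
        obtain ⟨y, hy, h3⟩ := exists_some_of_col hc.2 h2 hz
        rw [hy]
        exact Plac.bac [] [] (fun k => (columnInsert_some hy).2 (col_trans k hxb)) h3
    · simp only [columnInsert_bump hxb, columnInsert_bump h1, columnInsert_pass had,
        columnInsert_pass h2, true_and]
      cases hz : (columnInsert d c).2 with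
      | none => simpa using Plac.refl _
      | some z => exact Plac.bac [] [] hxb (hc.1 z (columnInsert_some hz).1)

theorem Plac.insertWord {w w' : List (Letter m n)} (h : Plac col w w') {c : List (Letter m n)}
    (hc : c.Pairwise col) : (insertWord c w).1 = (insertWord c w').1 ∧
      Plac col (insertWord c w).2 (insertWord c w').2 := by
  have key : ∀ p q t t' : List (Letter m n),
      (∀ c : List (Letter m n), c.Pairwise col →
        (SuperCrystal.insertWord c t).1 = (SuperCrystal.insertWord c t').1 ∧
        Plac col (SuperCrystal.insertWord c t).2 (SuperCrystal.insertWord c t').2) →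
      (SuperCrystal.insertWord c (p ++ (t ++ q))).1 =
        (SuperCrystal.insertWord c (p ++ (t' ++ q))).1 ∧
      Plac col (SuperCrystal.insertWord c (p ++ (t ++ q))).2
        (SuperCrystal.insertWord c (p ++ (t' ++ q))).2 := by
    intro p q t t' ht
    have := ht _ (insertWord_pairwise hc p)
    simp only [insertWord_append, this.1, true_and]
    exact (this.2.append_right _).append_left _
  induction h with
  | refl w => exact ⟨rfl, .refl _⟩
  | symm _ ih => exact ⟨ih.1.symm, ih.2.symm⟩
  | trans _ _ ih1 ih2 => exact ⟨ih1.1.trans ih2.1, ih1.2.trans ih2.2⟩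
  | @acb p q a b d h1 h2 => exact key p q [d, a, b] [a, d, b] fun c hc => insertWord_acb hc h1 h2
  | @bac p q a b d h1 h2 => exact key p q [b, a, d] [b, d, a] fun c hc => insertWord_bac hc h1 h2

/-- Induction on the number of columns plus the number of letters. Passing to the next column
removes a column or, when none is left, a letter, because the first letter then starts a new column
and bumps nothing. -/
theorem Plac.foldl_bump (N : ℕ) {T : Filling m n} {w w' : List (Letter m n)}
    (hN : T.length + w.length ≤ N) (hT : ∀ c ∈ T, c.Pairwise col) (h : Plac col w w') :
    w.foldl bump T = w'.foldl bump T := by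
  induction N generalizing T w w' with
  | zero =>
    have h1 : w = [] := List.length_eq_zero_iff.1 (by omega)
    have h2 : w' = [] := List.length_eq_zero_iff.1 (by rw [← h.length_eq]; omega)
    rw [h1, h2]
  | succ N ih =>
    cases T with
    | cons c T =>
      have h1 := h.insertWord (hT c (by simp))
      have := length_insertWord c w
      rw [foldl_bump_cons, foldl_bump_cons, h1.1]
      rw [ih (by simp at hN; omega) (fun d hd => hT d (by simp [hd])) h1.2]
    | nil =>
      cases w with
      | nil => rw [List.length_eq_zero_iff.1 h.length_eq.symm]
      | cons b w =>
        cases w' with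
        | nil => simpa using h.length_eq
        | cons b' w' =>
          have h1 := h.insertWord (c := []) (by simp)
          have h2 : (SuperCrystal.insertWord [] (b :: w)).2.length ≤ w.length := by
            simpa [SuperCrystal.insertWord, columnInsert] using length_insertWord [b] w
          rw [foldl_bump_nil, foldl_bump_nil, h1.1]
          rw [ih (by simp at hN ⊢; omega) (by simp) h1.2]

/-- Plactic equivalent words have the same insertion tableau. -/
theorem Plac.P_eq {w w' : List (Letter m n)} (h : Plac col w w') : P w = P w' :=
  h.foldl_bump _ le_rfl (by simp)

theorem insertWord_pass {x : Letter m n} {w : List (Letter m n)} (h : ∀ b ∈ w, col x b)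
    (c : List (Letter m n)) :
    insertWord (x :: c) w = (x :: (insertWord c w).1, (insertWord c w).2) := by
  induction w generalizing c with
  | nil => rfl
  | cons b w ih =>
    rw [insertWord, columnInsert_pass (h b (by simp)), ih (fun y hy => h y (by simp [hy]))]
    rfl

/-- Each letter of `c` passes the letters of `c` inserted before it and bumps the entry of `d` in
its own row, so that `d` comes out in its order and can be reinserted in the next column. -/
theorem insertWord_of_dom {c d : List (Letter m n)} (hc : c.Pairwise col) (h : Dom col c d) :
    insertWord d c = (c, d) := by
  induction c generalizing d with
  | nil =>
    cases d with
    | nil => rfl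
    | cons x d => simp at h
  | cons y c ih =>
    rw [List.pairwise_cons] at hc
    cases d with
    | nil =>
      have e := ih hc.2 (d := []) (by simp)
      simp [insertWord, columnInsert, insertWord_pass hc.1, e]
    | cons x d =>
      simp [insertWord, columnInsert_bump h.1, insertWord_pass hc.1, ih hc.2 h.2]

theorem foldl_bump_column {c : List (Letter m n)} {T : Filling m n} (h : IsTab (c :: T)) :
    c.foldl bump T = c :: T := by
  induction T generalizing c with
  | nil =>
    rw [isTab_cons] at h
    cases c with
    | nil => simp at h
    | cons b c => rw [foldl_bump_nil, insertWord_of_dom h.1 (by simp)]; rfl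
  | cons d T ih =>
    rw [isTab_cons] at h
    rw [foldl_bump_cons, insertWord_of_dom h.1 (d := d) h.2.2.1]
    simp [ih h.2.2.2]

/-- The insertion tableau of the reading of `T` is `T`. -/
theorem P_reading {T : Filling m n} (h : IsTab T) : P (reading T) = T := by
  induction T with
  | nil => rfl
  | cons c T ih =>
    have h' := (isTab_cons.1 h).2.2.2
    have e : P (reading T) = T := ih h'
    unfold P at e
    rw [reading_cons, P, List.foldl_append, e, foldl_bump_column h]

/-- A word is equivalent to the reading of its tableau, and equivalent words have equal tableaux.
From here on tableaux and plactic classes are interchangeable. -/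
theorem P_eq_iff {w w' : List (Letter m n)} : P w = P w' ↔ Plac col w w' :=
  ⟨fun h => (plac_reading_P w).trans (h ▸ (plac_reading_P w').symm), fun h => h.P_eq⟩

end Insertion

end SuperCrystal

namespace SuperCrystal

/-! ### The signature rule on words -/

section WordCrystal

variable {m n : ℕ}

theorem coroot_add (i : Node m n) (x y : Weight m n) :
    coroot i (x + y) = coroot i x + coroot i y := by
  simp only [coroot, form, Pi.add_apply, mul_add, Finset.sum_add_distrib]
  split_ifs <;> ring

theorem coroot_zero (i : Node m n) : coroot i (0 : Weight m n) = 0 := by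
  simp [coroot, form]

theorem src_ne_tgt (i : Node m n) : src i ≠ tgt i := by simp [src, tgt]

theorem tgt_ne_src (i : Node m n) : tgt i ≠ src i := (src_ne_tgt i).symm

theorem coroot_single_of_ne {i : Node m n} {b : Letter m n} (h1 : b ≠ src i) (h2 : b ≠ tgt i) :
    coroot i (Pi.single b 1) = 0 := by
  have : form (root i) (Pi.single b 1) = 0 := by
    refine Finset.sum_eq_zero fun c _ => ?_
    by_cases hc : c = b
    · subst hc; simp [root, h1, h2]
    · simp [hc]
  simp [coroot, this]

/-- The number of arrows of colour `i` into the letter `b`. -/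
def le (i : Node m n) (b : Letter m n) : ℕ := if b = tgt i then 1 else 0

/-- The number of arrows of colour `i` out of the letter `b`. -/
def lf (i : Node m n) (b : Letter m n) : ℕ := if b = src i then 1 else 0

theorem le_lf_cases (i : Node m n) (b : Letter m n) :
    (b = src i ∧ le i b = 0 ∧ lf i b = 1) ∨ (b = tgt i ∧ le i b = 1 ∧ lf i b = 0) ∨
      (b ≠ src i ∧ b ≠ tgt i ∧ le i b = 0 ∧ lf i b = 0) := by
  have := src_ne_tgt i
  unfold le lf
  by_cases h1 : b = src i
  · subst h1; simp [this]
  · by_cases h2 : b = tgt i <;> simp [h1, h2, this.symm]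

theorem coroot_single (i : Node m n) (b : Letter m n) :
    coroot i (Pi.single b 1) =
      if i.val + 1 = m then (lf i b + le i b : ℤ) else (lf i b - le i b : ℤ) := by
  rcases le_lf_cases i b with ⟨rfl, h1, h2⟩ | ⟨rfl, h1, h2⟩ | ⟨h3, h4, h1, h2⟩
  · rw [coroot_single_src, h1, h2]; simp
  · rw [coroot_single_tgt, h1, h2]; simp
  · rw [coroot_single_of_ne h3 h4, h1, h2]; simp

@[simp] theorem letterCrystal_eps (i : Node m n) (b : Letter m n) :
    (letterCrystal m n).eps i b = le i b := rfl

@[simp] theorem letterCrystal_phi (i : Node m n) (b : Letter m n) :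
    (letterCrystal m n).phi i b = lf i b := rfl

@[simp] theorem letterCrystal_wt (b : Letter m n) :
    (letterCrystal m n).wt b = Pi.single b 1 := rfl

@[simp] theorem word_eps_nil (i : Node m n) : (wordCrystal m n).eps i [] = 0 := rfl

@[simp] theorem word_phi_nil (i : Node m n) : (wordCrystal m n).phi i [] = 0 := rfl

@[simp] theorem word_wt_nil : (wordCrystal m n).wt [] = 0 := rfl

theorem word_wt_cons (b : Letter m n) (w : List (Letter m n)) :
    (wordCrystal m n).wt (b :: w) = Pi.single b 1 + (wordCrystal m n).wt w := rfl

theorem word_wt_append (u v : List (Letter m n)) :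
    (wordCrystal m n).wt (u ++ v) = (wordCrystal m n).wt u + (wordCrystal m n).wt v := by
  induction u with
  | nil => simp
  | cons b u ih => rw [List.cons_append, word_wt_cons, ih, word_wt_cons, add_assoc]

theorem word_wt_eq_count (w : List (Letter m n)) (b : Letter m n) :
    (wordCrystal m n).wt w b = w.count b := by
  induction w with
  | nil => simp
  | cons a w ih =>
    rw [word_wt_cons, Pi.add_apply, ih, List.count_cons]
    by_cases h : a = b
    · subst h; simp; ring
    · simp [h, Ne.symm h]

theorem word_phi_sub_eps {i : Node m n} (h : i.val + 1 ≠ m) (w : List (Letter m n)) :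
    ((wordCrystal m n).phi i w : ℤ) - (wordCrystal m n).eps i w =
      coroot i ((wordCrystal m n).wt w) := by
  induction w with
  | nil => simp [coroot_zero]
  | cons b w ih =>
    rw [word_wt_cons, coroot_add, ← ih, wordCrystal_phi_cons, wordCrystal_eps_cons]
    simp only [CrystalData.tensor, letterCrystal_eps, letterCrystal_phi, letterCrystal_wt, ← ih,
      coroot_single, if_neg h]
    split_ifs <;> omega

/-- Truncated subtraction on `ℕ` expresses the cancellation of brackets: at a barred node a `src i`
cancels an uncancelled `tgt i` on its right. At the nodes treated in `word_cons_odd` the roles of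
the two letters are exchanged. -/
theorem word_cons_barred {i : Node m n} (h : i.val + 1 < m) (b : Letter m n)
    (w : List (Letter m n)) :
    (wordCrystal m n).eps i (b :: w) = le i b + ((wordCrystal m n).eps i w - lf i b) ∧
    (wordCrystal m n).phi i (b :: w) =
      (wordCrystal m n).phi i w + (lf i b - (wordCrystal m n).eps i w) := by
  have h' : i.val + 1 ≠ m := by omega
  rw [wordCrystal_phi_cons, wordCrystal_eps_cons]
  simp only [CrystalData.tensor, letterCrystal_eps, letterCrystal_phi, letterCrystal_wt,
    ← word_phi_sub_eps h', coroot_single, if_neg h', if_pos h]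
  omega

theorem word_cons_odd {i : Node m n} (h : m < i.val + 1) (b : Letter m n)
    (w : List (Letter m n)) :
    (wordCrystal m n).eps i (b :: w) =
      (wordCrystal m n).eps i w + (le i b - (wordCrystal m n).phi i w) ∧
    (wordCrystal m n).phi i (b :: w) = lf i b + ((wordCrystal m n).phi i w - le i b) := by
  have h' : i.val + 1 ≠ m := by omega
  have h'' : ¬ i.val + 1 < m := by omega
  rw [wordCrystal_phi_cons, wordCrystal_eps_cons]
  simp only [CrystalData.tensor, letterCrystal_eps, letterCrystal_phi, letterCrystal_wt,
    ← word_phi_sub_eps h', coroot_single, if_neg h', if_pos h, if_neg h'']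
  omega

theorem word_cons_zero {i : Node m n} (h : i.val + 1 = m) (b : Letter m n)
    (w : List (Letter m n)) :
    (wordCrystal m n).eps i (b :: w) =
      (if le i b + lf i b = 0 then (wordCrystal m n).eps i w else le i b) ∧
    (wordCrystal m n).phi i (b :: w) =
      (if le i b + lf i b = 0 then (wordCrystal m n).phi i w else lf i b) := by
  have h' : ¬ i.val + 1 < m := by omega
  have h'' : ¬ m < i.val + 1 := by omega
  rw [wordCrystal_phi_cons, wordCrystal_eps_cons]
  simp only [CrystalData.tensor, letterCrystal_eps, letterCrystal_phi, letterCrystal_wt,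
    coroot_single, if_pos h, if_neg h', if_neg h'']
  rcases le_lf_cases i b with ⟨-, h1, h2⟩ | ⟨-, h1, h2⟩ | ⟨-, -, h1, h2⟩ <;> simp [h1, h2]

theorem word_append_barred {i : Node m n} (h : i.val + 1 < m) (u v : List (Letter m n)) :
    (wordCrystal m n).eps i (u ++ v) = (wordCrystal m n).eps i u +
      ((wordCrystal m n).eps i v - (wordCrystal m n).phi i u) ∧
    (wordCrystal m n).phi i (u ++ v) =
      (wordCrystal m n).phi i v + ((wordCrystal m n).phi i u - (wordCrystal m n).eps i v) := by
  induction u with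
  | nil => simp
  | cons b u ih =>
    rw [List.cons_append]
    have h1 := word_cons_barred h b u
    have h2 := word_cons_barred h b (u ++ v)
    omega

theorem word_append_odd {i : Node m n} (h : m < i.val + 1) (u v : List (Letter m n)) :
    (wordCrystal m n).eps i (u ++ v) = (wordCrystal m n).eps i v +
      ((wordCrystal m n).eps i u - (wordCrystal m n).phi i v) ∧
    (wordCrystal m n).phi i (u ++ v) =
      (wordCrystal m n).phi i u + ((wordCrystal m n).phi i v - (wordCrystal m n).eps i u) := by
  induction u with
  | nil => simp
  | cons b u ih =>
    rw [List.cons_append]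
    have h1 := word_cons_odd h b u
    have h2 := word_cons_odd h b (u ++ v)
    omega

theorem word_append_zero {i : Node m n} (h : i.val + 1 = m) (u v : List (Letter m n)) :
    (wordCrystal m n).eps i (u ++ v) =
      (if (wordCrystal m n).eps i u + (wordCrystal m n).phi i u = 0 then
        (wordCrystal m n).eps i v else (wordCrystal m n).eps i u) ∧
    (wordCrystal m n).phi i (u ++ v) =
      (if (wordCrystal m n).eps i u + (wordCrystal m n).phi i u = 0 then
        (wordCrystal m n).phi i v else (wordCrystal m n).phi i u) := by
  induction u with
  | nil => simp
  | cons b u ih =>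
    rw [List.cons_append]
    have h1 := word_cons_zero h b u
    have h2 := word_cons_zero h b (u ++ v)
    rcases le_lf_cases i b with ⟨-, h3, h4⟩ | ⟨-, h3, h4⟩ | ⟨-, -, h3, h4⟩ <;>
      simp_all

/-- The condition for `e_i` and `f_i` to act on the letter between `u` and `v`. -/
def Acts (i : Node m n) (u v : List (Letter m n)) : Prop :=
  (i.val + 1 < m → (wordCrystal m n).phi i u = 0 ∧ (wordCrystal m n).eps i v = 0) ∧
  (m < i.val + 1 → (wordCrystal m n).eps i u = 0 ∧ (wordCrystal m n).phi i v = 0) ∧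
  (i.val + 1 = m → (wordCrystal m n).eps i u = 0 ∧ (wordCrystal m n).phi i u = 0)

theorem le_src (i : Node m n) : le i (src i) = 0 := by simp [le, src_ne_tgt]
theorem le_tgt (i : Node m n) : le i (tgt i) = 1 := by simp [le]
theorem lf_src (i : Node m n) : lf i (src i) = 1 := by simp [lf]
theorem lf_tgt (i : Node m n) : lf i (tgt i) = 0 := by simp [lf, tgt_ne_src]

/-- `e_i` acts on the first letter of `b :: w`. -/
def EFirst (i : Node m n) (b : Letter m n) (w : List (Letter m n)) : Prop :=
  (i.val + 1 < m ∧ (wordCrystal m n).eps i w ≤ lf i b) ∨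
  (m < i.val + 1 ∧ (wordCrystal m n).phi i w < le i b) ∨ (i.val + 1 = m ∧ 0 < le i b + lf i b)

/-- `f_i` acts on the first letter of `b :: w`. -/
def FFirst (i : Node m n) (b : Letter m n) (w : List (Letter m n)) : Prop :=
  (i.val + 1 < m ∧ (wordCrystal m n).eps i w < lf i b) ∨
  (m < i.val + 1 ∧ (wordCrystal m n).phi i w ≤ le i b) ∨ (i.val + 1 = m ∧ 0 < le i b + lf i b)

theorem word_e_cons_of_first {i : Node m n} {b : Letter m n} {w : List (Letter m n)}
    (h : EFirst i b w) :
    (wordCrystal m n).e i (b :: w) = if b = tgt i then some (src i :: w) else none := by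
  rw [wordCrystal_e_cons]
  simp only [CrystalData.tensor, letterCrystal_eps, letterCrystal_phi, letterCrystal_wt,
    coroot_single]
  rw [if_pos]
  · simp only [letterCrystal]
    split_ifs <;> rfl
  · rcases h with h | h | h
    · exact Or.inl h
    · exact Or.inr (Or.inl h)
    · refine Or.inr (Or.inr ⟨h.1, ?_⟩)
      rw [if_pos h.1]; omega

theorem word_e_cons_of_not_first {i : Node m n} {b : Letter m n} {w : List (Letter m n)}
    (h : ¬ EFirst i b w) :
    (wordCrystal m n).e i (b :: w) = ((wordCrystal m n).e i w).map (b :: ·) := by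
  rw [wordCrystal_e_cons]
  simp only [CrystalData.tensor, letterCrystal_eps, letterCrystal_phi, letterCrystal_wt,
    coroot_single]
  rw [if_neg, Option.map_map]
  · rfl
  · rintro (k | k | k)
    · exact h (Or.inl k)
    · exact h (Or.inr (Or.inl k))
    · refine h (Or.inr (Or.inr ⟨k.1, ?_⟩))
      rw [if_pos k.1] at k; omega

theorem word_f_cons_of_first {i : Node m n} {b : Letter m n} {w : List (Letter m n)}
    (h : FFirst i b w) :
    (wordCrystal m n).f i (b :: w) = if b = src i then some (tgt i :: w) else none := by
  rw [wordCrystal_f_cons]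
  simp only [CrystalData.tensor, letterCrystal_eps, letterCrystal_phi, letterCrystal_wt,
    coroot_single]
  rw [if_pos]
  · simp only [letterCrystal]
    split_ifs <;> rfl
  · rcases h with h | h | h
    · exact Or.inl h
    · exact Or.inr (Or.inl h)
    · refine Or.inr (Or.inr ⟨h.1, ?_⟩)
      rw [if_pos h.1]; omega

theorem word_f_cons_of_not_first {i : Node m n} {b : Letter m n} {w : List (Letter m n)}
    (h : ¬ FFirst i b w) :
    (wordCrystal m n).f i (b :: w) = ((wordCrystal m n).f i w).map (b :: ·) := by
  rw [wordCrystal_f_cons]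
  simp only [CrystalData.tensor, letterCrystal_eps, letterCrystal_phi, letterCrystal_wt,
    coroot_single]
  rw [if_neg, Option.map_map]
  · rfl
  · rintro (k | k | k)
    · exact h (Or.inl k)
    · exact h (Or.inr (Or.inl k))
    · refine h (Or.inr (Or.inr ⟨k.1, ?_⟩))
      rw [if_pos k.1] at k; omega

/-- The values of `ε_i` and `φ_i` around the letter on which `e_i` or `f_i` acts. -/
theorem Acts.values {i : Node m n} {u v : List (Letter m n)} (h : Acts i u v) :
    (wordCrystal m n).eps i (u ++ tgt i :: v) = (wordCrystal m n).eps i (u ++ src i :: v) + 1 ∧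
    (wordCrystal m n).phi i (u ++ src i :: v) = (wordCrystal m n).phi i (u ++ tgt i :: v) + 1 ∧
    (i.val + 1 < m → (wordCrystal m n).eps i (u ++ src i :: v) = (wordCrystal m n).eps i u) ∧
    (m < i.val + 1 → (wordCrystal m n).phi i (u ++ tgt i :: v) = (wordCrystal m n).phi i u) := by
  have k1 := le_src i
  have k2 := le_tgt i
  have k3 := lf_src i
  have k4 := lf_tgt i
  rcases lt_trichotomy (i.val + 1) m with hi | hi | hi
  · have h0 := h.1 hi
    have h1 := word_append_barred hi u (tgt i :: v)
    have h2 := word_append_barred hi u (src i :: v)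
    have h3 := word_cons_barred hi (tgt i) v
    have h4 := word_cons_barred hi (src i) v
    omega
  · have h0 := h.2.2 hi
    have h1 := word_append_zero hi u (tgt i :: v)
    have h2 := word_append_zero hi u (src i :: v)
    have h3 := word_cons_zero hi (tgt i) v
    have h4 := word_cons_zero hi (src i) v
    rw [if_pos (by omega), if_pos (by omega)] at h1 h2
    rw [if_neg (by omega), if_neg (by omega)] at h3 h4
    omega
  · have h0 := h.2.1 hi
    have h1 := word_append_odd hi u (tgt i :: v)
    have h2 := word_append_odd hi u (src i :: v)
    have h3 := word_cons_odd hi (tgt i) v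
    have h4 := word_cons_odd hi (src i) v
    omega

theorem acts_cons_iff_e {i : Node m n} {u v : List (Letter m n)} (b : Letter m n) :
    Acts i (b :: u) v ↔ ¬ EFirst i b (u ++ tgt i :: v) ∧ Acts i u v := by
  have k1 := le_src i
  have k2 := le_tgt i
  have k3 := lf_src i
  have k4 := lf_tgt i
  unfold Acts EFirst
  rcases lt_trichotomy (i.val + 1) m with hi | hi | hi
  · have h1 := word_append_barred hi u (tgt i :: v)
    have h3 := word_cons_barred hi (tgt i) v
    have h4 := word_cons_barred hi b u
    omega
  · have h4 := word_cons_zero hi b u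
    split_ifs at h4 <;> omega
  · have h1 := word_append_odd hi u (tgt i :: v)
    have h3 := word_cons_odd hi (tgt i) v
    have h4 := word_cons_odd hi b u
    omega

theorem acts_cons_iff_f {i : Node m n} {u v : List (Letter m n)} (b : Letter m n) :
    Acts i (b :: u) v ↔ ¬ FFirst i b (u ++ src i :: v) ∧ Acts i u v := by
  have k1 := le_src i
  have k2 := le_tgt i
  have k3 := lf_src i
  have k4 := lf_tgt i
  unfold Acts FFirst
  rcases lt_trichotomy (i.val + 1) m with hi | hi | hi
  · have h1 := word_append_barred hi u (src i :: v)
    have h3 := word_cons_barred hi (src i) v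
    have h4 := word_cons_barred hi b u
    omega
  · have h4 := word_cons_zero hi b u
    split_ifs at h4 <;> omega
  · have h1 := word_append_odd hi u (src i :: v)
    have h3 := word_cons_odd hi (src i) v
    have h4 := word_cons_odd hi b u
    omega

theorem acts_nil_iff_e {i : Node m n} {v : List (Letter m n)} :
    Acts i [] v ↔ EFirst i (tgt i) v := by
  have k2 := le_tgt i
  have k4 := lf_tgt i
  unfold Acts EFirst
  rw [word_phi_nil, word_eps_nil]
  rcases lt_trichotomy (i.val + 1) m with hi | hi | hi <;> omega

theorem acts_nil_iff_f {i : Node m n} {v : List (Letter m n)} :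
    Acts i [] v ↔ FFirst i (src i) v := by
  have k2 := le_src i
  have k4 := lf_src i
  unfold Acts FFirst
  rw [word_phi_nil, word_eps_nil]
  rcases lt_trichotomy (i.val + 1) m with hi | hi | hi <;> omega

/-- The condition `Acts` concerns only the two sides of the changed letter, not the letter itself,
so the same condition governs f_i. This makes e_i and f_i inverse to each other, and it allows the
action to be located inside tableaux and biwords. -/
theorem word_e_eq_some_iff {i : Node m n} {w w' : List (Letter m n)} :
    (wordCrystal m n).e i w = some w' ↔
      ∃ u v, w = u ++ tgt i :: v ∧ w' = u ++ src i :: v ∧ Acts i u v := by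
  induction w generalizing w' with
  | nil => simp [word_e_nil]
  | cons b w ih =>
    constructor
    · intro h
      by_cases hf : EFirst i b w
      · rw [word_e_cons_of_first hf] at h
        split_ifs at h with hb
        subst hb
        exact ⟨[], w, rfl, by simpa using h.symm, acts_nil_iff_e.2 hf⟩
      · rw [word_e_cons_of_not_first hf, Option.map_eq_some_iff] at h
        obtain ⟨t, ht, rfl⟩ := h
        obtain ⟨u, v, rfl, rfl, h⟩ := ih.1 ht
        exact ⟨b :: u, v, rfl, rfl, (acts_cons_iff_e b).2 ⟨hf, h⟩⟩
    · rintro ⟨u, v, h1, rfl, h⟩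
      cases u with
      | nil =>
        obtain ⟨rfl, rfl⟩ := List.cons.inj h1
        rw [word_e_cons_of_first (acts_nil_iff_e.1 h), if_pos rfl]
        rfl
      | cons a u =>
        rw [List.cons_append, List.cons.injEq] at h1
        obtain ⟨rfl, rfl⟩ := h1
        rw [acts_cons_iff_e] at h
        exact (word_e_cons_of_not_first h.1).trans (by rw [ih.2 ⟨u, v, rfl, rfl, h.2⟩]; rfl)

theorem word_f_eq_some_iff {i : Node m n} {w w' : List (Letter m n)} :
    (wordCrystal m n).f i w = some w' ↔
      ∃ u v, w = u ++ src i :: v ∧ w' = u ++ tgt i :: v ∧ Acts i u v := by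
  induction w generalizing w' with
  | nil => simp [word_f_nil]
  | cons b w ih =>
    constructor
    · intro h
      by_cases hf : FFirst i b w
      · rw [word_f_cons_of_first hf] at h
        split_ifs at h with hb
        subst hb
        exact ⟨[], w, rfl, by simpa using h.symm, acts_nil_iff_f.2 hf⟩
      · rw [word_f_cons_of_not_first hf, Option.map_eq_some_iff] at h
        obtain ⟨t, ht, rfl⟩ := h
        obtain ⟨u, v, rfl, rfl, h⟩ := ih.1 ht
        exact ⟨b :: u, v, rfl, rfl, (acts_cons_iff_f b).2 ⟨hf, h⟩⟩
    · rintro ⟨u, v, h1, rfl, h⟩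
      cases u with
      | nil =>
        obtain ⟨rfl, rfl⟩ := List.cons.inj h1
        rw [word_f_cons_of_first (acts_nil_iff_f.1 h), if_pos rfl]
        rfl
      | cons a u =>
        rw [List.cons_append, List.cons.injEq] at h1
        obtain ⟨rfl, rfl⟩ := h1
        rw [acts_cons_iff_f] at h
        exact (word_f_cons_of_not_first h.1).trans (by rw [ih.2 ⟨u, v, rfl, rfl, h.2⟩]; rfl)

theorem word_e_isSome {i : Node m n} {w : List (Letter m n)}
    (h : 0 < (wordCrystal m n).eps i w) : ((wordCrystal m n).e i w).isSome := by
  induction w with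
  | nil => simp at h
  | cons b w ih =>
    by_cases hf : EFirst i b w
    · rw [word_e_cons_of_first hf]
      rcases le_lf_cases i b with ⟨-, h1, h2⟩ | ⟨h3, h1, h2⟩ | ⟨-, -, h1, h2⟩
      pick_goal 2
      · rw [if_pos h3]; rfl
      all_goals
        exfalso
        unfold EFirst at hf
        rcases lt_trichotomy (i.val + 1) m with hi | hi | hi
        · have := word_cons_barred hi b w
          omega
        · have := word_cons_zero hi b w
          split_ifs at this <;> omega
        · have := word_cons_odd hi b w
          omega
    · rw [word_e_cons_of_not_first hf, Option.isSome_map]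
      apply ih
      unfold EFirst at hf
      rcases lt_trichotomy (i.val + 1) m with hi | hi | hi
      · have := word_cons_barred hi b w
        omega
      · have := word_cons_zero hi b w
        split_ifs at this <;> omega
      · have := word_cons_odd hi b w
        omega

theorem word_f_isSome {i : Node m n} {w : List (Letter m n)}
    (h : 0 < (wordCrystal m n).phi i w) : ((wordCrystal m n).f i w).isSome := by
  induction w with
  | nil => simp at h
  | cons b w ih =>
    by_cases hf : FFirst i b w
    · rw [word_f_cons_of_first hf]
      rcases le_lf_cases i b with ⟨h3, h1, h2⟩ | ⟨-, h1, h2⟩ | ⟨-, -, h1, h2⟩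
      · rw [if_pos h3]; rfl
      all_goals
        exfalso
        unfold FFirst at hf
        rcases lt_trichotomy (i.val + 1) m with hi | hi | hi
        · have := word_cons_barred hi b w
          omega
        · have := word_cons_zero hi b w
          split_ifs at this <;> omega
        · have := word_cons_odd hi b w
          omega
    · rw [word_f_cons_of_not_first hf, Option.isSome_map]
      apply ih
      unfold FFirst at hf
      rcases lt_trichotomy (i.val + 1) m with hi | hi | hi
      · have := word_cons_barred hi b w
        omega
      · have := word_cons_zero hi b w
        split_ifs at this <;> omega
      · have := word_cons_odd hi b w
        omega

theorem word_f_iff_e (i : Node m n) (w w' : List (Letter m n)) :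
    (wordCrystal m n).f i w = some w' ↔ (wordCrystal m n).e i w' = some w := by
  rw [word_f_eq_some_iff, word_e_eq_some_iff]
  constructor <;> rintro ⟨u, v, h1, h2, h3⟩ <;> exact ⟨u, v, h2, h1, h3⟩

theorem word_wt_replace (i : Node m n) (u v : List (Letter m n)) :
    (wordCrystal m n).wt (u ++ src i :: v) = (wordCrystal m n).wt (u ++ tgt i :: v) + root i := by
  simp only [word_wt_append, word_wt_cons, root]
  abel

theorem word_coroot_zero {i : Node m n} (h : i.val + 1 = m) (w : List (Letter m n)) :
    0 ≤ coroot i ((wordCrystal m n).wt w) ∧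
    (coroot i ((wordCrystal m n).wt w) = 0 →
      (wordCrystal m n).phi i w + (wordCrystal m n).eps i w = 0) ∧
    (0 < coroot i ((wordCrystal m n).wt w) →
      (wordCrystal m n).phi i w + (wordCrystal m n).eps i w = 1) := by
  induction w with
  | nil => simp [coroot_zero]
  | cons b w ih =>
    have h1 := word_cons_zero h b w
    rw [word_wt_cons, coroot_add, coroot_single, if_pos h]
    rcases le_lf_cases i b with ⟨-, h3, h4⟩ | ⟨-, h3, h4⟩ | ⟨-, -, h3, h4⟩ <;>
      rw [h3, h4] at h1 ⊢ <;> simp at h1 ⊢ <;> omega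

/-- The words form a crystal. -/
theorem isCrystal_word : (wordCrystal m n).IsCrystal where
  phi_sub_eps i w h := word_phi_sub_eps h w
  coroot_zero_nonneg i w h := (word_coroot_zero h w).1
  phi_add_eps_of_eq i w h := (word_coroot_zero h w).2.1
  phi_add_eps_of_pos i w h := (word_coroot_zero h w).2.2
  eps_e i w w' h := by
    obtain ⟨u, v, rfl, rfl, ha⟩ := word_e_eq_some_iff.1 h
    have := ha.values
    omega
  phi_e i w w' h := by
    obtain ⟨u, v, rfl, rfl, ha⟩ := word_e_eq_some_iff.1 h
    exact ha.values.2.1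
  wt_e i w w' h := by
    obtain ⟨u, v, rfl, rfl, ha⟩ := word_e_eq_some_iff.1 h
    exact word_wt_replace i u v
  eps_f i w w' h := by
    obtain ⟨u, v, rfl, rfl, ha⟩ := word_f_eq_some_iff.1 h
    exact ha.values.1
  phi_f i w w' h := by
    obtain ⟨u, v, rfl, rfl, ha⟩ := word_f_eq_some_iff.1 h
    have := ha.values
    omega
  wt_f i w w' h := by
    obtain ⟨u, v, rfl, rfl, ha⟩ := word_f_eq_some_iff.1 h
    rw [word_wt_replace]
    abel
  f_iff_e := word_f_iff_e

end WordCrystal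

end SuperCrystal

namespace SuperCrystal

/-! ### Crystal operators respect the Knuth relations -/

section Compatibility

variable {m n : ℕ}

/-- `e_i` acts on the first factor of `u ⊗ v`. -/
def ELeft (i : Node m n) (u v : List (Letter m n)) : Prop :=
  (i.val + 1 < m ∧ (wordCrystal m n).eps i v ≤ (wordCrystal m n).phi i u) ∨
  (m < i.val + 1 ∧ (wordCrystal m n).phi i v < (wordCrystal m n).eps i u) ∨
  (i.val + 1 = m ∧ 0 < (wordCrystal m n).eps i u + (wordCrystal m n).phi i u)

/-- `f_i` acts on the first factor of `u ⊗ v`. -/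
def FLeft (i : Node m n) (u v : List (Letter m n)) : Prop :=
  (i.val + 1 < m ∧ (wordCrystal m n).eps i v < (wordCrystal m n).phi i u) ∨
  (m < i.val + 1 ∧ (wordCrystal m n).phi i v ≤ (wordCrystal m n).eps i u) ∨
  (i.val + 1 = m ∧ 0 < (wordCrystal m n).eps i u + (wordCrystal m n).phi i u)

/-- Associativity of the tensor product, one letter at a time: acting on the first letter of `b ::
(u ++ v)` is the same as acting on the left factor `b :: u` and, inside it, on `b`. -/
theorem eLeft_cons (i : Node m n) (b : Letter m n) (u v : List (Letter m n)) :
    (EFirst i b (u ++ v) → EFirst i b u ∧ ELeft i (b :: u) v) ∧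
    (¬ EFirst i b (u ++ v) → ELeft i u v → ¬ EFirst i b u ∧ ELeft i (b :: u) v) ∧
    (¬ EFirst i b (u ++ v) → ¬ ELeft i u v → ¬ ELeft i (b :: u) v) := by
  unfold EFirst ELeft
  rcases lt_trichotomy (i.val + 1) m with hi | hi | hi
  · have h1 := word_append_barred hi u v
    have h4 := word_cons_barred hi b u
    rcases le_lf_cases i b with ⟨-, h5, h6⟩ | ⟨-, h5, h6⟩ | ⟨-, -, h5, h6⟩ <;> omega
  · have h4 := word_cons_zero hi b u
    rcases le_lf_cases i b with ⟨-, h5, h6⟩ | ⟨-, h5, h6⟩ | ⟨-, -, h5, h6⟩ <;>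
      simp only [h5, h6] at h4 ⊢ <;> simp at h4 <;> omega
  · have h1 := word_append_odd hi u v
    have h4 := word_cons_odd hi b u
    rcases le_lf_cases i b with ⟨-, h5, h6⟩ | ⟨-, h5, h6⟩ | ⟨-, -, h5, h6⟩ <;> omega

theorem fLeft_cons (i : Node m n) (b : Letter m n) (u v : List (Letter m n)) :
    (FFirst i b (u ++ v) → FFirst i b u ∧ FLeft i (b :: u) v) ∧
    (¬ FFirst i b (u ++ v) → FLeft i u v → ¬ FFirst i b u ∧ FLeft i (b :: u) v) ∧
    (¬ FFirst i b (u ++ v) → ¬ FLeft i u v → ¬ FLeft i (b :: u) v) := by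
  unfold FFirst FLeft
  rcases lt_trichotomy (i.val + 1) m with hi | hi | hi
  · have h1 := word_append_barred hi u v
    have h4 := word_cons_barred hi b u
    rcases le_lf_cases i b with ⟨-, h5, h6⟩ | ⟨-, h5, h6⟩ | ⟨-, -, h5, h6⟩ <;> omega
  · have h4 := word_cons_zero hi b u
    rcases le_lf_cases i b with ⟨-, h5, h6⟩ | ⟨-, h5, h6⟩ | ⟨-, -, h5, h6⟩ <;>
      simp only [h5, h6] at h4 ⊢ <;> simp at h4 <;> omega
  · have h1 := word_append_odd hi u v
    have h4 := word_cons_odd hi b u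
    rcases le_lf_cases i b with ⟨-, h5, h6⟩ | ⟨-, h5, h6⟩ | ⟨-, -, h5, h6⟩ <;> omega

theorem word_e_eq_none {i : Node m n} {w : List (Letter m n)}
    (h : (wordCrystal m n).eps i w = 0) : (wordCrystal m n).e i w = none := by
  cases he : (wordCrystal m n).e i w with
  | none => rfl
  | some w' =>
    have := isCrystal_word.eps_e i w w' he
    omega

theorem word_f_eq_none {i : Node m n} {w : List (Letter m n)}
    (h : (wordCrystal m n).phi i w = 0) : (wordCrystal m n).f i w = none := by
  cases he : (wordCrystal m n).f i w with
  | none => rfl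
  | some w' =>
    have := isCrystal_word.phi_f i w w' he
    omega

theorem word_e_append (i : Node m n) (u v : List (Letter m n)) :
    (ELeft i u v → (wordCrystal m n).e i (u ++ v) = ((wordCrystal m n).e i u).map (· ++ v)) ∧
    (¬ ELeft i u v →
      (wordCrystal m n).e i (u ++ v) = ((wordCrystal m n).e i v).map (u ++ ·)) := by
  induction u with
  | nil =>
    refine ⟨fun h => ?_, fun _ => by simp⟩
    have : (wordCrystal m n).eps i v = 0 := by simp [ELeft] at h; exact h.2
    rw [List.nil_append, word_e_eq_none this]
    rfl
  | cons b u ih =>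
    have h := eLeft_cons i b u v
    rw [List.cons_append]
    by_cases h1 : EFirst i b (u ++ v)
    · have h2 := h.1 h1
      rw [word_e_cons_of_first h1, word_e_cons_of_first h2.1]
      refine ⟨fun _ => ?_, fun k => absurd h2.2 k⟩
      split_ifs <;> rfl
    · rw [word_e_cons_of_not_first h1]
      by_cases h2 : ELeft i u v
      · have h3 := h.2.1 h1 h2
        rw [ih.1 h2, word_e_cons_of_not_first h3.1, Option.map_map, Option.map_map]
        exact ⟨fun _ => rfl, fun k => absurd h3.2 k⟩
      · have h3 := h.2.2 h1 h2
        rw [ih.2 h2, Option.map_map]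
        exact ⟨fun k => absurd k h3, fun _ => rfl⟩

theorem word_f_append (i : Node m n) (u v : List (Letter m n)) :
    (FLeft i u v → (wordCrystal m n).f i (u ++ v) = ((wordCrystal m n).f i u).map (· ++ v)) ∧
    (¬ FLeft i u v →
      (wordCrystal m n).f i (u ++ v) = ((wordCrystal m n).f i v).map (u ++ ·)) := by
  induction u with
  | nil =>
    refine ⟨fun h => ?_, fun _ => by simp⟩
    have : (wordCrystal m n).phi i v = 0 := by simp [FLeft] at h; exact h.2
    rw [List.nil_append, word_f_eq_none this]
    rfl
  | cons b u ih =>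
    have h := fLeft_cons i b u v
    rw [List.cons_append]
    by_cases h1 : FFirst i b (u ++ v)
    · have h2 := h.1 h1
      rw [word_f_cons_of_first h1, word_f_cons_of_first h2.1]
      refine ⟨fun _ => ?_, fun k => absurd h2.2 k⟩
      split_ifs <;> rfl
    · rw [word_f_cons_of_not_first h1]
      by_cases h2 : FLeft i u v
      · have h3 := h.2.1 h1 h2
        rw [ih.1 h2, word_f_cons_of_not_first h3.1, Option.map_map, Option.map_map]
        exact ⟨fun _ => rfl, fun k => absurd h3.2 k⟩
      · have h3 := h.2.2 h1 h2
        rw [ih.2 h2, Option.map_map]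
        exact ⟨fun k => absurd k h3, fun _ => rfl⟩

/-- `e_i` and `f_i` act in the same way, up to plactic equivalence, on two words. -/
structure Compat (i : Node m n) (w w' : List (Letter m n)) : Prop where
  eps : (wordCrystal m n).eps i w = (wordCrystal m n).eps i w'
  phi : (wordCrystal m n).phi i w = (wordCrystal m n).phi i w'
  e : Option.Rel (Plac col) ((wordCrystal m n).e i w) ((wordCrystal m n).e i w')
  f : Option.Rel (Plac col) ((wordCrystal m n).f i w) ((wordCrystal m n).f i w')

theorem optionRel_refl (o : Option (List (Letter m n))) : Option.Rel (Plac col) o o := by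
  cases o with
  | none => exact .none
  | some w => exact .some (.refl w)

theorem optionRel_symm {o o' : Option (List (Letter m n))} (h : Option.Rel (Plac col) o o') :
    Option.Rel (Plac col) o' o := by
  cases h with
  | none => exact .none
  | some h => exact .some h.symm

theorem optionRel_trans {o o' o'' : Option (List (Letter m n))} (h : Option.Rel (Plac col) o o')
    (h' : Option.Rel (Plac col) o' o'') : Option.Rel (Plac col) o o'' := by
  cases h with
  | none => exact h'
  | some h =>
    cases h' with
    | some h' => exact .some (h.trans h')

theorem optionRel_map {o o' : Option (List (Letter m n))} (h : Option.Rel (Plac col) o o')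
    {g g' : List (Letter m n) → List (Letter m n)}
    (hg : ∀ w w', Plac col w w' → Plac col (g w) (g' w')) :
    Option.Rel (Plac col) (o.map g) (o'.map g') := by
  cases h with
  | none => exact .none
  | some h => exact .some (hg _ _ h)

/-- The tensor rule selects a factor by ε_i and φ_i alone. These agree on both sides, so
corresponding factors are changed, and the unchanged ones contribute the equivalences `hu` or `hv`.
-/
theorem Compat.append {i : Node m n} {u u' v v' : List (Letter m n)} (h : Compat i u u')
    (h' : Compat i v v') (hu : Plac col u u') (hv : Plac col v v') :
    Compat i (u ++ v) (u' ++ v') where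
  eps := by
    have := h.eps; have := h.phi; have := h'.eps; have := h'.phi
    rcases lt_trichotomy (i.val + 1) m with hi | hi | hi
    · rw [(word_append_barred hi u v).1, (word_append_barred hi u' v').1]; simp [*]
    · rw [(word_append_zero hi u v).1, (word_append_zero hi u' v').1]; simp [*]
    · rw [(word_append_odd hi u v).1, (word_append_odd hi u' v').1]; simp [*]
  phi := by
    have := h.eps; have := h.phi; have := h'.eps; have := h'.phi
    rcases lt_trichotomy (i.val + 1) m with hi | hi | hi
    · rw [(word_append_barred hi u v).2, (word_append_barred hi u' v').2]; simp [*]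
    · rw [(word_append_zero hi u v).2, (word_append_zero hi u' v').2]; simp [*]
    · rw [(word_append_odd hi u v).2, (word_append_odd hi u' v').2]; simp [*]
  e := by
    have he : ELeft i u v ↔ ELeft i u' v' := by
      simp only [ELeft, h.eps, h.phi, h'.eps, h'.phi]
    by_cases hl : ELeft i u v
    · rw [(word_e_append i u v).1 hl, (word_e_append i u' v').1 (he.1 hl)]
      exact optionRel_map h.e fun _ _ k => k.append hv
    · rw [(word_e_append i u v).2 hl, (word_e_append i u' v').2 (mt he.2 hl)]
      exact optionRel_map h'.e fun _ _ k => hu.append k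
  f := by
    have he : FLeft i u v ↔ FLeft i u' v' := by
      simp only [FLeft, h.eps, h.phi, h'.eps, h'.phi]
    by_cases hl : FLeft i u v
    · rw [(word_f_append i u v).1 hl, (word_f_append i u' v').1 (he.1 hl)]
      exact optionRel_map h.f fun _ _ k => k.append hv
    · rw [(word_f_append i u v).2 hl, (word_f_append i u' v').2 (mt he.2 hl)]
      exact optionRel_map h'.f fun _ _ k => hu.append k

theorem Compat.refl (i : Node m n) (w : List (Letter m n)) : Compat i w w :=
  ⟨rfl, rfl, optionRel_refl _, optionRel_refl _⟩

theorem val_src (i : Node m n) : (src i).val = i.val := rfl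

theorem val_tgt (i : Node m n) : (tgt i).val = i.val + 1 := rfl

theorem word_e_cons' (i : Node m n) (b : Letter m n) (w : List (Letter m n))
    [Decidable (EFirst i b w)] : (wordCrystal m n).e i (b :: w) = if EFirst i b w then
      (if b = tgt i then some (src i :: w) else none) else
      ((wordCrystal m n).e i w).map (b :: ·) := by
  split_ifs with h hb
  · rw [word_e_cons_of_first h, if_pos hb]
  · rw [word_e_cons_of_first h, if_neg hb]
  · rw [word_e_cons_of_not_first h]

theorem word_f_cons' (i : Node m n) (b : Letter m n) (w : List (Letter m n))
    [Decidable (FFirst i b w)] : (wordCrystal m n).f i (b :: w) = if FFirst i b w then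
      (if b = src i then some (tgt i :: w) else none) else
      ((wordCrystal m n).f i w).map (b :: ·) := by
  split_ifs with h hb
  · rw [word_f_cons_of_first h, if_pos hb]
  · rw [word_f_cons_of_first h, if_neg hb]
  · rw [word_f_cons_of_not_first h]

instance (i : Node m n) (b : Letter m n) (w : List (Letter m n)) : Decidable (EFirst i b w) := by
  unfold EFirst; infer_instance

instance (i : Node m n) (b : Letter m n) (w : List (Letter m n)) : Decidable (FFirst i b w) := by
  unfold FFirst; infer_instance

theorem le_lf_val (i : Node m n) (b : Letter m n) :
    (b = src i ∧ le i b = 0 ∧ lf i b = 1) ∨ (b = tgt i ∧ le i b = 1 ∧ lf i b = 0) ∨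
      ((b.val ≠ i.val ∧ b.val ≠ i.val + 1) ∧ (b ≠ src i ∧ b ≠ tgt i) ∧ le i b = 0 ∧ lf i b = 0) := by
  rcases le_lf_cases i b with h | h | ⟨h1, h2, h⟩
  · exact Or.inl h
  · exact Or.inr (Or.inl h)
  · exact Or.inr (Or.inr ⟨⟨fun k => h1 (Fin.ext k), fun k => h2 (Fin.ext k)⟩, ⟨h1, h2⟩, h⟩)

/-- A finite check: each of the three letters is `src i`, `tgt i` or irrelevant for `i`, and the
order constraints exclude many of the combinations. The images under an operator are again equal or
related by a Knuth relation, possibly by the other one, since changing a letter can turn a strict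
inequality into an equality and conversely. -/
theorem compat_acb_barred {i : Node m n} (hi : i.val + 1 < m) {a b c : Letter m n} (h1 : col a b) (h2 : ¬ col c b) :
    Compat i [c, a, b] [a, c, b] := by
  have hst := src_ne_tgt i
  have hts := tgt_ne_src i
  have vs := val_src i
  have vt := val_tgt i
  have l1 := le_src i
  have l2 := le_tgt i
  have l3 := lf_src i
  have l4 := lf_tgt i
  rw [col_iff] at h1 h2
  have g1 : ¬ m ≤ i.val := by omega
  have g2 : ¬ i.val + 1 = m := by omega
  rcases le_lf_val i a with ⟨rfl, ha, ha'⟩ | ⟨rfl, ha, ha'⟩ | ⟨hav, hab, ha, ha'⟩ <;>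
  rcases le_lf_val i b with ⟨rfl, hb, hb'⟩ | ⟨rfl, hb, hb'⟩ | ⟨hbv, hbb, hb, hb'⟩ <;>
  rcases le_lf_val i c with ⟨rfl, hc, hc'⟩ | ⟨rfl, hc, hc'⟩ | ⟨hcv, hcb, hc, hc'⟩ <;>
  try (exfalso; omega)
  all_goals constructor
  all_goals simp [word_e_cons', EFirst, word_f_cons', word_f_nil, FFirst, word_cons_barred hi, *]
  all_goals first
    | exact .refl _
    | exact .acb [] [] (col_iff.2 (by omega)) (mt col_iff.1 (by omega))
    | exact .bac [] [] (mt col_iff.1 (by omega)) (col_iff.2 (by omega))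

theorem compat_acb_zero {i : Node m n} (hi : i.val + 1 = m) {a b c : Letter m n} (h1 : col a b) (h2 : ¬ col c b) :
    Compat i [c, a, b] [a, c, b] := by
  have hst := src_ne_tgt i
  have hts := tgt_ne_src i
  have vs := val_src i
  have vt := val_tgt i
  have l1 := le_src i
  have l2 := le_tgt i
  have l3 := lf_src i
  have l4 := lf_tgt i
  rw [col_iff] at h1 h2
  have g1 : ¬ m ≤ i.val := by omega
  have g2 : ¬ i.val + 1 < m := by omega
  rcases le_lf_val i a with ⟨rfl, ha, ha'⟩ | ⟨rfl, ha, ha'⟩ | ⟨hav, hab, ha, ha'⟩ <;>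
  rcases le_lf_val i b with ⟨rfl, hb, hb'⟩ | ⟨rfl, hb, hb'⟩ | ⟨hbv, hbb, hb, hb'⟩ <;>
  rcases le_lf_val i c with ⟨rfl, hc, hc'⟩ | ⟨rfl, hc, hc'⟩ | ⟨hcv, hcb, hc, hc'⟩ <;>
  try (exfalso; omega)
  all_goals constructor
  all_goals simp [word_e_cons', word_e_nil, EFirst, word_f_cons', word_f_nil, FFirst, word_cons_zero hi, *]
  all_goals first
    | exact .refl _
    | exact .acb [] [] (col_iff.2 (by omega)) (mt col_iff.1 (by omega))

theorem compat_acb_odd {i : Node m n} (hi : m < i.val + 1) {a b c : Letter m n} (h1 : col a b) (h2 : ¬ col c b) :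
    Compat i [c, a, b] [a, c, b] := by
  have hst := src_ne_tgt i
  have hts := tgt_ne_src i
  have vs := val_src i
  have vt := val_tgt i
  have l1 := le_src i
  have l2 := le_tgt i
  have l3 := lf_src i
  have l4 := lf_tgt i
  rw [col_iff] at h1 h2
  have g1 : ¬ i.val + 1 < m := by omega
  have g2 : ¬ i.val + 1 = m := by omega
  have g3 : m ≤ i.val := by omega
  rcases le_lf_val i a with ⟨rfl, ha, ha'⟩ | ⟨rfl, ha, ha'⟩ | ⟨hav, hab, ha, ha'⟩ <;>
  rcases le_lf_val i b with ⟨rfl, hb, hb'⟩ | ⟨rfl, hb, hb'⟩ | ⟨hbv, hbb, hb, hb'⟩ <;>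
  rcases le_lf_val i c with ⟨rfl, hc, hc'⟩ | ⟨rfl, hc, hc'⟩ | ⟨hcv, hcb, hc, hc'⟩ <;>
  try (exfalso; omega)
  all_goals constructor
  all_goals simp [word_e_cons', word_e_nil, EFirst, word_f_cons', FFirst, word_cons_odd hi, *]
  all_goals first
    | exact .refl _
    | exact .acb [] [] (col_iff.2 (by omega)) (mt col_iff.1 (by omega))
    | exact .bac [] [] (mt col_iff.1 (by omega)) (col_iff.2 (by omega))

theorem compat_bac_barred {i : Node m n} (hi : i.val + 1 < m) {a b c : Letter m n} (h1 : ¬ col b a) (h2 : col b c) :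
    Compat i [b, a, c] [b, c, a] := by
  have hst := src_ne_tgt i
  have hts := tgt_ne_src i
  have vs := val_src i
  have vt := val_tgt i
  have l1 := le_src i
  have l2 := le_tgt i
  have l3 := lf_src i
  have l4 := lf_tgt i
  rw [col_iff] at h1 h2
  have g1 : ¬ m ≤ i.val := by omega
  have g2 : ¬ i.val + 1 = m := by omega
  rcases le_lf_val i a with ⟨rfl, ha, ha'⟩ | ⟨rfl, ha, ha'⟩ | ⟨hav, hab, ha, ha'⟩ <;>
  rcases le_lf_val i b with ⟨rfl, hb, hb'⟩ | ⟨rfl, hb, hb'⟩ | ⟨hbv, hbb, hb, hb'⟩ <;>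
  rcases le_lf_val i c with ⟨rfl, hc, hc'⟩ | ⟨rfl, hc, hc'⟩ | ⟨hcv, hcb, hc, hc'⟩ <;>
  try (exfalso; omega)
  all_goals constructor
  all_goals simp [word_e_cons', EFirst, word_f_cons', word_f_nil, FFirst, word_cons_barred hi, *]
  all_goals first
    | exact .refl _
    | exact .acb [] [] (col_iff.2 (by omega)) (mt col_iff.1 (by omega))
    | exact .bac [] [] (mt col_iff.1 (by omega)) (col_iff.2 (by omega))

theorem compat_bac_zero {i : Node m n} (hi : i.val + 1 = m) {a b c : Letter m n} (h1 : ¬ col b a) (h2 : col b c) :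
    Compat i [b, a, c] [b, c, a] := by
  have hst := src_ne_tgt i
  have hts := tgt_ne_src i
  have vs := val_src i
  have vt := val_tgt i
  have l1 := le_src i
  have l2 := le_tgt i
  have l3 := lf_src i
  have l4 := lf_tgt i
  rw [col_iff] at h1 h2
  have g1 : ¬ m ≤ i.val := by omega
  have g2 : ¬ i.val + 1 < m := by omega
  rcases le_lf_val i a with ⟨rfl, ha, ha'⟩ | ⟨rfl, ha, ha'⟩ | ⟨hav, hab, ha, ha'⟩ <;>
  rcases le_lf_val i b with ⟨rfl, hb, hb'⟩ | ⟨rfl, hb, hb'⟩ | ⟨hbv, hbb, hb, hb'⟩ <;>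
  rcases le_lf_val i c with ⟨rfl, hc, hc'⟩ | ⟨rfl, hc, hc'⟩ | ⟨hcv, hcb, hc, hc'⟩ <;>
  try (exfalso; omega)
  all_goals constructor
  all_goals simp [word_e_cons', word_e_nil, EFirst, word_f_cons', word_f_nil, FFirst, word_cons_zero hi, *]
  all_goals first
    | exact .refl _
    | exact .acb [] [] (col_iff.2 (by omega)) (mt col_iff.1 (by omega))
    | exact .bac [] [] (mt col_iff.1 (by omega)) (col_iff.2 (by omega))

theorem compat_bac_odd {i : Node m n} (hi : m < i.val + 1) {a b c : Letter m n} (h1 : ¬ col b a) (h2 : col b c) :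
    Compat i [b, a, c] [b, c, a] := by
  have hst := src_ne_tgt i
  have hts := tgt_ne_src i
  have vs := val_src i
  have vt := val_tgt i
  have l1 := le_src i
  have l2 := le_tgt i
  have l3 := lf_src i
  have l4 := lf_tgt i
  rw [col_iff] at h1 h2
  have g1 : ¬ i.val + 1 < m := by omega
  have g2 : ¬ i.val + 1 = m := by omega
  have g3 : m ≤ i.val := by omega
  rcases le_lf_val i a with ⟨rfl, ha, ha'⟩ | ⟨rfl, ha, ha'⟩ | ⟨hav, hab, ha, ha'⟩ <;>
  rcases le_lf_val i b with ⟨rfl, hb, hb'⟩ | ⟨rfl, hb, hb'⟩ | ⟨hbv, hbb, hb, hb'⟩ <;>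
  rcases le_lf_val i c with ⟨rfl, hc, hc'⟩ | ⟨rfl, hc, hc'⟩ | ⟨hcv, hcb, hc, hc'⟩ <;>
  try (exfalso; omega)
  all_goals constructor
  all_goals simp [word_e_cons', word_e_nil, EFirst, word_f_cons', FFirst, word_cons_odd hi, *]
  all_goals first
    | exact .refl _
    | exact .acb [] [] (col_iff.2 (by omega)) (mt col_iff.1 (by omega))
    | exact .bac [] [] (mt col_iff.1 (by omega)) (col_iff.2 (by omega))

theorem Compat.symm {i : Node m n} {w w' : List (Letter m n)} (h : Compat i w w') :
    Compat i w' w :=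
  ⟨h.eps.symm, h.phi.symm, optionRel_symm h.e, optionRel_symm h.f⟩

theorem Compat.trans {i : Node m n} {w w' w'' : List (Letter m n)} (h : Compat i w w')
    (h' : Compat i w' w'') : Compat i w w'' :=
  ⟨h.eps.trans h'.eps, h.phi.trans h'.phi, optionRel_trans h.e h'.e, optionRel_trans h.f h'.f⟩

/-- The crystal operators respect the plactic congruence. -/
theorem Plac.compat {w w' : List (Letter m n)} (h : Plac col w w') (i : Node m n) :
    Compat i w w' := by
  have key : ∀ p q t t' : List (Letter m n), Compat i t t' → Plac col t t' →
      Compat i (p ++ (t ++ q)) (p ++ (t' ++ q)) := fun p q t t' h hp =>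
    (Compat.refl i p).append (h.append (Compat.refl i q) hp (.refl q)) (.refl p)
      (hp.append_right q)
  induction h with
  | refl w => exact .refl i w
  | symm _ ih => exact ih.symm
  | trans _ _ ih1 ih2 => exact ih1.trans ih2
  | @acb p q a b c h1 h2 =>
    refine key p q [c, a, b] [a, c, b] ?_ (.acb [] [] h1 h2)
    rcases lt_trichotomy (i.val + 1) m with hi | hi | hi
    · exact compat_acb_barred hi h1 h2
    · exact compat_acb_zero hi h1 h2
    · exact compat_acb_odd hi h1 h2
  | @bac p q a b c h1 h2 =>
    refine key p q [b, a, c] [b, c, a] ?_ (.bac [] [] h1 h2)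
    rcases lt_trichotomy (i.val + 1) m with hi | hi | hi
    · exact compat_bac_barred hi h1 h2
    · exact compat_bac_zero hi h1 h2
    · exact compat_bac_odd hi h1 h2

theorem Plac.wt_eq {w w' : List (Letter m n)} (h : Plac col w w') :
    (wordCrystal m n).wt w = (wordCrystal m n).wt w' := by
  funext b
  rw [word_wt_eq_count, word_wt_eq_count, h.perm.count_eq]

end Compatibility

end SuperCrystal

namespace SuperCrystal

/-! ### Columns described by their numbers of letters below each threshold -/

section TableauCrystal

variable {m n : ℕ}

/-- The number of letters of `c` below the threshold `x`. -/
def lev (x : ℕ) (c : List (Letter m n)) : ℕ := c.countP (fun a => a.val < x)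

@[simp] theorem lev_nil (x : ℕ) : lev x ([] : List (Letter m n)) = 0 := rfl

theorem lev_cons (x : ℕ) (a : Letter m n) (c : List (Letter m n)) :
    lev x (a :: c) = lev x c + if a.val < x then 1 else 0 := by
  simp [lev, List.countP_cons]

theorem lev_append (x : ℕ) (c d : List (Letter m n)) : lev x (c ++ d) = lev x c + lev x d := by
  simp [lev]

@[simp] theorem lev_zero (c : List (Letter m n)) : lev 0 c = 0 := by simp [lev]

theorem lev_top {x : ℕ} (hx : m + n ≤ x) (c : List (Letter m n)) : lev x c = c.length := by
  rw [lev, List.countP_eq_length]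
  intro a _
  simp; omega

theorem lev_mono {x y : ℕ} (h : x ≤ y) (c : List (Letter m n)) : lev x c ≤ lev y c := by
  apply List.countP_mono_left
  intro a _ ha
  simp at ha ⊢; omega

theorem lev_succ (y : Letter m n) (c : List (Letter m n)) :
    lev (y.val + 1) c = lev y.val c + c.count y := by
  induction c with
  | nil => simp
  | cons a c ih =>
    rw [lev_cons, lev_cons, ih, List.count_cons]
    by_cases h : a = y
    · subst h; simp; omega
    · have : a.val ≠ y.val := fun k => h (Fin.ext k)
      simp only [beq_iff_eq, h, if_false]
      split_ifs <;> omega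

theorem lev_replace (i : Node m n) (u v : List (Letter m n)) (x : ℕ) :
    lev x (u ++ src i :: v) = lev x (u ++ tgt i :: v) + if x = i.val + 1 then 1 else 0 := by
  rw [lev_append, lev_append, lev_cons, lev_cons, val_src, val_tgt]
  split_ifs <;> omega

theorem lev_eq_zero {x : ℕ} {c : List (Letter m n)} (h : ∀ a ∈ c, x ≤ a.val) : lev x c = 0 := by
  rw [lev, List.countP_eq_zero]
  intro a ha
  have := h a ha
  simp; omega

/-- Two columns fit side by side if and only if their numbers of letters below each threshold
satisfy the corresponding inequalities. -/
theorem dom_iff_lev {c d : List (Letter m n)} (hc : c.Pairwise col) (hd : d.Pairwise col) :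
    Dom col c d ↔ ∀ x : ℕ, (x < m → lev (x + 1) d ≤ lev (x + 1) c) ∧
      (m ≤ x → lev (x + 1) d ≤ lev x c) := by
  constructor
  · intro h x
    induction c generalizing d with
    | nil =>
      cases d with
      | nil => simp
      | cons z d => simp at h
    | cons y c ih =>
      cases d with
      | nil => simp
      | cons z d =>
        have h1 := ih (List.pairwise_cons.1 hc).2 (List.pairwise_cons.1 hd).2 h.2
        have h2 := h.1
        rw [col_iff] at h2
        simp only [lev_cons]
        split_ifs <;> omega
  · intro h
    induction d generalizing c with
    | nil => simp
    | cons z d ih =>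
      have hz := h z.val
      simp only [lev_cons, Nat.lt_succ_self, if_true] at hz
      cases c with
      | nil => simp at hz; omega
      | cons y c =>
        rw [List.pairwise_cons] at hc hd
        have hyz : ¬ col z y := by
          intro k
          have hy : ∀ a ∈ y :: c, col z a := by
            intro a ha
            rcases List.mem_cons.1 ha with rfl | ha
            · exact k
            · exact col_trans k (hc.1 a ha)
          by_cases hm : z.val < m
          · have := hz.1 hm
            have h0 : lev (z.val + 1) (y :: c) = 0 := lev_eq_zero fun a ha => by
              have := hy a ha
              rw [col_iff] at this
              omega
            omega
          · have := hz.2 (by omega)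
            have h0 : lev z.val (y :: c) = 0 := lev_eq_zero fun a ha => by
              have := hy a ha
              rw [col_iff] at this
              omega
            omega
        refine ⟨hyz, ih hc.2 hd.2 fun x => ?_⟩
        have hx := h x
        simp only [lev_cons] at hx
        rw [col_iff] at hyz
        by_cases hxz : x < z.val
        · have h0 : lev (x + 1) d = 0 := lev_eq_zero fun a ha => by
            have := hd.1 a ha
            rw [col_iff] at this
            omega
          omega
        · rw [if_pos (by omega)] at hx
          constructor
          · intro hm
            have := hx.1 hm
            split_ifs at this <;> omega
          · intro hm
            have := hx.2 hm
            rw [if_pos (by omega)] at this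
            omega

/-- The values of `ε_i` and `φ_i` on a column. -/
theorem column_eps_phi (i : Node m n) {c : List (Letter m n)} (hc : c.Pairwise col) :
    (i.val + 1 < m → c.count (src i) ≤ 1 ∧ c.count (tgt i) ≤ 1 ∧
      (wordCrystal m n).eps i c = c.count (tgt i) - c.count (src i) ∧
      (wordCrystal m n).phi i c = c.count (src i) - c.count (tgt i)) ∧
    (m < i.val + 1 → (wordCrystal m n).eps i c = c.count (tgt i) ∧
      (wordCrystal m n).phi i c = c.count (src i)) ∧
    (i.val + 1 = m → (wordCrystal m n).phi i c = c.count (src i) ∧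
      (wordCrystal m n).eps i c + (wordCrystal m n).phi i c ≤ 1 ∧
      ((wordCrystal m n).eps i c + (wordCrystal m n).phi i c = 0 ↔
        c.count (src i) = 0 ∧ c.count (tgt i) = 0)) := by
  induction c with
  | nil => simp
  | cons x c ih =>
    rw [List.pairwise_cons] at hc
    have ih := ih hc.2
    have hsv := val_src i
    have htv := val_tgt i
    have h1 : ∀ y : Letter m n, ¬ col x y → c.count y = 0 := fun y hy =>
      List.count_eq_zero.2 fun hm => hy (hc.1 y hm)
    have h2 : (x :: c).count (src i) = c.count (src i) + lf i x := by
      simp [List.count_cons, lf]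
    have h3 : (x :: c).count (tgt i) = c.count (tgt i) + le i x := by
      simp [List.count_cons, le]
    rw [h2, h3]
    have h4 : (x = tgt i → c.count (src i) = 0) ∧
        (x = tgt i → i.val + 1 < m → c.count (tgt i) = 0) ∧
        (x = src i → i.val < m → c.count (src i) = 0) := by
      refine ⟨?_, ?_, ?_⟩
      · rintro rfl; exact h1 _ (by rw [col_iff]; omega)
      · rintro rfl hi; exact h1 _ (by rw [col_iff]; omega)
      · rintro rfl hi; exact h1 _ (by rw [col_iff]; omega)
    have h5 : (le i x = 0 ∧ lf i x = 0) ∨ (x = tgt i ∧ le i x = 1 ∧ lf i x = 0) ∨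
        (x = src i ∧ le i x = 0 ∧ lf i x = 1) := by
      rcases le_lf_cases i x with h | h | ⟨-, -, h⟩
      · exact Or.inr (Or.inr h)
      · exact Or.inr (Or.inl h)
      · exact Or.inl h
    have hb := fun hi : i.val + 1 < m => word_cons_barred hi x c
    have hz := fun hi : i.val + 1 = m => word_cons_zero hi x c
    have ho := fun hi : m < i.val + 1 => word_cons_odd hi x c
    clear h2 h3 h1 hsv htv
    generalize List.count (src i) c = p at *
    generalize List.count (tgt i) c = q at *
    generalize (wordCrystal m n).eps i (x :: c) = e' at *
    generalize (wordCrystal m n).phi i (x :: c) = f' at *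
    generalize (wordCrystal m n).eps i c = e at *
    generalize (wordCrystal m n).phi i c = f at *
    obtain ⟨h41, h42, h43⟩ := h4
    obtain ⟨ih1, ih2, ih3⟩ := ih
    refine ⟨fun hi => ?_, fun hi => ?_, fun hi => ?_⟩
    · specialize ih1 hi
      specialize hb hi
      rcases h5 with ⟨h6, h7⟩ | ⟨h, h6, h7⟩ | ⟨h, h6, h7⟩ <;> rw [h6, h7] at hb ⊢
      · omega
      · have := h41 h
        have := h42 h hi
        omega
      · have := h43 h (by omega)
        omega
    · specialize ih2 hi
      specialize ho hi
      rcases h5 with ⟨h6, h7⟩ | ⟨h, h6, h7⟩ | ⟨h, h6, h7⟩ <;> rw [h6, h7] at ho ⊢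
      · omega
      · have := h41 h
        omega
      · omega
    · specialize ih3 hi
      specialize hz hi
      rcases h5 with ⟨h6, h7⟩ | ⟨h, h6, h7⟩ | ⟨h, h6, h7⟩ <;> simp only [h6, h7] at hz ⊢
      · simp only [if_true, Nat.add_zero] at hz ⊢
        rw [hz.1, hz.2]
        exact ih3
      · have := h41 h
        simp at hz
        omega
      · have := h43 h (by omega)
        simp at hz
        omega

/-- The order could fail only through another `src i` or `tgt i` in the column that stands next to
the changed letter and may not be repeated or overtaken. By `column_eps_phi` such a letter would
make ε_i or φ_i positive on its side, against `Acts`. -/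
theorem column_replace {i : Node m n} {u v : List (Letter m n)} (h : Acts i u v) :
    (u ++ src i :: v).Pairwise col ↔ (u ++ tgt i :: v).Pairwise col := by
  have hsv := val_src i
  have htv := val_tgt i
  simp only [List.pairwise_append, List.pairwise_cons, List.mem_cons, forall_eq_or_imp]
  constructor
  · rintro ⟨hu, ⟨hs, hv⟩, huv⟩
    have hp := column_eps_phi i hv
    have h0 : (i.val + 1 < m → (tgt i) ∉ v) := fun hi => by
      have h1 := hp.1 hi
      have h2 : v.count (src i) = 0 := List.count_eq_zero.2 fun hm => by
        have := hs _ hm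
        rw [col_iff] at this; omega
      rw [← List.count_eq_zero]
      have := h.1 hi
      omega
    have h0' : (m < i.val + 1 → (src i) ∉ v) := fun hi => by
      have h1 := hp.2.1 hi
      rw [← List.count_eq_zero]
      have := h.2.1 hi
      omega
    refine ⟨hu, ⟨fun y hy => ?_, hv⟩, fun y hy => ⟨?_, (huv y hy).2⟩⟩
    · have h1 := hs y hy
      have h3 : i.val + 1 < m → y.val ≠ i.val + 1 := fun hi k => h0 hi (by
        rwa [show tgt i = y from Fin.ext (by omega)])
      have h4 : m < i.val + 1 → y.val ≠ i.val := fun hi k => h0' hi (by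
        rwa [show src i = y from Fin.ext (by omega)])
      rw [col_iff] at h1 ⊢
      omega
    · have := (huv y hy).1
      rw [col_iff] at this ⊢
      omega
  · rintro ⟨hu, ⟨ht, hv⟩, huv⟩
    have hp := column_eps_phi i hu
    have h0 : (i.val < m → (src i) ∉ u) := fun hi => by
      rw [← List.count_eq_zero]
      rcases lt_trichotomy (i.val + 1) m with hi | hi | hi
      · have h1 := hp.1 hi
        have h2 : u.count (tgt i) = 0 := List.count_eq_zero.2 fun hm => by
          have := (huv _ hm).1
          rw [col_iff] at this; omega
        have := h.1 hi
        omega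
      · have h1 := hp.2.2 hi
        have := h.2.2 hi
        omega
      · omega
    have h0' : (m ≤ i.val + 1 → (tgt i) ∉ u) := fun hi => by
      rw [← List.count_eq_zero]
      rcases hi.lt_or_eq with hi | hi
      · have h1 := hp.2.1 hi
        have := h.2.1 hi
        omega
      · have h1 := hp.2.2 hi.symm
        have := h.2.2 hi.symm
        omega
    refine ⟨hu, ⟨fun y hy => ?_, hv⟩, fun y hy => ⟨?_, (huv y hy).2⟩⟩
    · have h1 := ht y hy
      rw [col_iff] at h1 ⊢
      omega
    · have h1 := (huv y hy).1
      have h3 : i.val < m → y.val ≠ i.val := fun hi k => h0 hi (by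
        rwa [show src i = y from Fin.ext (by omega)])
      have h4 : m ≤ i.val + 1 → y.val ≠ i.val + 1 := fun hi k => h0' hi (by
        rwa [show tgt i = y from Fin.ext (by omega)])
      rw [col_iff] at h1 ⊢
      omega

end TableauCrystal

end SuperCrystal

namespace SuperCrystal

/-! ### Tableaux are stable under the crystal operators -/

section TableauStability

variable {m n : ℕ}

/-- In the formulas for a concatenation, the values of ε_i and φ_i that occur in `Acts` do not
increase when the outer factors are dropped. The tableau conditions can therefore be tested on two
adjacent columns at a time. -/
theorem Acts.of_append {i : Node m n} {R x y S : List (Letter m n)}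
    (h : Acts i (R ++ x) (y ++ S)) : Acts i x y := by
  obtain ⟨h1, h2, h3⟩ := h
  refine ⟨fun hi => ?_, fun hi => ?_, fun hi => ?_⟩
  · have := h1 hi
    have := word_append_barred hi R x
    have := word_append_barred hi y S
    omega
  · have := h2 hi
    have := word_append_odd hi R x
    have := word_append_odd hi y S
    omega
  · have h4 := h3 hi
    have h5 := word_append_zero hi R x
    split_ifs at h5 <;> omega

theorem reading_append (T₁ T₂ : Filling m n) : reading (T₁ ++ T₂) = reading T₂ ++ reading T₁ := by
  simp [reading]

theorem reading_eq_append_cons {T : Filling m n} {u v : List (Letter m n)} {a : Letter m n}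
    (h : reading T = u ++ a :: v) : ∃ T₁ c₁ c₂ T₂, T = T₁ ++ (c₁ ++ a :: c₂) :: T₂ ∧
      u = reading T₂ ++ c₁ ∧ v = c₂ ++ reading T₁ := by
  induction T generalizing v with
  | nil => simp at h
  | cons c T ih =>
    rw [reading_cons, List.append_eq_append_iff] at h
    rcases h with ⟨w, rfl, h⟩ | ⟨w, h1, h2⟩
    · exact ⟨[], w, v, T, by simp [h], rfl, by simp [reading]⟩
    · cases w with
      | nil =>
        refine ⟨[], [], v, T, ?_, ?_, ?_⟩ <;> simp_all [reading]
      | cons b w =>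
        simp only [List.cons_append, List.cons.injEq] at h2
        obtain ⟨rfl, rfl⟩ := h2
        obtain ⟨T₁, c₁, c₂, T₂, rfl, rfl, rfl⟩ := ih h1
        exact ⟨c :: T₁, c₁, c₂, T₂, rfl, rfl, by simp [reading_cons]⟩

theorem count_left_of_src {i : Node m n} {u v : List (Letter m n)}
    (h : (u ++ src i :: v).Pairwise col) : u.count (tgt i) = 0 ∧
      (i.val < m → u.count (src i) = 0 ∧ v.count (src i) = 0) := by
  have hsv := val_src i
  have htv := val_tgt i
  simp only [List.pairwise_append, List.pairwise_cons, List.mem_cons, forall_eq_or_imp] at h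
  obtain ⟨-, ⟨h1, -⟩, h2⟩ := h
  simp only [List.count_eq_zero]
  refine ⟨fun hm => ?_, fun hi => ⟨fun hm => ?_, fun hm => ?_⟩⟩
  · have := (h2 _ hm).1
    rw [col_iff] at this; omega
  · have := (h2 _ hm).1
    rw [col_iff] at this; omega
  · have := h1 _ hm
    rw [col_iff] at this; omega

theorem count_right_of_tgt {i : Node m n} {u v : List (Letter m n)}
    (h : (u ++ tgt i :: v).Pairwise col) : v.count (src i) = 0 ∧
      (i.val + 1 < m → u.count (tgt i) = 0 ∧ v.count (tgt i) = 0) := by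
  have hsv := val_src i
  have htv := val_tgt i
  simp only [List.pairwise_append, List.pairwise_cons, List.mem_cons, forall_eq_or_imp] at h
  obtain ⟨-, ⟨h1, -⟩, h2⟩ := h
  simp only [List.count_eq_zero]
  refine ⟨fun hm => ?_, fun hi => ⟨fun hm => ?_, fun hm => ?_⟩⟩
  · have := h1 _ hm
    rw [col_iff] at this; omega
  · have := (h2 _ hm).1
    rw [col_iff] at this; omega
  · have := h1 _ hm
    rw [col_iff] at this; omega

theorem lev_tgt (i : Node m n) (c : List (Letter m n)) :
    lev (i.val + 1 + 1) c = lev (i.val + 1) c + c.count (tgt i) := by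
  have := lev_succ (tgt i) c
  rwa [val_tgt] at this

theorem lev_replace_cases (i : Node m n) (u v : List (Letter m n)) (x : ℕ) :
    (x = i.val + 1 → lev x (u ++ src i :: v) = lev x (u ++ tgt i :: v) + 1) ∧
    (x ≠ i.val + 1 → lev x (u ++ src i :: v) = lev x (u ++ tgt i :: v)) := by
  have := lev_replace i u v x
  split_ifs at this <;> omega

theorem lev_src (i : Node m n) (c : List (Letter m n)) :
    lev (i.val + 1) c = lev i.val c + c.count (src i) := by
  have := lev_succ (src i) c
  rwa [val_src] at this

theorem pairwise_split {c₁ c₂ : List (Letter m n)} {a : Letter m n}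
    (h : (c₁ ++ a :: c₂).Pairwise col) : c₁.Pairwise col ∧ c₂.Pairwise col :=
  ⟨(List.pairwise_append.1 h).1, (List.pairwise_cons.1 (List.pairwise_append.1 h).2.1).2⟩

/-- In terms of levels, the two columns differ only at the threshold `i + 1`, where `src i` counts
and `tgt i` does not. Raising the level of the left column is harmless; lowering it needs room, and
the signature rule provides it. -/
theorem dom_replace_left {i : Node m n} {c₁ c₂ d : List (Letter m n)} (hd : d.Pairwise col)
    (hc : (c₁ ++ src i :: c₂).Pairwise col) (h : Acts i (d ++ c₁) c₂) :
    Dom col (c₁ ++ src i :: c₂) d ↔ Dom col (c₁ ++ tgt i :: c₂) d := by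
  have hA : Acts i c₁ c₂ := by
    have := Acts.of_append (R := d) (S := []) (by simpa using h)
    exact this
  have hc' := (column_replace hA).1 hc
  rw [dom_iff_lev hc hd, dom_iff_lev hc' hd]
  have hlev := lev_replace_cases i c₁ c₂
  have hs := count_left_of_src hc
  have ht := count_right_of_tgt hc'
  constructor
  swap
  · intro k x
    have := k x
    have := hlev x
    have := hlev (x + 1)
    omega
  intro k x
  -- The inequalities that use the level of the left column at `i + 1` must be strict before that
  -- level drops by one. It is compared with the level of `d` at `i + 1` if the letter `i` is even,
  -- and at `i + 2` if the letter `i + 1` is odd; at the node 0 both occur.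
  have key : (i.val < m → lev (i.val + 1) d + 1 ≤ lev (i.val + 1) (c₁ ++ src i :: c₂)) ∧
      (m ≤ i.val + 1 → lev (i.val + 1 + 1) d + 1 ≤ lev (i.val + 1) (c₁ ++ src i :: c₂)) := by
    have e1 : (c₁ ++ src i :: c₂).count (src i) = c₁.count (src i) + c₂.count (src i) + 1 := by
      simp; omega
    have e2 : (c₁ ++ src i :: c₂).count (tgt i) = c₁.count (tgt i) + c₂.count (tgt i) := by
      simp [src_ne_tgt]
    have l1 := lev_src i d
    have l2 := lev_tgt i d
    have l3 := lev_src i (c₁ ++ src i :: c₂)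
    have l4 := lev_tgt i (c₁ ++ src i :: c₂)
    have z : i.val < m → lev i.val d ≤ lev i.val (c₁ ++ src i :: c₂) := by
      intro hm
      have hi0 : i.val - 1 + 1 = i.val ∨ i.val = 0 := by omega
      rcases hi0 with h0 | h0
      · have := (k (i.val - 1)).1 (by omega)
        rwa [h0] at this
      · rw [h0]; simp
    have z0 := k i.val
    have z1 := k (i.val + 1)
    have p1 := column_eps_phi i (pairwise_split hc).1
    have p2 := column_eps_phi i (pairwise_split hc).2
    have p3 := column_eps_phi i hd
    rcases lt_trichotomy (i.val + 1) m with hi | hi | hi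
    · have hh := h.1 hi
      have ha := word_append_barred hi d c₁
      have p1 := p1.1 hi
      have p2 := p2.1 hi
      have p3 := p3.1 hi
      have hs := hs.2 (by omega)
      have z0 := z0.1 (by omega)
      have z1 := z1.1 (by omega)
      have z := z (by omega)
      refine ⟨fun _ => ?_, by omega⟩
      rw [l3] at z0 ⊢
      rw [l4, l3] at z1
      rw [l2, l1] at z1
      rw [l1] at z0 ⊢
      rw [e1] at z0 z1 ⊢
      rw [e2] at z1
      clear k hlev ht hc hd hA hc' h l1 l2 l3 l4 e1 e2
      omega
    · have hh := h.2.2 hi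
      have h5 := word_append_zero hi d c₁
      have p3 := p3.2.2 hi
      have h6 : d.count (src i) = 0 ∧ d.count (tgt i) = 0 := by
        split_ifs at h5 with h7
        · exact p3.2.2.1 h7
        · rw [hh.1, hh.2] at h5
          rw [← h5.1, ← h5.2] at h7
          exact absurd rfl h7
      have z := z (by omega)
      rw [l2, l1, h6.1, h6.2, l3, e1]
      omega
    · have hh := h.2.1 hi
      have ha := word_append_odd hi d c₁
      have p1 := p1.2.1 hi
      have p3 := p3.2.1 hi
      have z0 := z0.2 (by omega)
      refine ⟨by omega, fun _ => ?_⟩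
      rw [l2, l3, e1]
      clear k hlev ht hc hd hA hc' h l1 l2 l3 l4 e1 e2
      omega
  have h1 := k x
  have h2 := hlev x
  have h3 := hlev (x + 1)
  clear k hlev
  by_cases hx : x = i.val
  · subst hx; omega
  · by_cases hx : x = i.val + 1
    · subst hx; omega
    · omega

/-- The mirror image of `dom_replace_left`: the changed column is now on the right, and the passage
from `tgt i` to `src i`, which raises its level, is the one that needs a strict inequality. -/
theorem dom_replace_right {i : Node m n} {c₁ c₂ b : List (Letter m n)} (hb : b.Pairwise col)
    (hc : (c₁ ++ src i :: c₂).Pairwise col) (h : Acts i c₁ (c₂ ++ b)) :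
    Dom col b (c₁ ++ src i :: c₂) ↔ Dom col b (c₁ ++ tgt i :: c₂) := by
  have hA : Acts i c₁ c₂ := by
    have := Acts.of_append (R := []) (S := b) (by simpa using h)
    exact this
  have hc' := (column_replace hA).1 hc
  rw [dom_iff_lev hb hc, dom_iff_lev hb hc']
  have hlev := lev_replace_cases i c₁ c₂
  have hs := count_left_of_src hc
  have ht := count_right_of_tgt hc'
  constructor
  · intro k x
    have := k x
    have := hlev x
    have := hlev (x + 1)
    omega
  intro k x
  have key : (i.val < m → lev (i.val + 1) (c₁ ++ tgt i :: c₂) + 1 ≤ lev (i.val + 1) b) ∧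
      (m ≤ i.val → lev (i.val + 1) (c₁ ++ tgt i :: c₂) + 1 ≤ lev i.val b) := by
    have e1 : (c₁ ++ tgt i :: c₂).count (src i) = c₁.count (src i) + c₂.count (src i) := by
      simp [tgt_ne_src]
    have e2 : (c₁ ++ tgt i :: c₂).count (tgt i) = c₁.count (tgt i) + c₂.count (tgt i) + 1 := by
      simp; omega
    have l1 := lev_src i b
    have l2 := lev_tgt i b
    have l3 := lev_src i (c₁ ++ tgt i :: c₂)
    have l4 := lev_tgt i (c₁ ++ tgt i :: c₂)
    have z : i.val < m → lev i.val (c₁ ++ tgt i :: c₂) ≤ lev i.val b := by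
      intro hm
      have hi0 : i.val - 1 + 1 = i.val ∨ i.val = 0 := by omega
      rcases hi0 with h0 | h0
      · have := (k (i.val - 1)).1 (by omega)
        rwa [h0] at this
      · rw [h0]; simp
    have z0 := k i.val
    have z1 := k (i.val + 1)
    have p1 := column_eps_phi i (pairwise_split hc).1
    have p2 := column_eps_phi i (pairwise_split hc).2
    have p3 := column_eps_phi i hb
    rcases lt_trichotomy (i.val + 1) m with hi | hi | hi
    · have hh := h.1 hi
      have ha := word_append_barred hi c₂ b
      have p1 := p1.1 hi
      have p2 := p2.1 hi
      have p3 := p3.1 hi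
      have hs := hs.2 (by omega)
      have ht := ht.2 hi
      have z0 := z0.1 (by omega)
      have z1 := z1.1 (by omega)
      have z := z (by omega)
      refine ⟨fun _ => ?_, by omega⟩
      rw [l3] at z0 ⊢
      rw [l4, l3] at z1
      rw [l2, l1] at z1
      rw [l1] at z0 ⊢
      rw [e1] at z0 z1 ⊢
      rw [e2] at z1
      clear k hlev hc hb hA hc' h l1 l2 l3 l4 e1 e2
      omega
    · have z1 := z1.2 (by omega)
      refine ⟨fun _ => ?_, by omega⟩
      rw [l4, e2] at z1
      omega
    · have hh := h.2.1 hi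
      have ha := word_append_odd hi c₂ b
      have p2 := p2.2.1 hi
      have p3 := p3.2.1 hi
      have z1 := z1.2 (by omega)
      refine ⟨by omega, fun _ => ?_⟩
      rw [l4, e2, l1] at z1
      clear k hlev hs ht hc hb hA hc' h l1 l2 l3 l4 e1 e2
      omega
  have h1 := k x
  have h3 := hlev (x + 1)
  clear k hlev
  by_cases hx : x = i.val
  · subst hx; omega
  · omega

theorem isTab_append_cons {T₁ T₂ : Filling m n} {c : List (Letter m n)} :
    IsTab (T₁ ++ c :: T₂) ↔ IsTab T₁ ∧ IsTab T₂ ∧ (c.Pairwise col ∧ c ≠ []) ∧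
      (∀ b ∈ T₁.getLast?, Dom col b c) ∧ ∀ d ∈ T₂.head?, Dom col c d := by
  unfold IsTab
  rw [List.isChain_append, List.isChain_cons]
  simp only [List.mem_append, List.mem_cons, List.head?_cons, Option.mem_some_iff]
  constructor
  · rintro ⟨h1, h2, h3, h4⟩
    exact ⟨⟨fun x hx => h1 x (Or.inl hx), h2⟩, ⟨fun x hx => h1 x (Or.inr (Or.inr hx)), h3.2⟩,
      h1 c (by simp), fun b hb => h4 b hb c rfl, h3.1⟩
  · rintro ⟨⟨h1, h2⟩, ⟨h3, h4⟩, h5, h6, h7⟩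
    refine ⟨?_, h2, ⟨h7, h4⟩, ?_⟩
    · rintro x (hx | rfl | hx)
      · exact h1 x hx
      · exact h5
      · exact h3 x hx
    · rintro b hb y rfl
      exact h6 b hb

/-- The change affects one column and its comparison with its two neighbours. `Acts.of_append`
restricts the hypothesis to each of these situations. -/
theorem isTab_replace {i : Node m n} {T₁ T₂ : Filling m n} {c₁ c₂ : List (Letter m n)}
    (h : Acts i (reading T₂ ++ c₁) (c₂ ++ reading T₁)) :
    IsTab (T₁ ++ (c₁ ++ src i :: c₂) :: T₂) ↔ IsTab (T₁ ++ (c₁ ++ tgt i :: c₂) :: T₂) := by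
  have hA : Acts i c₁ c₂ := h.of_append
  rw [isTab_append_cons, isTab_append_cons, ← column_replace hA]
  refine and_congr_right fun hT₁ => and_congr_right fun hT₂ => ?_
  have hne : ∀ a : Letter m n, (c₁ ++ a :: c₂ ≠ []) := by simp
  simp only [hne, ne_eq, not_false_eq_true, and_true]
  refine and_congr_right fun hc => and_congr ?_ ?_
  · refine forall₂_congr fun b hb => ?_
    obtain ⟨T, rfl⟩ := List.getLast?_eq_some_iff.1 (Option.mem_def.1 hb)
    refine dom_replace_right (hT₁.1 b (by simp)).1 hc ?_
    rw [reading_append, ← List.append_assoc] at h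
    simpa [reading] using h.of_append (R := reading T₂)
  · refine forall₂_congr fun d hd => ?_
    obtain ⟨T, rfl⟩ := List.head?_eq_some_iff.1 (Option.mem_def.1 hd)
    refine dom_replace_left (hT₂.1 d (by simp)).1 hc ?_
    rw [reading_cons, List.append_assoc] at h
    exact h.of_append

theorem splitLengths_flatten {α : Type*} (l : List (List α)) :
    (l.map List.length).splitLengths l.flatten = l := by
  induction l with
  | nil => simp
  | cons c l ih => simp [List.splitLengths_cons, ih]

theorem refill_reading {T T' : Filling m n} (h : T'.map List.length = T.map List.length) :
    refill T (reading T') = T' := by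
  rw [refill, List.map_reverse, ← h, ← List.map_reverse, reading, splitLengths_flatten,
    List.reverse_reverse]

theorem reading_e {i : Node m n} {T : Filling m n} (hT : IsTab T) {w : List (Letter m n)}
    (h : (wordCrystal m n).e i (reading T) = some w) :
    ∃ T', IsTab T' ∧ reading T' = w ∧ T'.map List.length = T.map List.length := by
  obtain ⟨u, v, h1, rfl, hA⟩ := word_e_eq_some_iff.1 h
  obtain ⟨T₁, c₁, c₂, T₂, rfl, rfl, rfl⟩ := reading_eq_append_cons h1
  exact ⟨_, (isTab_replace hA).2 hT, by simp [reading_append, reading_cons], by simp⟩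

theorem reading_f {i : Node m n} {T : Filling m n} (hT : IsTab T) {w : List (Letter m n)}
    (h : (wordCrystal m n).f i (reading T) = some w) :
    ∃ T', IsTab T' ∧ reading T' = w ∧ T'.map List.length = T.map List.length := by
  obtain ⟨u, v, h1, rfl, hA⟩ := word_f_eq_some_iff.1 h
  obtain ⟨T₁, c₁, c₂, T₂, rfl, rfl, rfl⟩ := reading_eq_append_cons h1
  exact ⟨_, (isTab_replace hA).1 hT, by simp [reading_append, reading_cons], by simp⟩

/-- The new word is the reading of a tableau of the same shape, so refilling the shape and inserting
the word give the same result. With `P` in place of `refill`, plactic invariance becomes applicable.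
-/
theorem tableau_e (i : Node m n) {T : Filling m n} (hT : IsTab T) :
    (tableauCrystal m n).e i T = ((wordCrystal m n).e i (reading T)).map P := by
  change ((wordCrystal m n).e i (reading T)).map (refill T) = _
  cases h : (wordCrystal m n).e i (reading T) with
  | none => rfl
  | some w =>
    obtain ⟨T', hT', rfl, hl⟩ := reading_e hT h
    simp [refill_reading hl, P_reading hT']

theorem tableau_f (i : Node m n) {T : Filling m n} (hT : IsTab T) :
    (tableauCrystal m n).f i T = ((wordCrystal m n).f i (reading T)).map P := by
  change ((wordCrystal m n).f i (reading T)).map (refill T) = _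
  cases h : (wordCrystal m n).f i (reading T) with
  | none => rfl
  | some w =>
    obtain ⟨T', hT', rfl, hl⟩ := reading_f hT h
    simp [refill_reading hl, P_reading hT']

theorem map_P_eq {x y : Option (List (Letter m n))} (h : Option.Rel (Plac col) x y) :
    x.map P = y.map P := by
  cases h with
  | none => rfl
  | some h => simp [P_eq_iff.2 h]

theorem tableau_e_P (i : Node m n) (w : List (Letter m n)) :
    (tableauCrystal m n).e i (P w) = ((wordCrystal m n).e i w).map P := by
  rw [tableau_e i (isTab_P w)]
  exact (map_P_eq ((plac_reading_P w).compat i).e).symm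

theorem tableau_f_P (i : Node m n) (w : List (Letter m n)) :
    (tableauCrystal m n).f i (P w) = ((wordCrystal m n).f i w).map P := by
  rw [tableau_f i (isTab_P w)]
  exact (map_P_eq ((plac_reading_P w).compat i).f).symm

theorem shape_P_e {i : Node m n} {w w' : List (Letter m n)} (h : (wordCrystal m n).e i w = some w') :
    (P w').map List.length = (P w).map List.length := by
  have h1 := tableau_e_P i w
  rw [h, tableau_e i (isTab_P w)] at h1
  cases h2 : (wordCrystal m n).e i (reading (P w)) with
  | none => rw [h2] at h1; simp at h1
  | some z =>
    rw [h2] at h1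
    obtain ⟨T', hT', rfl, hl⟩ := reading_e (isTab_P w) h2
    simp only [Option.map_some, Option.some.injEq, P_reading hT'] at h1
    rw [← h1, hl]

end TableauStability

end SuperCrystal

namespace SuperCrystal

/-! ### Tableaux as arrays of levels -/

section Levels

variable {m n : ℕ}

theorem shape_P_f {i : Node m n} {w w' : List (Letter m n)} (h : (wordCrystal m n).f i w = some w') :
    (P w').map List.length = (P w).map List.length :=
  (shape_P_e ((word_f_iff_e _ _ _).1 h)).symm

theorem count_le_one_of_even {c : List (Letter m n)} (hc : c.Pairwise col) {y : Letter m n}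
    (hy : y.val < m) : c.count y ≤ 1 := by
  by_contra h
  have h2 : [y, y].Sublist c := by
    have := List.replicate_sublist_iff.2 (show 2 ≤ c.count y by omega)
    simpa using this
  have := hc.sublist h2
  simp [col_iff] at this
  omega

/-- The number of letters below `x` in the `k`-th column. -/
def level (T : Filling m n) (k x : ℕ) : ℕ := lev x (T.getD k [])

/-- The inequalities that characterize the levels of a tableau. -/
structure IsLevel (m n : ℕ) (g : ℕ → ℕ → ℕ) : Prop where
  zero : ∀ k, g k 0 = 0
  mono : ∀ k x, x < m + n → g k x ≤ g k (x + 1)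
  even_step : ∀ k x, x < m → g k (x + 1) ≤ g k x + 1
  even_row : ∀ k x, x < m → g (k + 1) (x + 1) ≤ g k (x + 1)
  odd_row : ∀ k x, m ≤ x → x < m + n → g (k + 1) (x + 1) ≤ g k x

theorem pairwise_getD {T : Filling m n} (hT : IsTab T) (k : ℕ) : (T.getD k []).Pairwise col := by
  rcases lt_or_ge k T.length with h | h
  · rw [List.getD_eq_getElem _ _ h]
    exact (hT.1 _ (List.getElem_mem h)).1
  · rw [List.getD_eq_default _ _ h]
    exact List.Pairwise.nil

theorem dom_getD {T : Filling m n} (hT : IsTab T) (k : ℕ) :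
    Dom col (T.getD k []) (T.getD (k + 1) []) := by
  rcases lt_or_ge (k + 1) T.length with h | h
  · rw [List.getD_eq_getElem _ _ h, List.getD_eq_getElem _ _ (by omega)]
    exact List.isChain_iff_getElem.1 hT.2 k h
  · rw [List.getD_eq_default _ _ h]
    simp

theorem IsTab.isLevel {T : Filling m n} (hT : IsTab T) : IsLevel m n (level T) where
  zero k := lev_zero _
  mono k x _ := lev_mono (Nat.le_succ x) _
  even_step k x hx := by
    have := lev_succ (⟨x, by omega⟩ : Letter m n) (T.getD k [])
    have := count_le_one_of_even (pairwise_getD hT k) (y := ⟨x, by omega⟩) hx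
    unfold level
    simp only at *
    omega
  even_row k x hx :=
    ((dom_iff_lev (pairwise_getD hT k) (pairwise_getD hT (k + 1))).1 (dom_getD hT k) x).1 hx
  odd_row k x hx _ :=
    ((dom_iff_lev (pairwise_getD hT k) (pairwise_getD hT (k + 1))).1 (dom_getD hT k) x).2 hx

theorem IsLevel.le_self {g : ℕ → ℕ → ℕ} (h : IsLevel m n g) (k : ℕ) {x : ℕ} (hx : x ≤ m) :
    g k x ≤ x := by
  induction x with
  | zero => rw [h.zero]
  | succ x ih =>
    have := ih (by omega)
    have := h.even_step k x hx
    omega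

/-- The odd row inequality prevents growth along the diagonal, so the level is bounded by its value
at the threshold `m`, where each of the `m` even letters contributes at most one. For `j = n` this
is the hook condition. -/
theorem IsLevel.diagonal_le {g : ℕ → ℕ → ℕ} (h : IsLevel m n g) (k j : ℕ) (hj : j ≤ n) :
    g (k + j) (m + j) ≤ m := by
  induction j with
  | zero => exact h.le_self k le_rfl
  | succ j ih =>
    have := h.odd_row (k + j) (m + j) (by omega) (by omega)
    have := ih (by omega)
    simp only [Nat.add_assoc] at *
    omega

theorem level_top (T : Filling m n) (k : ℕ) : level T k (m + n) = (T.getD k []).length :=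
  lev_top le_rfl _

theorem not_col_iff {a b : Letter m n} : ¬ col b a ↔ a < b ∨ (a = b ∧ deg a = 0) := by
  rw [col_iff, Fin.lt_def, Fin.ext_iff, deg_eq_zero_iff]
  omega

theorem dom_col_iff {x y : List (Letter m n)} (hl : y.length ≤ x.length) :
    Dom col x y ↔ ∀ (r : ℕ) (a b : Letter m n), x[r]? = some a → y[r]? = some b →
      a < b ∨ (a = b ∧ deg a = 0) := by
  induction x generalizing y with
  | nil =>
    have : y = [] := List.eq_nil_of_length_eq_zero (by simpa using hl)
    subst this; simp
  | cons c x ih =>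
    cases y with
    | nil => simp
    | cons d y =>
      rw [dom_cons_cons, ih (by simpa using hl), not_col_iff]
      constructor
      · rintro ⟨h1, h2⟩ r a b ha hb
        cases r with
        | zero => simp at ha hb; subst ha hb; exact h1
        | succ r => exact h2 r a b (by simpa using ha) (by simpa using hb)
      · intro h
        exact ⟨h 0 c d (by simp) (by simp), fun r a b ha hb => h (r + 1) a b (by simpa) (by simpa)⟩

theorem Dom.length_le {α : Type*} {r : α → α → Prop} {y x : List α} (h : Dom r y x) :
    x.length ≤ y.length := by
  induction y generalizing x with
  | nil =>
    cases x with
    | nil => simp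
    | cons a x => simp at h
  | cons b y ih =>
    cases x with
    | nil => simp
    | cons a x => simpa using ih h.2

theorem isHookTableau_iff {lam : YoungDiagram} {T : Filling m n} :
    IsHookTableau lam T ↔ IsTab T ∧ T.map List.length = lam.transpose.rowLens := by
  have hcol : ∀ c : List (Letter m n),
      c.IsChain (fun a b => a < b ∨ (a = b ∧ deg a = 1)) ↔ c.Pairwise col := by
    intro c
    have : IsTrans (Letter m n) col := ⟨fun _ _ _ => col_trans⟩
    exact List.isChain_iff_pairwise (R := col)
  have hlen : T.map List.length = lam.transpose.rowLens →
      T.IsChain (fun x y => y.length ≤ x.length) := by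
    intro h
    have := lam.transpose.rowLens_sorted.pairwise
    rw [← h, List.pairwise_map] at this
    exact this.isChain
  constructor
  · rintro ⟨h1, h2, h3⟩
    refine ⟨⟨fun c hc => ⟨(hcol c).1 (h2 c hc), ?_⟩, ?_⟩, h1⟩
    · rintro rfl
      have : 0 ∈ lam.transpose.rowLens := by
        rw [← h1]; exact List.mem_map.2 ⟨[], hc, rfl⟩
      exact absurd (lam.transpose.pos_of_mem_rowLens 0 this) (by simp)
    · have := (isChain_and_iff _ _ T).1 ⟨hlen h1, h3⟩
      exact this.imp fun x y h => (dom_col_iff h.1).2 h.2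
  · rintro ⟨⟨h1, h2⟩, h3⟩
    exact ⟨h3, fun c hc => (hcol c).2 (h1 c hc).1,
      h2.imp fun x y h => (dom_col_iff h.length_le).1 h⟩

theorem IsTab.exists_isHook {T : Filling m n} (hT : IsTab T) :
    ∃ lam : YoungDiagram, IsHook m n lam ∧ T.map List.length = lam.transpose.rowLens := by
  have hs : (T.map List.length).SortedGE := by
    have h1 : T.IsChain (fun x y => y.length ≤ x.length) := hT.2.imp fun _ _ h => h.length_le
    have : IsTrans (List (Letter m n)) (fun x y => y.length ≤ x.length) :=
      ⟨fun _ _ _ h h' => le_trans h' h⟩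
    have := List.isChain_iff_pairwise.1 h1
    exact List.Pairwise.sortedGE (List.pairwise_map.2 this)
  have hr := YoungDiagram.rowLens_ofRowLens_eq_self (w := T.map List.length) (hw := hs) (by
    intro x hx
    obtain ⟨c, hc, rfl⟩ := List.mem_map.1 hx
    exact List.length_pos_iff.2 (hT.1 c hc).2)
  refine ⟨(YoungDiagram.ofRowLens _ hs).transpose, ?_, by simpa using hr.symm⟩
  unfold IsHook
  by_contra h
  have h1 : (n, m) ∈ YoungDiagram.ofRowLens _ hs := by
    have : (m, n) ∈ (YoungDiagram.ofRowLens _ hs).transpose := by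
      rw [YoungDiagram.mem_iff_lt_rowLen]; omega
    simpa using this
  rw [YoungDiagram.mem_ofRowLens] at h1
  obtain ⟨h2, h3⟩ := h1
  simp only [List.length_map, List.getElem_map] at h2 h3
  -- A box in row `m` and column `n`, counted from 0, would give that column more than `m` entries.
  have h4 := hT.isLevel.diagonal_le 0 n le_rfl
  rw [Nat.zero_add, level_top, List.getD_eq_getElem _ _ h2] at h4
  omega

/-- The sorted column with prescribed levels. -/
def columnOf (m n : ℕ) (h : ℕ → ℕ) : List (Letter m n) :=
  (List.finRange (m + n)).flatMap fun y => List.replicate (h (y.val + 1) - h y.val) y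

theorem count_columnOf (h : ℕ → ℕ) (y : Letter m n) :
    (columnOf m n h).count y = h (y.val + 1) - h y.val := by
  rw [columnOf, List.count_flatMap]
  have : ∀ l : List (Letter m n), l.Nodup →
      (l.map (List.count y ∘ fun y => List.replicate (h (y.val + 1) - h y.val) y)).sum =
        if y ∈ l then h (y.val + 1) - h y.val else 0 := by
    intro l hl
    induction l with
    | nil => simp
    | cons a l ih =>
      rw [List.nodup_cons] at hl
      rw [List.map_cons, List.sum_cons, ih hl.2]
      by_cases hay : a = y
      · subst hay; simp [hl.1]
      · simp [List.count_replicate, hay, Ne.symm hay]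
  rw [this _ (List.nodup_finRange _)]
  simp

theorem lev_columnOf {h : ℕ → ℕ} (h0 : h 0 = 0) (hm : ∀ x < m + n, h x ≤ h (x + 1)) {x : ℕ}
    (hx : x ≤ m + n) : lev x (columnOf m n h) = h x := by
  induction x with
  | zero => simp [h0]
  | succ x ih =>
    have h1 := lev_succ (⟨x, by omega⟩ : Letter m n) (columnOf m n h)
    rw [count_columnOf] at h1
    have h2 := hm x (by omega)
    have h3 := ih (by omega)
    simp only at h1
    omega

theorem pairwise_columnOf {h : ℕ → ℕ} (he : ∀ x < m, h (x + 1) ≤ h x + 1) :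
    (columnOf m n h).Pairwise col := by
  rw [columnOf, List.pairwise_flatMap]
  constructor
  · intro y _
    rw [List.pairwise_replicate]
    rw [col_iff]
    by_cases hy : y.val < m
    · have := he y.val hy
      left; omega
    · right; right; exact ⟨rfl, by omega⟩
  · refine (List.pairwise_lt_finRange (m + n)).imp ?_
    intro a b hab x hx y hy
    rw [List.mem_replicate] at hx hy
    rw [hx.2, hy.2, col_iff]
    exact Or.inl hab

theorem lev_eq_of_le {c d : List (Letter m n)} (h : ∀ x ≤ m + n, lev x c = lev x d) (x : ℕ) :
    lev x c = lev x d := by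
  rcases le_total x (m + n) with hx | hx
  · exact h x hx
  · rw [lev_top hx, lev_top hx, ← lev_top le_rfl c, ← lev_top le_rfl d, h _ le_rfl]

theorem column_ext {c d : List (Letter m n)} (hc : c.Pairwise col) (hd : d.Pairwise col)
    (h : ∀ x ≤ m + n, lev x c = lev x d) : c = d := by
  refine List.Perm.eq_of_pairwise ?_ hc hd ?_
  · intro a b _ _ h1 h2
    rw [col_iff] at h1 h2
    exact Fin.ext (by omega)
  · rw [List.perm_iff_count]
    intro y
    have h1 := lev_succ y c
    have h2 := lev_succ y d
    rw [lev_eq_of_le h, lev_eq_of_le h] at h1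
    omega

theorem length_eq_of_level {T T' : Filling m n} (hT : IsTab T) (hT' : IsTab T')
    (h : ∀ k, level T k (m + n) = level T' k (m + n)) : T.length = T'.length := by
  have key : ∀ S S' : Filling m n, IsTab S → (∀ k, level S k (m + n) = level S' k (m + n)) →
      S.length ≤ S'.length := by
    intro S S' hS h
    by_contra hc
    have h1 := h S'.length
    rw [level_top, level_top, List.getD_eq_default S' _ le_rfl,
      List.getD_eq_getElem _ _ (by omega)] at h1
    exact (hS.1 _ (List.getElem_mem _)).2 (List.eq_nil_of_length_eq_zero h1)
  exact le_antisymm (key _ _ hT h) (key _ _ hT' fun k => (h k).symm)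

theorem tab_ext {T T' : Filling m n} (hT : IsTab T) (hT' : IsTab T')
    (h : ∀ k, ∀ x ≤ m + n, level T k x = level T' k x) : T = T' := by
  refine List.ext_getElem (length_eq_of_level hT hT' fun k => h k _ le_rfl) fun k hk hk' => ?_
  have := column_ext (pairwise_getD hT k) (pairwise_getD hT' k) (h k)
  rwa [List.getD_eq_getElem _ _ hk, List.getD_eq_getElem _ _ hk'] at this

theorem level_of_length_map_eq {T T' : Filling m n} (h : T'.map List.length = T.map List.length)
    (k : ℕ) : level T' k (m + n) = level T k (m + n) := by
  rw [level_top, level_top]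
  have := congrArg (fun l => l.getD k 0) h
  have ho : ∀ o : Option (List (Letter m n)), (o.map List.length).getD 0 = (o.getD []).length := by
    rintro (_ | _) <;> rfl
  simpa [List.getD_eq_getElem?_getD, ho] using this

theorem length_map_eq_of_level {T T' : Filling m n} (hT : IsTab T) (hT' : IsTab T')
    (h : ∀ k, level T k (m + n) = level T' k (m + n)) :
    T.map List.length = T'.map List.length := by
  refine List.ext_getElem (by simpa using length_eq_of_level hT hT' h) fun k hk hk' => ?_
  have := h k
  simp only [List.length_map] at hk hk'
  rw [level_top, level_top, List.getD_eq_getElem _ _ hk, List.getD_eq_getElem _ _ hk'] at this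
  simpa using this

/-- The tableau with prescribed levels. -/
theorem IsLevel.exists_tab {g : ℕ → ℕ → ℕ} (hg : IsLevel m n g) (N : ℕ)
    (hN : ∀ k, 0 < g k (m + n) ↔ k < N) :
    ∃ T : Filling m n, IsTab T ∧ ∀ k, ∀ x ≤ m + n, level T k x = g k x := by
  have hp : ∀ k, (columnOf m n (g k)).Pairwise col := fun k => pairwise_columnOf (hg.even_step k)
  have hl : ∀ k, ∀ x ≤ m + n, lev x (columnOf m n (g k)) = g k x := fun k x hx =>
    lev_columnOf (hg.zero k) (hg.mono k) hx
  refine ⟨(List.range N).map fun k => columnOf m n (g k), ⟨?_, ?_⟩, ?_⟩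
  · intro c hc
    obtain ⟨k, hk, rfl⟩ := List.mem_map.1 hc
    refine ⟨hp k, fun h0 => ?_⟩
    have := hl k _ le_rfl
    rw [h0, lev_nil] at this
    have := (hN k).2 (List.mem_range.1 hk)
    omega
  · rw [List.isChain_iff_getElem]
    intro k hk
    simp only [List.length_map, List.length_range] at hk
    simp only [List.getElem_map, List.getElem_range]
    rw [dom_iff_lev (hp _) (hp _)]
    intro x
    constructor
    · intro hx
      rw [hl _ _ (by omega), hl _ _ (by omega)]
      exact hg.even_row k x hx
    · intro hx
      rcases lt_or_ge x (m + n) with h | h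
      · rw [hl _ _ (by omega), hl _ _ (by omega)]
        exact hg.odd_row k x hx h
      -- Beyond the last letter both levels are column lengths. They are compared by the row
      -- inequality for the last odd letter or, if `n = 0`, by the even one.
      · rw [lev_top (by omega), lev_top (by omega), ← lev_top le_rfl, ← lev_top le_rfl,
          hl _ _ le_rfl, hl _ _ le_rfl]
        have hmono : ∀ j x, x ≤ m → g (j + 1) x ≤ g j x := by
          intro j x hx
          cases x with
          | zero => rw [hg.zero, hg.zero]
          | succ x => exact hg.even_row j x hx
        rcases Nat.eq_zero_or_pos n with h0 | h0
        · exact hmono k _ (by omega)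
        · have h1 := hg.odd_row k (m + n - 1) (by omega) (by omega)
          have h2 := hg.mono k (m + n - 1) (by omega)
          rw [show m + n - 1 + 1 = m + n by omega] at h1 h2
          omega
  · intro k x hx
    unfold level
    rcases lt_or_ge k N with h | h
    · rw [List.getD_eq_getElem _ _ (by simpa using h)]
      simpa using hl k x hx
    · rw [List.getD_eq_default _ _ (by simpa using h), lev_nil]
      have h1 : g k (m + n) = 0 := by
        have := (hN k).not.2 (by omega); omega
      have h2 : g k x ≤ g k (m + n) := by
        clear h hN
        induction hx using Nat.decreasingInduction with
        | self => exact le_rfl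
        | of_succ y hy ih => exact (hg.mono k y hy).trans ih
      omega

end Levels

end SuperCrystal

namespace SuperCrystal

/-! ### Connectedness of the crystal of tableaux of a given shape -/

section Connectivity

variable {m n : ℕ}

/-- Two tableaux are linked if a path of arrows, followed in either direction, joins them. -/
def Linked (T T' : Filling m n) : Prop :=
  Relation.EqvGen (fun S S' => ∃ i, (wordCrystal m n).f i (reading S) = some (reading S')) T T'

theorem level_replace (i : Node m n) (T₁ T₂ : Filling m n) (c₁ c₂ : List (Letter m n)) (k x : ℕ) :
    level (T₁ ++ (c₁ ++ src i :: c₂) :: T₂) k x = level (T₁ ++ (c₁ ++ tgt i :: c₂) :: T₂) k x +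
      if k = T₁.length ∧ x = i.val + 1 then 1 else 0 := by
  unfold level
  rcases lt_trichotomy k T₁.length with h | h | h
  · rw [List.getD_append _ _ _ _ h, List.getD_append _ _ _ _ h, if_neg (by omega)]
    rfl
  · subst h
    rw [List.getD_append_right _ _ _ _ le_rfl, List.getD_append_right _ _ _ _ le_rfl]
    simp [lev_replace]
  · rw [List.getD_append_right _ _ _ _ h.le, List.getD_append_right _ _ _ _ h.le,
      if_neg (by omega)]
    obtain ⟨d, hd⟩ : ∃ d, k - T₁.length = d + 1 := ⟨k - T₁.length - 1, by omega⟩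
    rw [hd]; rfl

theorem exists_raise {i : Node m n} {T : Filling m n} (hT : IsTab T)
    (h : 0 < (wordCrystal m n).eps i (reading T)) :
    ∃ T', IsTab T' ∧ T'.map List.length = T.map List.length ∧ Linked T' T ∧
      ∃ j < T.length, ∀ k x, level T' k x = level T k x +
        if k = j ∧ x = i.val + 1 then 1 else 0 := by
  obtain ⟨w, hw⟩ := Option.isSome_iff_exists.1 (word_e_isSome h)
  obtain ⟨u, v, h1, rfl, hA⟩ := (word_e_eq_some_iff).1 hw
  obtain ⟨T₁, c₁, c₂, T₂, rfl, rfl, rfl⟩ := reading_eq_append_cons h1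
  refine ⟨_, (isTab_replace hA).2 hT, by simp, Relation.EqvGen.rel _ _ ⟨i, ?_⟩,
    T₁.length, by simp, level_replace i T₁ T₂ c₁ c₂⟩
  rw [word_f_iff_e, hw]
  simp [reading_append, reading_cons]

theorem exists_lower {i : Node m n} {T : Filling m n} (hT : IsTab T)
    (h : 0 < (wordCrystal m n).phi i (reading T)) :
    ∃ T', IsTab T' ∧ T'.map List.length = T.map List.length ∧ Linked T T' ∧
      ∃ j < T.length, ∀ k x, level T k x = level T' k x +
        if k = j ∧ x = i.val + 1 then 1 else 0 := by
  obtain ⟨w, hw⟩ := Option.isSome_iff_exists.1 (word_f_isSome h)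
  obtain ⟨u, v, h1, rfl, hA⟩ := (word_f_eq_some_iff).1 hw
  obtain ⟨T₁, c₁, c₂, T₂, rfl, rfl, rfl⟩ := reading_eq_append_cons h1
  refine ⟨_, (isTab_replace hA).1 hT, by simp, Relation.EqvGen.rel _ _ ⟨i, ?_⟩,
    T₁.length, by simp, level_replace i T₁ T₂ c₁ c₂⟩
  rw [hw]
  simp [reading_append, reading_cons]

theorem reading_drop (T : Filling m n) (k : ℕ) :
    reading (T.drop k) = reading (T.drop (k + 1)) ++ T.getD k [] := by
  rcases lt_or_ge k T.length with h | h
  · rw [List.drop_eq_getElem_cons h, reading_cons, List.getD_eq_getElem _ _ h]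
  · rw [List.drop_eq_nil_of_le h, List.drop_eq_nil_of_le (by omega), List.getD_eq_default _ _ h]
    rfl

theorem level_eq_zero_of_length_le {T : Filling m n} {k : ℕ} (h : T.length ≤ k) (x : ℕ) :
    level T k x = 0 := by
  unfold level
  rw [List.getD_eq_default _ _ h, lev_nil]

theorem count_getD (T : Filling m n) (k : ℕ) (y : Letter m n) :
    level T k (y.val + 1) = level T k y.val + (T.getD k []).count y :=
  lev_succ y _

theorem drop_induction {p : ℕ → Prop} (N : ℕ) (h0 : ∀ k, N ≤ k → p k)
    (hs : ∀ k, p (k + 1) → p k) (k : ℕ) : p k := by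
  rcases le_total N k with h | h
  · exact h0 k h
  · induction h using Nat.decreasingInduction with
    | self => exact h0 N le_rfl
    | of_succ k _ ih => exact hs k ih

theorem count_sub_word {i : Node m n} (hi : i.val + 1 ≠ m) (w : List (Letter m n)) :
    (wordCrystal m n).phi i w + w.count (tgt i) = (wordCrystal m n).eps i w + w.count (src i) := by
  induction w with
  | nil => simp
  | cons b w ih =>
    have h2 : (b :: w).count (src i) = w.count (src i) + lf i b := by simp [List.count_cons, lf]
    have h3 : (b :: w).count (tgt i) = w.count (tgt i) + le i b := by simp [List.count_cons, le]
    rw [h2, h3]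
    rcases lt_or_gt_of_ne hi with hi | hi
    · have := word_cons_barred hi b w
      omega
    · have := word_cons_odd hi b w
      omega

/-- Without any `src i` in `u`, nothing cancels a `tgt i` of `u`; at the node 0, the first relevant
letter of the word is then `tgt i`. -/
theorem eps_pos_of_count {i : Node m n} (hi : i.val + 1 ≤ m) {u : List (Letter m n)}
    (hs : u.count (src i) = 0) (ht : 0 < u.count (tgt i)) (w : List (Letter m n)) :
    0 < (wordCrystal m n).eps i (u ++ w) := by
  induction u with
  | nil => simp at ht
  | cons b u ih =>
    rw [List.count_cons] at hs ht
    rw [List.cons_append]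
    have hb : lf i b = 0 := by
      unfold lf; rw [if_neg]; rintro rfl; simp at hs
    by_cases hbt : b = tgt i
    · have h1 : le i b = 1 := by rw [hbt, le_tgt]
      rcases hi.lt_or_eq with hi | hi
      · have := word_cons_barred hi b (u ++ w); omega
      · have := word_cons_zero hi b (u ++ w)
        rw [h1] at this; simp at this; omega
    · have h1 : le i b = 0 := by unfold le; rw [if_neg hbt]
      have := ih (by omega) (by simpa [hbt] using ht)
      rcases hi.lt_or_eq with hi | hi
      · have := word_cons_barred hi b (u ++ w); omega
      · have := word_cons_zero hi b (u ++ w)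
        rw [h1, hb] at this; simp at this; omega

/-- The total level at `a`. -/
def levelSum (T : Filling m n) (a : ℕ) : ℕ := ∑ k ∈ Finset.range T.length, level T k a

theorem length_eq_of_map {T T' : Filling m n} (h : T'.map List.length = T.map List.length) :
    T'.length = T.length := by
  simpa using congrArg List.length h

theorem levelSum_of_raise {T T' : Filling m n} (h : T'.map List.length = T.map List.length)
    {j x : ℕ} (hj : j < T.length)
    (hl : ∀ k y, level T' k y = level T k y + if k = j ∧ y = x then 1 else 0) :
    levelSum T' x = levelSum T x + 1 := by
  unfold levelSum
  rw [length_eq_of_map h]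
  simp only [hl, and_true, Finset.sum_add_distrib]
  rw [Finset.sum_ite_eq' (Finset.range T.length) j (fun _ => 1)]
  simp [hj]

/-- The statement that the tableaux of a shape are linked as soon as their levels from `a` on
agree. -/
def LinkedFrom (m n a : ℕ) : Prop :=
  ∀ T T' : Filling m n, IsTab T → IsTab T' →
    (∀ k x, a ≤ x → x ≤ m + n → level T k x = level T' k x) → Linked T T'

theorem Linked.trans {S T U : Filling m n} (h : Linked S T) (h' : Linked T U) : Linked S U :=
  Relation.EqvGen.trans _ _ _ h h'

theorem Linked.symm {S T : Filling m n} (h : Linked S T) : Linked T S :=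
  Relation.EqvGen.symm _ _ h

theorem level_pos_iff {T : Filling m n} (hT : IsTab T) (k : ℕ) :
    0 < level T k (m + n) ↔ k < T.length := by
  rw [level_top]
  rcases lt_or_ge k T.length with h | h
  · rw [List.getD_eq_getElem _ _ h]
    simpa [h] using List.length_pos_iff.2 (hT.1 _ (List.getElem_mem h)).2
  · rw [List.getD_eq_default _ _ h]; simp; omega

/-- Raise the level `a` of an entry, for a letter `a` that is even or the smallest odd one. -/
theorem exists_linked_raise {a : ℕ} (ha0 : 0 < a) (ha : a ≤ m) (hn : a < m + n)
    (ih : LinkedFrom m n a) {T : Filling m n} (hT : IsTab T) {k₁ : ℕ}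
    (hk : level T k₁ a < min (level T k₁ (a + 1)) a) :
    ∃ T', IsTab T' ∧ Linked T T' ∧ T'.length = T.length ∧ levelSum T' a = levelSum T a + 1 ∧
      ∀ k x, a < x → level T' k x = level T k x := by
  have hL := hT.isLevel
  -- Levels from `a` on are kept; below `a` they are made as large as possible. The induction
  -- hypothesis links `T` to the tableau `S` with these levels. In `S`, no letter `a - 1` occurs
  -- from column `k₁` on, while column `k₁` contains the letter `a`, so e_i can be applied for the
  -- node joining them.
  set g : ℕ → ℕ → ℕ := fun k x => if a ≤ x then level T k x else min (level T k a) x with hg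
  have hrow : ∀ k, level T (k + 1) a ≤ level T k a := fun k => by
    have := hL.even_row k (a - 1) (by omega)
    rwa [show a - 1 + 1 = a by omega] at this
  have g1 : ∀ k x, a ≤ x → g k x = level T k x := fun k x hx => if_pos hx
  have g2 : ∀ k x, x ≤ a → g k x = min (level T k a) x := fun k x hx => by
    rcases hx.lt_or_eq with h | rfl
    · exact if_neg (by omega)
    · rw [g1 _ _ le_rfl, min_eq_left (hL.le_self k ha)]
  have hG : IsLevel m n g := by
    refine ⟨fun k => ?_, fun k x hx => ?_, fun k x hx => ?_, fun k x hx => ?_, fun k x hx hx' => ?_⟩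
    · rw [g2 _ _ (by omega)]; simp
    · rcases le_or_gt a x with h | h
      · rw [g1 _ _ h, g1 _ _ (by omega)]; exact hL.mono k x hx
      · rw [g2 _ _ h.le, g2 _ _ h]; omega
    · rcases le_or_gt a x with h | h
      · rw [g1 _ _ h, g1 _ _ (by omega)]; exact hL.even_step k x hx
      · rw [g2 _ _ h.le, g2 _ _ h]; omega
    · rcases le_or_gt a x with h | h
      · rw [g1 _ _ (by omega), g1 _ _ (by omega)]; exact hL.even_row k x hx
      · rw [g2 _ _ h, g2 _ _ h]
        have := hrow k
        omega
    · rw [g1 _ _ (by omega), g1 _ _ (by omega)]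
      exact hL.odd_row k x hx hx'
  obtain ⟨S, hS, hSl⟩ := hG.exists_tab T.length (fun k => by
    rw [g1 _ _ (by omega)]; exact level_pos_iff hT k)
  have hTS : ∀ k x, a ≤ x → x ≤ m + n → level T k x = level S k x := fun k x hx hx' => by
    rw [hSl k x hx', g1 _ _ hx]
  have hlink := ih T S hT hS hTS
  have hlen : T.map List.length = S.map List.length :=
    length_map_eq_of_level hT hS fun k => hTS k _ (by omega) le_rfl
  let i : Node m n := ⟨a - 1, by omega⟩
  have hi : i.val + 1 = a := by simp only [i]; omega
  have hsrc : (src i).val + 1 = a := by rw [val_src]; exact hi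
  have htgt : (tgt i).val = a := by rw [val_tgt]; exact hi
  have hcs : ∀ k, k₁ ≤ k → (reading (S.drop k)).count (src i) = 0 := by
    refine drop_induction S.length (fun k hk _ => ?_) (fun k ih2 hk2 => ?_)
    · rw [List.drop_eq_nil_of_le hk]; rfl
    · rw [reading_drop, List.count_append, ih2 (by omega)]
      have h1 := count_getD S k (src i)
      rw [hsrc, hSl _ _ (by omega), hSl _ _ (by omega)] at h1
      rw [g1 _ _ le_rfl, g2 _ _ (by omega)] at h1
      have h2 : level T k a ≤ level T k₁ a := by
        clear h1 ih2
        induction hk2 with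
        | refl => exact le_rfl
        | step h ih3 => exact (hrow _).trans ih3
      omega
  have hct : 0 < (reading (S.drop k₁)).count (tgt i) := by
    rw [reading_drop, List.count_append]
    have h1 := count_getD S k₁ (tgt i)
    rw [htgt, ← hTS _ _ (by omega) (by omega), ← hTS _ _ (by omega) (by omega)] at h1
    omega
  have heps : 0 < (wordCrystal m n).eps i (reading S) := by
    rw [← List.take_append_drop k₁ S, reading_append]
    exact eps_pos_of_count (by omega) (hcs k₁ le_rfl) hct _
  obtain ⟨T', hT', hl', hlk, j, hj, hlev⟩ := exists_raise hS heps
  refine ⟨T', hT', hlink.trans hlk.symm, ?_, ?_, ?_⟩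
  · rw [length_eq_of_map hl', length_eq_of_map hlen.symm]
  · rw [hi] at hlev
    rw [levelSum_of_raise hl' hj hlev, levelSum, levelSum, length_eq_of_map hlen.symm]
    simp only [hTS _ a le_rfl hn.le]
  · intro k x hx
    rw [hlev, if_neg (by omega)]
    rcases le_total x (m + n) with h | h
    · exact (hTS k x hx.le h).symm
    · unfold level
      rw [lev_top h, lev_top h, ← level_top, ← level_top]
      exact (hTS k _ (by omega) le_rfl).symm

/-- Lower the level `a` of an entry, for an odd letter `a` that is not the smallest one. -/
theorem exists_linked_lower {a : ℕ} (ha : m < a) (hn : a < m + n)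
    (ih : LinkedFrom m n a) {T : Filling m n} (hT : IsTab T) {k₁ : ℕ}
    (hk : level T (k₁ + 1) (a + 1) < level T k₁ a) :
    ∃ T', IsTab T' ∧ Linked T T' ∧ T'.length = T.length ∧ levelSum T a = levelSum T' a + 1 ∧
      ∀ k x, a < x → level T' k x = level T k x := by
  have hL := hT.isLevel
  -- Between `m` and `a` the levels are made as small as the odd row inequality permits, so that the
  -- level of column `k` at `a - 1` is that of column `k + 1` at `a`. By telescoping, the columns
  -- from `k` on contain `level T k a` letters `a - 1`.
  set g : ℕ → ℕ → ℕ := fun k x => if a ≤ x then level T k x else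
    if m ≤ x then level T (k + a - x) a else min (level T (k + a - m) a) x with hg
  have hrow : ∀ k, level T (k + 1) a ≤ level T k a := fun k => by
    have := hL.odd_row k (a - 1) (by omega) (by omega)
    have := hL.mono k (a - 1) (by omega)
    rw [show a - 1 + 1 = a by omega] at *
    omega
  have hdiag : ∀ k, level T (k + a - m) a ≤ m := fun k => by
    have := hL.diagonal_le k (a - m) (by omega)
    rwa [show k + (a - m) = k + a - m by omega, show m + (a - m) = a by omega] at this
  have g1 : ∀ k x, a ≤ x → g k x = level T k x := fun k x hx => if_pos hx
  have g2 : ∀ k x, m ≤ x → x ≤ a → g k x = level T (k + a - x) a := fun k x hx hx' => by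
    rcases hx'.lt_or_eq with h | rfl
    · simp only [hg]; rw [if_neg (by omega), if_pos hx]
    · rw [g1 _ _ le_rfl, Nat.add_sub_cancel]
  have g3 : ∀ k x, x ≤ m → g k x = min (level T (k + a - m) a) x := fun k x hx => by
    rcases hx.lt_or_eq with h | rfl
    · simp only [hg]; rw [if_neg (by omega), if_neg (by omega)]
    · rw [g2 _ _ le_rfl ha.le, min_eq_left (hdiag k)]
  have hG : IsLevel m n g := by
    refine ⟨fun k => ?_, fun k x hx => ?_, fun k x hx => ?_, fun k x hx => ?_, fun k x hx hx' => ?_⟩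
    · rw [g3 _ _ (by omega)]; simp
    · rcases le_or_gt a x with h | h
      · rw [g1 _ _ h, g1 _ _ (by omega)]; exact hL.mono k x hx
      · rcases le_or_gt m x with h' | h'
        · rw [g2 _ _ h' h.le, g2 _ _ (by omega) h]
          have := hrow (k + a - (x + 1))
          rwa [show k + a - (x + 1) + 1 = k + a - x by omega] at this
        · rw [g3 _ _ h'.le, g3 _ _ h']; omega
    · rw [g3 _ _ hx.le, g3 _ _ hx]; omega
    · have h1 := hrow (k + a - m)
      rw [show k + a - m + 1 = k + 1 + a - m by omega] at h1
      rw [g3 _ _ hx, g3 _ _ hx]; omega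
    · rcases le_or_gt a x with h | h
      · rw [g1 _ _ h, g1 _ _ (by omega)]; exact hL.odd_row k x hx hx'
      · rw [g2 _ _ hx h.le, g2 _ _ (by omega) h, show k + 1 + a - (x + 1) = k + a - x by omega]
  obtain ⟨S, hS, hSl⟩ := hG.exists_tab T.length (fun k => by
    rw [g1 _ _ (by omega)]; exact level_pos_iff hT k)
  have hTS : ∀ k x, a ≤ x → x ≤ m + n → level T k x = level S k x := fun k x hx hx' => by
    rw [hSl k x hx', g1 _ _ hx]
  have hlink := ih T S hT hS hTS
  have hlen : T.map List.length = S.map List.length :=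
    length_map_eq_of_level hT hS fun k => hTS k _ (by omega) le_rfl
  let i : Node m n := ⟨a - 1, by omega⟩
  have hi : i.val + 1 = a := by simp only [i]; omega
  have hsrc : (src i).val + 1 = a := by rw [val_src]; exact hi
  have htgt : (tgt i).val = a := by rw [val_tgt]; exact hi
  have hsk : ∀ k, level T k a = level T (k + 1) a + (S.getD k []).count (src i) := fun k => by
    have h1 := count_getD S k (src i)
    rw [hsrc, hSl _ _ (by omega), hSl _ _ (by omega)] at h1
    rwa [g1 _ _ le_rfl, g2 _ _ (by omega) (by omega),
      show k + a - (src i).val = k + 1 by omega] at h1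
  have htk : ∀ k, level T k (a + 1) = level T k a + (S.getD k []).count (tgt i) := fun k => by
    have h1 := count_getD S k (tgt i)
    rwa [htgt, ← hTS _ _ (by omega) (by omega), ← hTS _ _ (by omega) (by omega)] at h1
  have hcs : ∀ k, (reading (S.drop k)).count (src i) = level T k a ∧
      (reading (S.drop k)).count (tgt i) ≤ level T k (a + 1) := by
    refine drop_induction S.length (fun k hk => ?_) (fun k ih2 => ?_)
    · rw [List.drop_eq_nil_of_le hk, level_eq_zero_of_length_le]
      · simp
      · rwa [length_eq_of_map hlen]
    · rw [reading_drop, List.count_append, List.count_append]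
      have h1 := hsk k
      have h2 := htk k
      have h3 := hL.odd_row k a (by omega) hn
      omega
  -- The columns to the right of `k₁` contain `level T (k₁ + 1) a` letters `src i` and at most
  -- `level T (k₁ + 1) (a + 1)` letters `tgt i`. With the `src i` of column `k₁`, at least `level T
  -- k₁ a - level T (k₁ + 1) (a + 1)` of them remain uncancelled, and this number is positive by
  -- `hk`.
  have hphi : 0 < (wordCrystal m n).phi i (reading S) := by
    rw [← List.take_append_drop k₁ S, reading_append, reading_drop]
    have him : m < i.val + 1 := by omega
    have h1 := word_append_odd him (reading (S.drop (k₁ + 1)) ++ S.getD k₁ []) (reading (S.take k₁))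
    have h2 := word_append_odd him (reading (S.drop (k₁ + 1))) (S.getD k₁ [])
    have h3 := (column_eps_phi i (pairwise_getD hS k₁)).2.1 him
    have h4 := count_sub_word (by omega) (i := i) (reading (S.drop (k₁ + 1)))
    have h5 := hcs (k₁ + 1)
    have h6 := hsk k₁
    omega
  obtain ⟨T', hT', hl', hlk, j, hj, hlev⟩ := exists_lower hS hphi
  refine ⟨T', hT', hlink.trans hlk, ?_, ?_, ?_⟩
  · rw [length_eq_of_map hl', length_eq_of_map hlen.symm]
  · rw [hi] at hlev
    rw [← levelSum_of_raise hl'.symm (by rwa [length_eq_of_map hl']) hlev, levelSum, levelSum,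
      length_eq_of_map hlen.symm]
    simp only [hTS _ a le_rfl hn.le]
  · intro k x hx
    have := hlev k x
    rw [if_neg (by omega)] at this
    rw [← Nat.add_zero (level T' k x), ← this]
    rcases le_total x (m + n) with h | h
    · exact (hTS k x hx.le h).symm
    · unfold level
      rw [lev_top h, lev_top h, ← level_top, ← level_top]
      exact (hTS k _ (by omega) le_rfl).symm

theorem linkedFrom_zero (m n : ℕ) : LinkedFrom m n 0 := fun T T' hT hT' h => by
  rw [tab_ext hT hT' fun k x hx => h k x (Nat.zero_le x) hx]
  exact Relation.EqvGen.refl _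

/-- Raising terminates because `levelSum` is bounded. The final level at `a` depends only on the
levels at `a + 1`, so tableaux with equal upper levels end with equal levels at `a`. -/
theorem exists_linked_canonical_low {a : ℕ} (ha : a ≤ m) (hn : a < m + n)
    (ih : LinkedFrom m n a) {T : Filling m n} (hT : IsTab T) :
    ∃ T', IsTab T' ∧ Linked T T' ∧ (∀ k x, a < x → level T' k x = level T k x) ∧
      ∀ k, level T' k a = min (level T k (a + 1)) a := by
  obtain ⟨N, hN⟩ : ∃ N, N = T.length * m - levelSum T a := ⟨_, rfl⟩
  induction N using Nat.strong_induction_on generalizing T with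
  | _ N ihN =>
    by_cases hc : ∀ k, level T k a = min (level T k (a + 1)) a
    · exact ⟨T, hT, Relation.EqvGen.refl _, fun _ _ _ => rfl, hc⟩
    · push Not at hc
      obtain ⟨k₁, hk⟩ := hc
      have h1 := hT.isLevel.mono k₁ a hn
      have h2 := hT.isLevel.le_self k₁ ha
      obtain ⟨S, hS, hTS, hlen, hsum, hl⟩ := exists_linked_raise
        (Nat.pos_of_ne_zero (by rintro rfl; omega)) ha hn ih hT (k₁ := k₁) (by omega)
      have hb : levelSum S a ≤ S.length * m := by
        unfold levelSum
        refine (Finset.sum_le_card_nsmul _ _ m fun k _ =>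
          (hS.isLevel.le_self k ha).trans ha).trans (by simp)
      rw [hlen] at hb
      obtain ⟨T', hT', hST, hl', hc'⟩ := ihN _ (by rw [hlen]; omega) hS rfl
      exact ⟨T', hT', hTS.trans hST, fun k x hx => (hl' k x hx).trans (hl k x hx), fun k => by
        rw [hc', hl _ _ (by omega)]⟩

theorem exists_linked_canonical_high {a : ℕ} (ha : m < a) (hn : a < m + n)
    (ih : LinkedFrom m n a) {T : Filling m n} (hT : IsTab T) :
    ∃ T', IsTab T' ∧ Linked T T' ∧ (∀ k x, a < x → level T' k x = level T k x) ∧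
      ∀ k, level T' k a = level T (k + 1) (a + 1) := by
  obtain ⟨N, hN⟩ : ∃ N, N = levelSum T a := ⟨_, rfl⟩
  induction N using Nat.strong_induction_on generalizing T with
  | _ N ihN =>
    by_cases hc : ∀ k, level T k a = level T (k + 1) (a + 1)
    · exact ⟨T, hT, Relation.EqvGen.refl _, fun _ _ _ => rfl, hc⟩
    · push Not at hc
      obtain ⟨k₁, hk⟩ := hc
      have h1 := hT.isLevel.odd_row k₁ a ha.le hn
      obtain ⟨S, hS, hTS, hlen, hsum, hl⟩ := exists_linked_lower ha hn ih hT (k₁ := k₁) (by omega)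
      obtain ⟨T', hT', hST, hl', hc'⟩ := ihN _ (by omega) hS rfl
      exact ⟨T', hT', hTS.trans hST, fun k x hx => (hl' k x hx).trans (hl k x hx), fun k => by
        rw [hc', hl _ _ (by omega)]⟩

/-- Both tableaux are moved to the same canonical level at `a`, after which the induction hypothesis
joins them. At the final threshold `m + n` only the column lengths have to agree. -/
theorem linkedFrom (a : ℕ) (ha : a ≤ m + n) : LinkedFrom m n a := by
  induction a with
  | zero => exact linkedFrom_zero m n
  | succ a ih =>
    have ih := ih (by omega)
    intro T T' hT hT' h
    rcases le_or_gt a m with ham | ham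
    · obtain ⟨S, hS, hTS, hl, hc⟩ := exists_linked_canonical_low ham ha ih hT
      obtain ⟨S', hS', hTS', hl', hc'⟩ := exists_linked_canonical_low ham ha ih hT'
      refine (hTS.trans (ih S S' hS hS' fun k x hx hx' => ?_)).trans hTS'.symm
      rcases hx.lt_or_eq with hx | rfl
      · rw [hl _ _ hx, hl' _ _ hx, h k x hx hx']
      · rw [hc, hc', h _ _ le_rfl ha]
    · obtain ⟨S, hS, hTS, hl, hc⟩ := exists_linked_canonical_high ham ha ih hT
      obtain ⟨S', hS', hTS', hl', hc'⟩ := exists_linked_canonical_high ham ha ih hT'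
      refine (hTS.trans (ih S S' hS hS' fun k x hx hx' => ?_)).trans hTS'.symm
      rcases hx.lt_or_eq with hx | rfl
      · rw [hl _ _ hx, hl' _ _ hx, h k x hx hx']
      · rw [hc, hc', h _ _ le_rfl ha]

/-- The crystal of tableaux of a given shape is connected. -/
theorem linked_of_shape {T T' : Filling m n} (hT : IsTab T) (hT' : IsTab T')
    (h : T.map List.length = T'.map List.length) : Linked T T' :=
  linkedFrom (m + n) le_rfl T T' hT hT' fun k x hx hx' => by
    rw [le_antisymm hx' hx]
    exact level_of_length_map_eq h k

end Connectivity

end SuperCrystal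

namespace SuperCrystal

/-! ### Changing a letter of a biword preserves the plactic class of its labels -/

section RowWords

variable {m n : ℕ} {β : Type*} (L : β → β → Prop) (par : β → ℕ)

/-- The relation between the consecutive pairs of a biword, for the order `L` of the labels. -/
def pairRel (x y : Letter m n × β) : Prop := L x.2 y.2 ∨ (x.2 = y.2 ∧ Adj (par x.2) x.1 y.1)

/-- The column relation on labels. -/
def labelCol (y y' : β) : Prop := L y y' ∨ (y = y' ∧ par y = 1)

/-- The order `L` of the labels stays arbitrary because it is needed twice: as `<` for biwords in
Ω♯, and as the opposite order for biwords in (Ω♯)* with their two words exchanged. -/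
theorem isColumnOrder_labelCol [IsStrictTotalOrder β L] : IsColumnOrder (labelCol L par) where
  trans := by
    rintro a b c (h1 | ⟨rfl, h1⟩) (h2 | ⟨rfl, h2⟩)
    · exact Or.inl (_root_.trans h1 h2)
    · exact Or.inl h1
    · exact Or.inl h2
    · exact Or.inr ⟨rfl, h1⟩
  cotrans := by
    rintro a b c h
    rcases trichotomous_of L a b with h1 | rfl | h1
    · exact Or.inl (Or.inl h1)
    · exact Or.inr h
    · right
      rcases h with h | ⟨rfl, h⟩
      · exact Or.inl (_root_.trans h1 h)
      · exact Or.inl h1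

theorem labelCol_irrefl_of_even [IsStrictTotalOrder β L] {y : β} (h : par y = 0) :
    ¬ labelCol L par y y := by
  rintro (h1 | h1)
  · exact irrefl _ h1
  · omega

theorem not_labelCol_of [IsStrictTotalOrder β L] {y y' : β} (h : L y y' ∨ (y = y' ∧ par y = 0)) :
    ¬ labelCol L par y' y := by
  intro h1
  rcases h with h | ⟨rfl, h⟩
  · rcases h1 with h1 | ⟨rfl, h1⟩
    · exact irrefl _ (_root_.trans h h1)
    · exact irrefl _ h
  · exact labelCol_irrefl_of_even L par h h1

/-- The pairs with first letter `x`, in the order of the second kind of biwords. -/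
def rowPart (x : ℕ) (W : List (Letter m n × β)) : List (Letter m n × β) :=
  if x < m then W.filter (fun p => p.1.val = x) else (W.filter (fun p => p.1.val = x)).reverse

/-- The pairs whose first letter lies in `[a, b)`, in the order of the second kind of biwords. -/
def rowsIn (a : ℕ) : ℕ → List (Letter m n × β) → List (Letter m n × β)
  | 0, _ => []
  | b + 1, W => if a ≤ b then rowPart b W ++ rowsIn a b W else []

variable {L par}

theorem rowsIn_succ {a b : ℕ} (h : a ≤ b) (W : List (Letter m n × β)) :
    rowsIn a (b + 1) W = rowPart b W ++ rowsIn a b W := if_pos h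

theorem rowsIn_of_le {a b : ℕ} (h : b ≤ a) (W : List (Letter m n × β)) : rowsIn a b W = [] := by
  cases b with
  | zero => rfl
  | succ b => exact if_neg (by omega)

theorem rowsIn_append {a b c : ℕ} (hab : a ≤ b) (hbc : b ≤ c) (W : List (Letter m n × β)) :
    rowsIn a c W = rowsIn b c W ++ rowsIn a b W := by
  induction hbc with
  | refl => rw [rowsIn_of_le le_rfl, List.nil_append]
  | step h ih => rw [rowsIn_succ (hab.trans h), rowsIn_succ h, ih, List.append_assoc]

theorem rowsIn_single (a : ℕ) (W : List (Letter m n × β)) : rowsIn a (a + 1) W = rowPart a W := by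
  rw [rowsIn_succ le_rfl, rowsIn_of_le le_rfl, List.append_nil]

theorem rowsIn_congr {a b : ℕ} {W W' : List (Letter m n × β)}
    (h : ∀ x, a ≤ x → x < b → rowPart x W = rowPart x W') : rowsIn a b W = rowsIn a b W' := by
  induction b with
  | zero => rfl
  | succ b ih =>
    rcases le_or_gt a b with hab | hab
    · rw [rowsIn_succ hab, rowsIn_succ hab, h b hab (Nat.lt_succ_self b),
        ih fun x hx hx' => h x hx (by omega)]
    · rw [rowsIn_of_le hab, rowsIn_of_le hab]

theorem rowPart_perm (x : ℕ) (W : List (Letter m n × β)) :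
    (rowPart x W).Perm (W.filter (fun p => p.1.val = x)) := by
  unfold rowPart
  split_ifs
  · exact List.Perm.refl _
  · exact List.reverse_perm _

theorem rowsIn_perm (a b : ℕ) (W : List (Letter m n × β)) :
    (rowsIn a b W).Perm (W.filter (fun p => a ≤ p.1.val ∧ p.1.val < b)) := by
  induction b with
  | zero => simp [rowsIn]
  | succ b ih =>
    rcases le_or_gt a b with hab | hab
    · rw [rowsIn_succ hab]
      refine ((rowPart_perm b W).append ih).trans ?_
      clear ih
      have := List.filter_append_perm (fun p : Letter m n × β => decide (p.1.val = b))
        (W.filter (fun p => a ≤ p.1.val ∧ p.1.val < b + 1))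
      rw [List.filter_filter, List.filter_filter] at this
      refine List.Perm.trans (List.Perm.of_eq ?_) this
      congr 1 <;> refine List.filter_congr fun p _ => ?_
      · simp; omega
      · rw [Bool.eq_iff_iff]; simp; omega
    · rw [rowsIn_of_le hab]
      rw [List.filter_eq_nil_iff.2]
      intro p _
      simp; omega

variable (L par) in
/-- The relation between the pairs of a biword of the second kind. -/
def pairRel' (x y : Letter m n × β) : Prop :=
  y.1 < x.1 ∨ (x.1 = y.1 ∧ ((deg x.1 = 0 ∧ labelCol L par x.2 y.2) ∨
    (deg x.1 = 1 ∧ ¬ labelCol L par x.2 y.2)))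

theorem filter_pairwise_even {W : List (Letter m n × β)} (hW : W.Pairwise (pairRel L par)) {x : ℕ}
    (hx : x < m) : ((W.filter (fun p => p.1.val = x)).map Prod.snd).Pairwise (labelCol L par) := by
  rw [List.pairwise_map]
  refine (List.Pairwise.imp_of_mem ?_ (hW.filter _))
  rintro ⟨b, y⟩ ⟨b', y'⟩ h1 h2 (h | ⟨h, h3⟩)
  · exact Or.inl h
  · simp only [List.mem_filter, decide_eq_true_eq] at h1 h2
    obtain rfl : b = b' := Fin.ext (h1.2.trans h2.2.symm)
    right
    refine ⟨h, ?_⟩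
    rcases h3 with ⟨_, h3 | h3⟩ | ⟨h3, _⟩
    · exact absurd h3 (lt_irrefl _)
    · rw [deg_eq_one_iff, h1.2] at h3; omega
    · exact h3

theorem filter_pairwise_odd [IsStrictTotalOrder β L] {W : List (Letter m n × β)}
    (hW : W.Pairwise (pairRel L par)) {x : ℕ} (hx : m ≤ x) :
    ((W.filter (fun p => p.1.val = x)).map Prod.snd).Pairwise (rowRel (labelCol L par)) := by
  rw [List.pairwise_map]
  refine (List.Pairwise.imp_of_mem ?_ (hW.filter _))
  rintro ⟨b, y⟩ ⟨b', y'⟩ h1 h2 (h | ⟨h, h3⟩)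
  · exact not_labelCol_of L par (Or.inl h)
  · simp only [List.mem_filter, decide_eq_true_eq] at h1 h2
    obtain rfl : b = b' := Fin.ext (h1.2.trans h2.2.symm)
    refine not_labelCol_of L par (Or.inr ⟨h, ?_⟩)
    rcases h3 with ⟨h3, _⟩ | ⟨_, h3 | h3⟩
    · exact h3
    · exact absurd h3 (lt_irrefl _)
    · rw [deg_eq_zero_iff, h1.2] at h3; omega

theorem rowPart_pairwise [IsStrictTotalOrder β L] {W : List (Letter m n × β)}
    (hW : W.Pairwise (pairRel L par)) (x : ℕ) : (rowPart x W).Pairwise (pairRel' L par) := by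
  unfold rowPart
  split_ifs with hx
  · refine List.Pairwise.imp_of_mem ?_ (List.pairwise_map.1 (filter_pairwise_even hW hx))
    rintro ⟨b, y⟩ ⟨b', y'⟩ h1 h2 h
    simp only [List.mem_filter, decide_eq_true_eq] at h1 h2
    obtain rfl : b = b' := Fin.ext (h1.2.trans h2.2.symm)
    exact Or.inr ⟨rfl, Or.inl ⟨(deg_eq_zero_iff b).2 (h1.2 ▸ hx), h⟩⟩
  · rw [List.pairwise_reverse]
    refine List.Pairwise.imp_of_mem ?_ (List.pairwise_map.1 (filter_pairwise_odd hW (not_lt.1 hx)))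
    rintro ⟨b, y⟩ ⟨b', y'⟩ h1 h2 h
    simp only [List.mem_filter, decide_eq_true_eq] at h1 h2
    obtain rfl : b = b' := Fin.ext (h1.2.trans h2.2.symm)
    exact Or.inr ⟨rfl, Or.inr ⟨(deg_eq_one_iff b).2 (h1.2 ▸ not_lt.1 hx), h⟩⟩

theorem mem_rowPart {x : ℕ} {W : List (Letter m n × β)} {p : Letter m n × β} :
    p ∈ rowPart x W ↔ p ∈ W ∧ p.1.val = x := by
  rw [(rowPart_perm x W).mem_iff]; simp

theorem mem_rowsIn {a b : ℕ} {W : List (Letter m n × β)} {p : Letter m n × β} :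
    p ∈ rowsIn a b W ↔ p ∈ W ∧ a ≤ p.1.val ∧ p.1.val < b := by
  rw [(rowsIn_perm a b W).mem_iff]; simp

theorem rowsIn_pairwise [IsStrictTotalOrder β L] {W : List (Letter m n × β)}
    (hW : W.Pairwise (pairRel L par)) (a b : ℕ) : (rowsIn a b W).Pairwise (pairRel' L par) := by
  induction b with
  | zero => exact List.Pairwise.nil
  | succ b ih =>
    rcases le_or_gt a b with hab | hab
    · rw [rowsIn_succ hab, List.pairwise_append]
      refine ⟨rowPart_pairwise hW b, ih, fun p hp q hq => ?_⟩
      rw [mem_rowPart] at hp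
      rw [mem_rowsIn] at hq
      left
      rw [Fin.lt_def]
      omega
    · rw [rowsIn_of_le hab]
      exact List.Pairwise.nil

/-- A parenthesis word with at most `k` unmatched closing symbols: the `j`-th opening symbol
precedes the `(j + k)`-th closing symbol. -/
theorem dom_of_defect {γ : Type*} (r : β → β → Prop) (val : γ → β) (o c : γ → Bool)
    (d : List γ → ℕ) (hd : ∀ b W, d (b :: W) = (c b).toNat + (d W - (o b).toNat))
    (hoc : ∀ b, o b = true → c b = true → False) {W : List γ}
    (h : W.Pairwise fun a b => o a = true → c b = true → ¬ r (val b) (val a)) {k : ℕ}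
    (hk : d W ≤ k) : Dom r ((W.filter o).map val) (((W.filter c).map val).drop k) := by
  induction W generalizing k with
  | nil => simp
  | cons b W ih =>
    rw [List.pairwise_cons] at h
    rw [hd] at hk
    cases hc : c b with
    | true =>
      have ho : o b = false := by
        cases ho : o b with
        | true => exact (hoc b ho hc).elim
        | false => rfl
      rw [hc, ho] at hk
      simp only [Bool.toNat_true, Bool.toNat_false] at hk
      rw [List.filter_cons_of_neg (by simp [ho]), List.filter_cons_of_pos hc]
      obtain ⟨k, rfl⟩ : ∃ k', k = k' + 1 := ⟨k - 1, by omega⟩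
      exact ih h.2 (by omega)
    | false =>
      rw [hc] at hk
      rw [List.filter_cons_of_neg (p := c) (by simp [hc])]
      cases ho : o b with
      | false =>
        rw [ho] at hk
        rw [List.filter_cons_of_neg (by simp [ho])]
        exact ih h.2 (by simpa using hk)
      | true =>
        rw [ho] at hk
        rw [List.filter_cons_of_pos ho]
        simp only [Bool.toNat_true, Bool.toNat_false] at hk
        -- An opening symbol allows one more unmatched closing symbol in the tail, whence `k + 1`.
        -- It is itself compared with the closing symbol of index `k`.
        have := ih h.2 (k := k + 1) (by omega)
        cases hX : ((W.filter c).map val).drop k with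
        | nil => simp
        | cons x X =>
          rw [List.map_cons, dom_cons_cons]
          refine ⟨?_, ?_⟩
          · have hx : x ∈ (W.filter c).map val := List.mem_of_mem_drop (by rw [hX]; simp)
            obtain ⟨g, hg, rfl⟩ := List.mem_map.1 hx
            rw [List.mem_filter] at hg
            exact h.1 g hg.1 ho hg.2
          · rwa [← List.tail_drop, hX] at this

/-- The labels of the pairs with first letter `b`. -/
def labels (b : Letter m n) (W : List (Letter m n × β)) : List β :=
  (W.filter (fun p => p.1 = b)).map Prod.snd

theorem labels_append (b : Letter m n) (W W' : List (Letter m n × β)) :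
    labels b (W ++ W') = labels b W ++ labels b W' := by simp [labels]

theorem labels_cons_self (b : Letter m n) (y : β) (W : List (Letter m n × β)) :
    labels b ((b, y) :: W) = y :: labels b W := by simp [labels]

theorem labels_cons_ne {b b' : Letter m n} (h : b' ≠ b) (y : β) (W : List (Letter m n × β)) :
    labels b ((b', y) :: W) = labels b W := by simp [labels, h]

theorem rowPart_map_snd (b : Letter m n) (W : List (Letter m n × β)) :
    (rowPart b.val W).map Prod.snd = if b.val < m then labels b W else (labels b W).reverse := by
  unfold rowPart labels
  simp only [Fin.ext_iff]
  split_ifs <;> simp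

theorem labels_eq_nil {b : Letter m n} {W : List (Letter m n × β)} (h : b ∉ W.map Prod.fst) :
    labels b W = [] := by
  unfold labels
  rw [List.filter_eq_nil_iff.2, List.map_nil]
  intro p hp
  simp only [decide_eq_true_eq]
  rintro rfl
  exact h (List.mem_map_of_mem hp)

theorem toNat_tgt (i : Node m n) (p : Letter m n × β) :
    (decide (p.1 = tgt i)).toNat = le i p.1 := by
  unfold le; split_ifs with h <;> simp [h]

theorem toNat_src (i : Node m n) (p : Letter m n × β) :
    (decide (p.1 = src i)).toNat = lf i p.1 := by
  unfold lf; split_ifs with h <;> simp [h]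

theorem src_tgt_disjoint (i : Node m n) (p : Letter m n × β) (h : decide (p.1 = src i) = true)
    (h' : decide (p.1 = tgt i) = true) : False := by
  simp only [decide_eq_true_eq] at h h'
  exact src_ne_tgt i (h.symm.trans h')

theorem word_single (i : Node m n) (b : Letter m n) :
    (wordCrystal m n).eps i [b] = le i b ∧ (wordCrystal m n).phi i [b] = lf i b := by
  rcases lt_trichotomy (i.val + 1) m with hi | hi | hi
  · have := word_cons_barred hi b []
    simpa using this
  · have := word_cons_zero hi b []
    simp only [word_eps_nil, word_phi_nil] at this
    split_ifs at this <;> omega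
  · have := word_cons_odd hi b []
    simpa using this

theorem not_mem_of_zero {i : Node m n} (hi : i.val + 1 = m) {w : List (Letter m n)}
    (he : (wordCrystal m n).eps i w = 0) (hf : (wordCrystal m n).phi i w = 0) :
    src i ∉ w ∧ tgt i ∉ w := by
  induction w with
  | nil => simp
  | cons b w ih =>
    have h1 := word_cons_zero hi b w
    rw [he, hf] at h1
    by_cases h0 : le i b + lf i b = 0
    · rw [if_pos h0, if_pos h0] at h1
      have := ih h1.1.symm h1.2.symm
      have hs : b ≠ src i := by rintro rfl; simp [lf] at h0
      have ht : b ≠ tgt i := by rintro rfl; simp [le] at h0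
      simp only [List.mem_cons, not_or]
      exact ⟨⟨hs.symm, this.1⟩, ht.symm, this.2⟩
    · rw [if_neg h0, if_neg h0] at h1
      omega

theorem not_labelCol_of_src_tgt [IsStrictTotalOrder β L] {i : Node m n} {p q : Letter m n × β}
    (h : pairRel L par p q) (hp : p.1 = src i) (hq : q.1 = tgt i) : ¬ labelCol L par q.2 p.2 := by
  refine not_labelCol_of L par (h.imp id fun h => ⟨h.1, ?_⟩)
  have hs := val_src i
  have ht := val_tgt i
  have h2 := h.2
  rw [hp, hq, Adj, Fin.lt_def, Fin.lt_def, Fin.ext_iff] at h2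
  omega

theorem labelCol_of_tgt_src {i : Node m n} {p q : Letter m n × β}
    (h : pairRel L par p q) (hp : p.1 = tgt i) (hq : q.1 = src i) : labelCol L par p.2 q.2 := by
  refine h.imp id fun h => ⟨h.1, ?_⟩
  have hs := val_src i
  have ht := val_tgt i
  have h2 := h.2
  rw [hp, hq, Adj, Fin.lt_def, Fin.lt_def, Fin.ext_iff] at h2
  omega

/-- If ε_i vanishes, every `tgt i` is cancelled by an earlier `src i`, so the `j`-th `src i`
precedes the `j`-th `tgt i`. As the biword is sorted, this precedence becomes an inequality between
labels. The three statements that follow are its variants for φ_i, read from the right end, and for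
odd letters. -/
theorem dom_labels_of_eps_barred [IsStrictTotalOrder β L] {i : Node m n} (hi : i.val + 1 < m)
    {W : List (Letter m n × β)} (hW : W.Pairwise (pairRel L par))
    (h : (wordCrystal m n).eps i (W.map Prod.fst) = 0) :
    Dom (labelCol L par) (labels (src i) W) (labels (tgt i) W) :=
  dom_of_defect (labelCol L par) Prod.snd (fun p => decide (p.1 = src i))
    (fun p => decide (p.1 = tgt i)) (fun W => (wordCrystal m n).eps i (W.map Prod.fst))
    (fun b W => by
      rw [toNat_tgt, toNat_src, List.map_cons]
      exact (word_cons_barred hi b.1 _).1)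
    (src_tgt_disjoint i)
    (hW.imp fun h hp hq => not_labelCol_of_src_tgt h (of_decide_eq_true hp) (of_decide_eq_true hq))
    (k := 0) h.le

theorem dom_labels_of_phi_barred [IsStrictTotalOrder β L] {i : Node m n} (hi : i.val + 1 < m)
    {W : List (Letter m n × β)} (hW : W.Pairwise (pairRel L par))
    (h : (wordCrystal m n).phi i (W.map Prod.fst) = 0) :
    Dom (flip (labelCol L par)) (labels (tgt i) W).reverse (labels (src i) W).reverse := by
  have := dom_of_defect (W := W.reverse) (flip (labelCol L par)) Prod.snd
    (fun p => decide (p.1 = tgt i))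
    (fun p => decide (p.1 = src i)) (fun W => (wordCrystal m n).phi i (W.reverse.map Prod.fst))
    (fun b W => by
      rw [toNat_tgt, toNat_src, List.reverse_cons, List.map_append, (word_append_barred hi _ _).2,
        List.map_singleton, (word_single i b.1).1, (word_single i b.1).2])
    (fun b h1 h2 => src_tgt_disjoint i b h2 h1)
    (List.pairwise_reverse.2 (hW.imp fun h hp hq =>
      not_labelCol_of_src_tgt h (of_decide_eq_true hq) (of_decide_eq_true hp)))
    (k := 0) (by rw [List.reverse_reverse]; exact h.le)
  simpa [labels, List.filter_reverse] using this

theorem dom_labels_of_phi_odd [IsStrictTotalOrder β L] {i : Node m n} (hi : m < i.val + 1)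
    {W : List (Letter m n × β)} (hW : W.Pairwise (pairRel L par))
    (h : (wordCrystal m n).phi i (W.map Prod.fst) = 0) :
    Dom (rowRel (labelCol L par)) (labels (tgt i) W) (labels (src i) W) :=
  dom_of_defect (rowRel (labelCol L par)) Prod.snd (fun p => decide (p.1 = tgt i))
    (fun p => decide (p.1 = src i)) (fun W => (wordCrystal m n).phi i (W.map Prod.fst))
    (fun b W => by
      rw [toNat_tgt, toNat_src, List.map_cons]
      exact (word_cons_odd hi b.1 _).2)
    (fun b h1 h2 => src_tgt_disjoint i b h2 h1)
    (hW.imp fun h hp hq => not_not.2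
      (labelCol_of_tgt_src h (of_decide_eq_true hp) (of_decide_eq_true hq)))
    (k := 0) h.le

theorem dom_labels_of_eps_odd [IsStrictTotalOrder β L] {i : Node m n} (hi : m < i.val + 1)
    {W : List (Letter m n × β)} (hW : W.Pairwise (pairRel L par))
    (h : (wordCrystal m n).eps i (W.map Prod.fst) = 0) :
    Dom (flip (rowRel (labelCol L par))) (labels (src i) W).reverse (labels (tgt i) W).reverse := by
  have := dom_of_defect (W := W.reverse) (flip (rowRel (labelCol L par))) Prod.snd
    (fun p => decide (p.1 = src i))
    (fun p => decide (p.1 = tgt i)) (fun W => (wordCrystal m n).eps i (W.reverse.map Prod.fst))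
    (fun b W => by
      rw [toNat_tgt, toNat_src, List.reverse_cons, List.map_append, (word_append_odd hi _ _).1,
        List.map_singleton, (word_single i b.1).1, (word_single i b.1).2])
    (src_tgt_disjoint i)
    (List.pairwise_reverse.2 (hW.imp fun h hp hq => not_not.2
      (labelCol_of_tgt_src h (of_decide_eq_true hq) (of_decide_eq_true hp))))
    (k := 0) (by rw [List.reverse_reverse]; exact h.le)
  simpa [labels, List.filter_reverse] using this

/-- Changing a letter of a biword by `e_i` does not change the plactic class of its word of
labels. -/
theorem rowsIn_plac [IsStrictTotalOrder β L] {i : Node m n} {W₁ W₂ : List (Letter m n × β)} {y : β}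
    (hA : Acts i (W₁.map Prod.fst) (W₂.map Prod.fst))
    (ht : (W₁ ++ (tgt i, y) :: W₂).Pairwise (pairRel L par))
    (hs : (W₁ ++ (src i, y) :: W₂).Pairwise (pairRel L par)) :
    Plac (labelCol L par) ((rowsIn 0 (m + n) (W₁ ++ (tgt i, y) :: W₂)).map Prod.snd)
      ((rowsIn 0 (m + n) (W₁ ++ (src i, y) :: W₂)).map Prod.snd) := by
  have hsv := val_src i
  have htv := val_tgt i
  have hlt : i.val + 2 ≤ m + n := by have := i.2; omega
  have hpart : ∀ x, x ≠ i.val → x ≠ i.val + 1 →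
      rowPart x (W₁ ++ (tgt i, y) :: W₂) = rowPart x (W₁ ++ (src i, y) :: W₂) := by
    intro x h1 h2
    unfold rowPart
    simp only [List.filter_append]
    rw [List.filter_cons_of_neg, List.filter_cons_of_neg]
    · simp; omega
    · simp; omega
  -- Only the adjacent blocks of `tgt i` and `src i` change; the remaining blocks form a common
  -- prefix and a common suffix.
  have hsplit : ∀ W : List (Letter m n × β), rowsIn 0 (m + n) W =
      rowsIn (i.val + 1 + 1) (m + n) W ++ (rowPart (i.val + 1) W ++ rowPart i.val W) ++
        rowsIn 0 i.val W := by
    intro W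
    rw [rowsIn_append (Nat.zero_le (i.val + 1 + 1)) (by omega),
      rowsIn_append (Nat.zero_le i.val) (c := i.val + 1 + 1) (by omega),
      rowsIn_succ (Nat.le_succ _), rowsIn_single]
    simp
  rw [hsplit, hsplit (W₁ ++ (src i, y) :: W₂),
    rowsIn_congr (a := i.val + 1 + 1) (fun x h1 _ => hpart x (by omega) (by omega)),
    rowsIn_congr (a := 0) (fun x _ h1 => hpart x (by omega) (by omega))]
  simp only [List.map_append]
  refine (Plac.append_left ?_ _).append_right _
  rw [← htv, ← hsv, rowPart_map_snd, rowPart_map_snd, rowPart_map_snd, rowPart_map_snd]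
  simp only [labels_append, labels_cons_self, labels_cons_ne (src_ne_tgt i),
    labels_cons_ne (tgt_ne_src i), hsv, htv]
  have hX := filter_pairwise_even ht (x := i.val + 1)
  have hX' := filter_pairwise_odd ht (x := i.val + 1)
  have hY := filter_pairwise_even hs (x := i.val)
  have hY' := filter_pairwise_odd hs (x := i.val)
  have e1 : (((W₁ ++ (tgt i, y) :: W₂).filter (fun p => p.1.val = i.val + 1)).map Prod.snd) =
      labels (tgt i) W₁ ++ y :: labels (tgt i) W₂ := by
    rw [← labels_cons_self (tgt i), ← labels_append]
    simp only [labels, Fin.ext_iff, htv]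
  have e2 : (((W₁ ++ (src i, y) :: W₂).filter (fun p => p.1.val = i.val)).map Prod.snd) =
      labels (src i) W₁ ++ y :: labels (src i) W₂ := by
    rw [← labels_cons_self (src i), ← labels_append]
    simp only [labels, Fin.ext_iff, hsv]
  rw [e1] at hX hX'
  rw [e2] at hY hY'
  have hW₁ : W₁.Pairwise (pairRel L par) := (List.pairwise_append.1 ht).1
  have hW₂ : W₂.Pairwise (pairRel L par) :=
    (List.pairwise_cons.1 (List.pairwise_append.1 ht).2.1).2
  have hr := isColumnOrder_labelCol L par
  rcases lt_trichotomy (i.val + 1) m with hi | hi | hi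
  · rw [if_pos hi, if_pos (by omega), if_pos hi, if_pos (by omega)]
    exact Plac.exchange hr (hX hi) (hY (by omega))
      (dom_labels_of_phi_barred hi hW₁ (hA.1 hi).1) (dom_labels_of_eps_barred hi hW₂ (hA.1 hi).2)
  -- At the node 0 the block of `tgt i` is reversed and that of `src i` is not. Neither letter
  -- occurs in `W₁`, so `y` ends the first block before the move and starts the second one after it:
  -- the word of labels is literally unchanged.
  · rw [if_neg (by omega), if_pos (by omega), if_neg (by omega), if_pos (by omega)]
    have h0 := hA.2.2 hi
    have hn : src i ∉ W₁.map Prod.fst ∧ tgt i ∉ W₁.map Prod.fst :=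
      not_mem_of_zero hi h0.1 h0.2
    rw [labels_eq_nil hn.1, labels_eq_nil hn.2]
    simp only [List.nil_append, List.reverse_cons, List.append_assoc, List.singleton_append]
    exact Plac.refl _
  · rw [if_neg (by omega), if_neg (by omega), if_neg (by omega), if_neg (by omega)]
    -- Both blocks are rows read backwards. The exchange lemma for `rowRel` is applied with the two
    -- blocks interchanged, whence `symm`, and the resulting equivalence is then reversed.
    have := (Plac.exchange hr.rowRel (hY' (by omega)) (hX' (by omega))
      (dom_labels_of_eps_odd hi hW₁ (hA.2.1 hi).1) (dom_labels_of_phi_odd hi hW₂ (hA.2.1 hi).2)).symm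
    have := this.reverse_of_rowRel
    simpa using this

end RowWords

end SuperCrystal

namespace SuperCrystal

/-! ### Stripping a longest row or a longest column from an insertion tableau -/

section RowsAndColumns

variable {m n : ℕ}

/-- At the first place where domination fails, the path goes down `x` to that place and continues
with the rest of `y`. It has one more letter than `y`. With Greene's invariance this shows that a
longest column or row must dominate. -/
theorem exists_chain_of_not_dom {α : Type*} {r : α → α → Prop}
    (hr : IsColumnOrder r) {x y : List α} (hx : x.Pairwise r)
    (hy : y.Pairwise r) (h : ¬ Dom r y x) :
    ∃ x₁ y₁, x₁ ≠ [] ∧ x₁.Sublist x ∧ y₁.Sublist y ∧ (x₁ ++ y₁).Pairwise r ∧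
      (x₁ ++ y₁).length = y.length + 1 := by
  induction y generalizing x with
  | nil =>
    cases x with
    | nil => simp at h
    | cons a x => exact ⟨[a], [], by simp, by simp, by simp, by simp, by simp⟩
  | cons b y ih =>
    cases x with
    | nil => simp at h
    | cons a x =>
      rw [List.pairwise_cons] at hx
      rw [dom_cons_cons] at h
      by_cases hab : r a b
      · refine ⟨[a], b :: y, by simp, by simp, List.Sublist.refl _, ?_, by simp [Nat.add_comm]⟩
        rw [List.singleton_append, List.pairwise_cons]
        refine ⟨fun c hc => ?_, hy⟩
        rcases List.mem_cons.1 hc with rfl | hc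
        · exact hab
        · exact hr.trans hab ((List.pairwise_cons.1 hy).1 c hc)
      · obtain ⟨x₁, y₁, h1, h2, h3, h4, h5⟩ := ih hx.2 (List.pairwise_cons.1 hy).2
          fun h' => h ⟨hab, h'⟩
        refine ⟨a :: x₁, y₁, by simp, h2.cons_cons a, h3.cons b, ?_, by simp at h5 ⊢; omega⟩
        rw [List.cons_append, List.pairwise_cons]
        refine ⟨fun c hc => ?_, h4⟩
        rcases List.mem_append.1 hc with hc | hc
        · exact hx.1 c (h2.subset hc)
        · obtain ⟨d, hd⟩ := List.exists_mem_of_ne_nil x₁ h1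
          exact hr.trans (hx.1 d (h2.subset hd)) ((List.pairwise_append.1 h4).2.2 d hd c hc)

/-- The existence of a row of length `k` among the subwords of `w` (read backwards). -/
def HasRow {α : Type*} (r : α → α → Prop) (w : List α) (k : ℕ) : Prop :=
  HasColumn (rowRel r) w.reverse k

theorem rowRel_rowRel {α : Type*} (r : α → α → Prop) : rowRel (rowRel r) = r := by
  funext a b; simp [rowRel]

theorem Plac.hasRow_iff {α : Type*} {r : α → α → Prop} (hr : IsColumnOrder r) {w w' : List α}
    (h : Plac r w w') (k : ℕ) : HasRow r w k ↔ HasRow r w' k := by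
  have h' : Plac (rowRel (rowRel r)) w w' := by rwa [rowRel_rowRel]
  exact Plac.hasColumn_iff hr.rowRel h'.reverse_of_rowRel k

/-- The letter `c` travels left through `y` by `bac`; the letter just before each exchanged pair
serves as the witness, and at the end it is `z`. -/
theorem Plac.move_letter {α : Type*} {r : α → α → Prop} (hr : IsColumnOrder r) {z c : α}
    {y : List α} (hy : (z :: y).Pairwise fun p q => ¬ r p q) (hc : r z c) :
    Plac r (z :: (y ++ [c])) (z :: c :: y) := by
  induction y generalizing z with
  | nil => exact Plac.refl _
  | cons a y ih =>
    rw [List.pairwise_cons] at hy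
    have hza := hy.1 a (by simp)
    have h1 := ih hy.2 ((hr.cotrans hc).resolve_left hza)
    exact (h1.cons z).trans (Plac.bac [] y hza hc)

theorem Plac.move_column {α : Type*} {r : α → α → Prop} (hr : IsColumnOrder r) {z : α}
    {y c : List α} (hy : (z :: y).Pairwise fun p q => ¬ r p q) (hc : (z :: c).Pairwise r) :
    Plac r (z :: (y ++ c)) (z :: (c ++ y)) := by
  induction c generalizing z with
  | nil => rw [List.append_nil]; exact Plac.refl _
  | cons a c ih =>
    rw [List.pairwise_cons] at hc
    have hza := hc.1 a (by simp)
    have h1 := (Plac.move_letter hr hy hza).append_right c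
    have h2 : (a :: y).Pairwise fun p q => ¬ r p q := by
      rw [List.pairwise_cons] at hy ⊢
      exact ⟨fun b hb hab => hy.1 b hb (hr.trans hza hab), hy.2⟩
    have h3 := (ih h2 hc.2).cons z
    simp only [List.cons_append, List.append_assoc] at h1 ⊢
    exact h1.trans h3

/-- The first row of a filling. -/
def tops (T : Filling m n) : List (Letter m n) := T.filterMap List.head?

/-- Put a row on top of a filling. -/
def addRow : List (Letter m n) → Filling m n → Filling m n
  | [], T => T
  | z :: zs, [] => [z] :: addRow zs []
  | z :: zs, c :: T => (z :: c) :: addRow zs T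

theorem tops_cons (a : Letter m n) (c : List (Letter m n)) (T : Filling m n) :
    tops ((a :: c) :: T) = a :: tops T := rfl

theorem pairwise_col_cons {z a : Letter m n} {c : List (Letter m n)} (hz : col z a)
    (hc : (a :: c).Pairwise col) : (z :: a :: c).Pairwise col := by
  rw [List.pairwise_cons]
  refine ⟨fun b hb => ?_, hc⟩
  rcases List.mem_cons.1 hb with rfl | hb
  · exact hz
  · exact col_trans hz ((List.pairwise_cons.1 hc).1 b hb)

theorem plac_move_filling {zs y : List (Letter m n)} {T : Filling m n}
    (hT : ∀ c ∈ T, c.Pairwise col ∧ c ≠ []) (hd : Dom (rowRel col) zs (tops T))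
    (hz : (zs.reverse ++ y).Pairwise fun p q => ¬ col p q) :
    Plac col (zs.reverse ++ (y ++ reading T)) (zs.reverse ++ (reading T ++ y)) := by
  induction T generalizing zs y with
  | nil => simpa using Plac.refl _
  | cons c T ih =>
    have hc := hT c (by simp)
    obtain ⟨a, c, rfl⟩ := List.exists_cons_of_ne_nil hc.2
    rw [tops_cons] at hd
    cases zs with
    | nil => simp at hd
    | cons z zs =>
      have hza : col z a := not_not.1 hd.1
      rw [List.reverse_cons, List.append_assoc, List.singleton_append] at hz
      have hT' : ∀ c ∈ T, c.Pairwise col ∧ c ≠ [] := fun c hc => hT c (by simp [hc])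
      have h1 := (ih hT' hd.2 hz).append_right (a :: c)
      have hzy := (List.pairwise_append.1 hz).2.1
      have h2 := (Plac.move_column isColumnOrder_col hzy (pairwise_col_cons hza hc.1)).append_left
        (zs.reverse ++ reading T)
      have hz1 : (zs.reverse ++ [z]).Pairwise fun p q => ¬ col p q :=
        hz.sublist (by simp)
      have h3 := (ih hT' hd.2 hz1).append_right (a :: c ++ y)
      simp only [reading_cons, List.reverse_cons, List.append_assoc, List.cons_append,
        List.nil_append] at h1 h2 h3 ⊢
      exact (h1.trans h2).trans h3.symm

/-- With the rest `zs` of the row in front of it, `z` passes through the reading of the other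
columns and arrives on top of its own column; induction then treats `zs`. -/
theorem plac_addRow {zs : List (Letter m n)} {T : Filling m n}
    (hT : ∀ c ∈ T, c.Pairwise col ∧ c ≠ []) (hd : Dom (rowRel col) zs (tops T))
    (hz : zs.Pairwise (rowRel col)) :
    Plac col (zs.reverse ++ reading T) (reading (addRow zs T)) := by
  induction zs generalizing T with
  | nil => exact Plac.refl _
  | cons z zs ih =>
    rw [List.pairwise_cons] at hz
    cases T with
    | nil =>
      have := (ih (T := []) (by simp) (by simp [tops]) hz.2).append_right [z]
      simpa [addRow, reading_cons] using this
    | cons c T =>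
      have hc := hT c (by simp)
      obtain ⟨a, c, rfl⟩ := List.exists_cons_of_ne_nil hc.2
      rw [tops_cons] at hd
      have hT' : ∀ c ∈ T, c.Pairwise col ∧ c ≠ [] := fun c hc => hT c (by simp [hc])
      have hz1 : (zs.reverse ++ [z]).Pairwise fun p q => ¬ col p q := by
        rw [← List.reverse_cons, List.pairwise_reverse, List.pairwise_cons]
        exact hz
      have h1 := (plac_move_filling hT' hd.2 hz1).append_right (a :: c)
      have h2 := (ih hT' hd.2 hz.2).append_right (z :: a :: c)
      simp only [addRow, reading_cons, List.reverse_cons, List.append_assoc, List.cons_append,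
        List.nil_append] at h1 h2 ⊢
      exact h1.trans h2

theorem isTab_addRow {zs : List (Letter m n)} {T : Filling m n} (hT : IsTab T)
    (hd : Dom (rowRel col) zs (tops T)) (hz : zs.Pairwise (rowRel col)) :
    IsTab (addRow zs T) := by
  induction zs generalizing T with
  | nil => exact hT
  | cons z zs ih =>
    rw [List.pairwise_cons] at hz
    cases T with
    | nil =>
      refine isTab_cons.2 ⟨List.pairwise_singleton _ _, by simp, ?_,
        ih isTab_nil (by simp [tops]) hz.2⟩
      cases zs with
      | nil => simp [addRow]
      | cons z' zs => simpa [addRow, dom_cons_cons, rowRel] using hz.1 z' (by simp)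
    | cons c T =>
      rw [isTab_cons] at hT
      obtain ⟨hc, hne, hcT, hT⟩ := hT
      obtain ⟨a, c, rfl⟩ := List.exists_cons_of_ne_nil hne
      rw [tops_cons] at hd
      have hza : col z a := not_not.1 hd.1
      refine isTab_cons.2 ⟨pairwise_col_cons hza hc, by simp, ?_, ih hT hd.2 hz.2⟩
      cases zs with
      | nil =>
        cases T with
        | nil => simp [addRow]
        | cons d T =>
          have hdT := (isTab_cons.1 hT).2.1
          obtain ⟨b, d, rfl⟩ := List.exists_cons_of_ne_nil hdT
          have := hd.2
          simp [tops_cons] at this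
      | cons z' zs =>
        have hz' := hz.1 z' (by simp)
        cases T with
        | nil => simpa [addRow, dom_cons_cons, rowRel] using hz'
        | cons d T => simpa [addRow, dom_cons_cons] using ⟨hz', hcT⟩

theorem tops_pairwise {T : Filling m n} (hT : IsTab T) : (tops T).Pairwise (rowRel col) := by
  induction T with
  | nil => exact List.Pairwise.nil
  | cons c T ih =>
    rw [isTab_cons] at hT
    obtain ⟨hc, hne, hcT, hT⟩ := hT
    obtain ⟨a, c, rfl⟩ := List.exists_cons_of_ne_nil hne
    rw [tops_cons, List.pairwise_cons]
    refine ⟨?_, ih hT⟩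
    cases T with
    | nil => simp [tops]
    | cons d T =>
      obtain ⟨b, d, rfl⟩ := List.exists_cons_of_ne_nil (isTab_cons.1 hT).2.1
      have hab : rowRel col a b := hcT.1
      have := ih hT
      rw [tops_cons, List.pairwise_cons] at this
      rw [tops_cons]
      intro x hx
      rcases List.mem_cons.1 hx with rfl | hx
      · exact hab
      · exact isColumnOrder_col.rowRel.trans hab (this.1 x hx)

theorem tops_sublist (T : Filling m n) : (tops T).Sublist (reading T).reverse := by
  induction T with
  | nil => simp [tops]
  | cons c T ih =>
    rw [reading_cons, List.reverse_append]
    cases c with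
    | nil =>
      have h0 : tops ([] :: T) = tops T := rfl
      simpa [h0] using ih
    | cons a c =>
      rw [tops_cons, List.reverse_cons, List.append_assoc]
      exact ((ih.cons_cons a).trans (List.sublist_append_right _ _))

/-- The tableau of a word that starts with a longest row. -/
theorem P_row_append {zs w : List (Letter m n)} (hz : zs.Pairwise (rowRel col))
    (h : ∀ k, HasRow col (zs.reverse ++ w) k → k ≤ zs.length) :
    P (zs.reverse ++ w) = addRow zs (P w) ∧ Dom (rowRel col) zs (tops (P w)) := by
  have hT := isTab_P w
  have hpl : Plac col (zs.reverse ++ w) (zs.reverse ++ reading (P w)) :=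
    (plac_reading_P w).append_left _
  -- If `zs` did not fit above the first row of `P w`, the two would contain a row longer than `zs`
  -- in an equivalent word, against the maximality `h`.
  have hd : Dom (rowRel col) zs (tops (P w)) := by
    by_contra hd
    obtain ⟨x, y, -, hx, hy, hxy, hl⟩ := exists_chain_of_not_dom
      isColumnOrder_col.rowRel (tops_pairwise hT) hz hd
    have : HasRow col (zs.reverse ++ reading (P w)) (zs.length + 1) := by
      refine ⟨x ++ y, ?_, hxy, hl⟩
      rw [List.reverse_append, List.reverse_reverse]
      exact (hx.trans (tops_sublist _)).append hy
    have := h _ ((hpl.hasRow_iff isColumnOrder_col _).2 this)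
    omega
  refine ⟨?_, hd⟩
  rw [← P_reading (isTab_addRow hT hd hz)]
  exact P_eq_iff.2 (hpl.trans (plac_addRow hT.1 hd hz))

theorem addRow_inj {zs zs' : List (Letter m n)} {T T' : Filling m n} (hT : ∀ c ∈ T, c ≠ [])
    (hT' : ∀ c ∈ T', c ≠ []) (hl : zs.length = zs'.length) (hd : Dom (rowRel col) zs (tops T))
    (hd' : Dom (rowRel col) zs' (tops T')) (h : addRow zs T = addRow zs' T') :
    zs = zs' ∧ T = T' := by
  induction zs generalizing zs' T T' with
  | nil =>
    have : zs' = [] := List.eq_nil_of_length_eq_zero (by simpa using hl.symm)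
    subst this
    exact ⟨rfl, h⟩
  | cons z zs ih =>
    cases zs' with
    | nil => simp at hl
    | cons z' zs' =>
      have hl' : zs.length = zs'.length := by simpa using hl
      cases T with
      | nil =>
        cases T' with
        | nil =>
          simp only [addRow, List.cons.injEq, and_true] at h
          have := ih hT hT' hl' (by simp [tops]) (by simp [tops]) h.2
          exact ⟨by rw [h.1, this.1], rfl⟩
        | cons c T' =>
          simp only [addRow, List.cons.injEq] at h
          exact absurd h.1.2.symm (hT' c (by simp))
      | cons c T =>
        cases T' with
        | nil =>
          simp only [addRow, List.cons.injEq] at h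
          exact absurd h.1.2 (hT c (by simp))
        | cons c' T' =>
          obtain ⟨a, c, rfl⟩ := List.exists_cons_of_ne_nil (hT c (by simp))
          obtain ⟨a', c', rfl⟩ := List.exists_cons_of_ne_nil (hT' c' (by simp))
          simp only [addRow, List.cons.injEq] at h
          have := ih (fun c hc => hT c (by simp [hc])) (fun c hc => hT' c (by simp [hc])) hl'
            hd.2 hd'.2 h.2
          exact ⟨by rw [h.1.1, this.1], by rw [h.1.2.1, h.1.2.2, this.2]⟩

/-- The tableau of a word that ends with a longest column. -/
theorem P_append_column {c w : List (Letter m n)} (hc : c.Pairwise col) (hne : c ≠ [])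
    (h : ∀ k, HasColumn col (w ++ c) k → k ≤ c.length) : P (w ++ c) = c :: P w := by
  have hT := isTab_P w
  have hpl : Plac col (w ++ c) (reading (P w) ++ c) := (plac_reading_P w).append_right _
  have hp : ((P w).headD []).Pairwise col ∧ ((P w).headD []).Sublist (reading (P w)) := by
    cases hP : P w with
    | nil => simp
    | cons d T =>
      rw [hP] at hT
      exact ⟨(isTab_cons.1 hT).1, by rw [reading_cons]; exact List.sublist_append_right _ _⟩
  have hd : Dom col c ((P w).headD []) := by
    by_contra hd
    obtain ⟨x, y, -, hx, hy, hxy, hl⟩ := exists_chain_of_not_dom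
      isColumnOrder_col hp.1 hc hd
    have : HasColumn col (reading (P w) ++ c) (c.length + 1) :=
      ⟨x ++ y, (hx.trans hp.2).append hy, hxy, hl⟩
    have := h _ ((hpl.hasColumn_iff isColumnOrder_col _).2 this)
    omega
  have hT' : IsTab (c :: P w) := isTab_cons.2 ⟨hc, hne, hd, hT⟩
  rw [← P_reading hT', reading_cons]
  exact P_eq_iff.2 hpl

end RowsAndColumns

end SuperCrystal

namespace SuperCrystal

/-! ### Reconstruction of a biword whose first word is extremal -/

section Extremal

variable {m n u v : ℕ}

/-- The subword of the letters in `[a, b)`. -/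
def segment (a b : ℕ) (w : List (Letter m n)) : List (Letter m n) :=
  w.filter (fun c => a ≤ c.val ∧ c.val < b)

/-- A word is extremal if the occurrences of each odd letter `t` form a longest column of the
subword of letters up to `t`, and the occurrences of each even letter `s` form a longest row of the
subword of even letters from `s` on. -/
structure Extremal (w : List (Letter m n)) : Prop where
  odd : ∀ t : Letter m n, m ≤ t.val → ∀ k, HasColumn col (segment 0 (t.val + 1) w) k →
    k ≤ w.count t
  even : ∀ s : Letter m n, s.val < m → ∀ k, HasRow col (segment s.val m w) k → k ≤ w.count s

theorem Plac.segment {w w' : List (Letter m n)} (h : Plac col w w') (a b : ℕ) :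
    Plac col (segment a b w) (segment a b w') := by
  refine h.filter _ (fun x y z h1 h2 hx hz => ?_) fun x y z h1 h2 hx hz => ?_
  all_goals
    rw [col_iff] at h1 h2
    simp only [decide_eq_true_eq] at hx hz ⊢
    omega

theorem Extremal.of_plac {w w' : List (Letter m n)} (h : Extremal w) (hp : Plac col w w') :
    Extremal w' where
  odd t ht k hk := by
    rw [← hp.perm.count_eq]
    exact h.odd t ht k (((hp.segment _ _).hasColumn_iff isColumnOrder_col k).2 hk)
  even s hs k hk := by
    rw [← hp.perm.count_eq]
    exact h.even s hs k (((hp.segment _ _).hasRow_iff isColumnOrder_col k).2 hk)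

/-- The biword relation for the standard order of the labels. -/
abbrev precRel : Letter m n × Letter u v → Letter m n × Letter u v → Prop :=
  pairRel (fun y y' => y < y') deg

theorem precRel_antisymm {p q : Letter m n × Letter u v} (h : precRel p q) (h' : precRel q p) :
    p = q := by
  obtain ⟨a, b⟩ := p
  obtain ⟨c, d⟩ := q
  rcases h with h | ⟨rfl, h⟩
  · rcases h' with h' | ⟨h', -⟩
    · exact absurd h' (lt_asymm h)
    · exact absurd h' (ne_of_gt h)
  · rcases h' with h' | ⟨-, h'⟩
    · exact absurd h' (lt_irrefl _)
    · simp only [Adj, Fin.lt_def, Fin.ext_iff] at h h'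
      rw [Prod.mk.injEq, Fin.ext_iff]
      exact ⟨by omega, rfl⟩

theorem sublist_of_sorted {Z W : List (Letter m n × Letter u v)} {a b : ℕ}
    (hW : W.Pairwise precRel) (hZ : Z.Pairwise precRel) (h : Z.Subperm (rowsIn a b W)) :
    Z.Sublist (W.filter (fun p => a ≤ p.1.val ∧ p.1.val < b)) := by
  have : Std.Antisymm (precRel (m := m) (n := n) (u := u) (v := v)) :=
    ⟨fun _ _ => precRel_antisymm⟩
  exact List.sublist_of_subperm_of_pairwise (h.trans (rowsIn_perm a b W).subperm) hZ (hW.filter _)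

theorem map_fst_filter (a b : ℕ) (W : List (Letter m n × Letter u v)) :
    (W.filter (fun p => a ≤ p.1.val ∧ p.1.val < b)).map Prod.fst =
      segment a b (W.map Prod.fst) := by
  rw [segment, List.filter_map]; rfl

/-- The duality behind the reconstruction. The pairs that carry a row of labels, taken backwards,
increase weakly in both entries, and the sorting rules allow a repeated first letter only if it is
odd. They therefore also occur in this order in `W`, where their first letters form a column. -/
theorem hasColumn_of_hasRow_labels {W : List (Letter m n × Letter u v)} (hW : W.Pairwise precRel)
    {a b k : ℕ} (h : HasRow col ((rowsIn a b W).map Prod.snd) k) :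
    HasColumn col (segment a b (W.map Prod.fst)) k := by
  obtain ⟨s, hs, hp, hk⟩ := h
  rw [← List.map_reverse, List.sublist_map_iff] at hs
  obtain ⟨Z, hZ, rfl⟩ := hs
  rw [List.pairwise_map] at hp
  have h1 := (List.pairwise_reverse.2 (rowsIn_pairwise hW a b)).sublist hZ
  have h2 : Z.Pairwise fun p q => col p.1 q.1 ∧ precRel p q := by
    refine (h1.and hp).imp ?_
    rintro ⟨x, y⟩ ⟨x', y'⟩ ⟨h3, h4⟩
    simp only [pairRel', labelCol, rowRel, col, precRel, pairRel, Adj, Fin.lt_def, Fin.ext_iff,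
      deg_eq_zero_iff, deg_eq_one_iff] at h3 h4 ⊢
    omega
  refine ⟨Z.map Prod.fst, ?_, ?_, by simpa using hk⟩
  · rw [← map_fst_filter]
    exact (sublist_of_sorted hW (h2.imp fun h => h.2)
      (hZ.subperm.trans (List.reverse_perm _).subperm)).map _
  · rw [List.pairwise_map]
    exact h2.imp fun h => h.1

theorem hasRow_of_hasColumn_labels {W : List (Letter m n × Letter u v)} (hW : W.Pairwise precRel)
    {a b k : ℕ} (hb : b ≤ m) (h : HasColumn col ((rowsIn a b W).map Prod.snd) k) :
    HasRow col (segment a b (W.map Prod.fst)) k := by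
  obtain ⟨s, hs, hp, hk⟩ := h
  rw [List.sublist_map_iff] at hs
  obtain ⟨Z, hZ, rfl⟩ := hs
  rw [List.pairwise_map] at hp
  have h1 := (rowsIn_pairwise hW a b).sublist hZ
  have h2 : Z.Pairwise fun p q => rowRel col q.1 p.1 ∧ precRel p q := by
    refine (h1.and hp).imp_of_mem ?_
    rintro ⟨x, y⟩ ⟨x', y'⟩ hx - ⟨h3, h4⟩
    have hx := (mem_rowsIn.1 (hZ.subset hx)).2.2
    simp only [pairRel', labelCol, rowRel, col, precRel, pairRel, Adj, Fin.lt_def, Fin.ext_iff,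
      deg_eq_zero_iff, deg_eq_one_iff] at hx h3 h4 ⊢
    omega
  refine ⟨(Z.map Prod.fst).reverse, ?_, ?_, by simpa using hk⟩
  · rw [← map_fst_filter]
    exact ((sublist_of_sorted hW (h2.imp fun h => h.2) hZ.subperm).map _).reverse
  · rw [List.pairwise_reverse, List.pairwise_map]
    exact h2.imp fun h => h.1

theorem length_labels (b : Letter m n) (W : List (Letter m n × Letter u v)) :
    (labels b W).length = (W.map Prod.fst).count b := by
  rw [labels, List.length_map, List.count, List.countP_map, ← List.countP_eq_length_filter]
  refine List.countP_congr fun p _ => ?_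
  simp

theorem labels_pairwise_odd {W : List (Letter m n × Letter u v)} (hW : W.Pairwise precRel)
    {t : Letter m n} (ht : m ≤ t.val) : (labels t W).Pairwise (rowRel col) := by
  have : ((W.filter (fun p => p.1.val = t.val)).map Prod.snd).Pairwise (rowRel col) :=
    filter_pairwise_odd hW ht
  simpa only [labels, Fin.ext_iff] using this

theorem labels_pairwise_even {W : List (Letter m n × Letter u v)} (hW : W.Pairwise precRel)
    {t : Letter m n} (ht : t.val < m) : (labels t W).Pairwise col := by
  have : ((W.filter (fun p => p.1.val = t.val)).map Prod.snd).Pairwise col :=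
    filter_pairwise_even hW ht
  simpa only [labels, Fin.ext_iff] using this

theorem rowsIn_succ_odd {t : Letter m n} (ht : m ≤ t.val) (W : List (Letter m n × Letter u v)) :
    (rowsIn 0 (t.val + 1) W).map Prod.snd =
      (labels t W).reverse ++ (rowsIn 0 t.val W).map Prod.snd := by
  rw [rowsIn_succ (Nat.zero_le _), List.map_append, rowPart_map_snd, if_neg (by omega)]

theorem rowsIn_even {s : Letter m n} (hs : s.val < m) (W : List (Letter m n × Letter u v)) :
    (rowsIn s.val m W).map Prod.snd =
      (rowsIn (s.val + 1) m W).map Prod.snd ++ labels s W := by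
  rw [rowsIn_append (Nat.le_succ s.val) (by omega), rowsIn_single, List.map_append,
    rowPart_map_snd, if_pos hs]

/-- By duality and extremality, the block of `t` is a longest row of the word of labels. It is then
a row placed on top of the tableau of the remaining word, of known length, and can be removed from
it. -/
theorem labels_eq_odd {W W' : List (Letter m n × Letter u v)} (hW : W.Pairwise precRel)
    (hW' : W'.Pairwise precRel) (hE : Extremal (W.map Prod.fst)) (hE' : Extremal (W'.map Prod.fst))
    (hc : ∀ b, (W.map Prod.fst).count b = (W'.map Prod.fst).count b)
    {t : Letter m n} (ht : m ≤ t.val)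
    (h : Plac col ((rowsIn 0 (t.val + 1) W).map Prod.snd)
      ((rowsIn 0 (t.val + 1) W').map Prod.snd)) :
    labels t W = labels t W' ∧
      Plac col ((rowsIn 0 t.val W).map Prod.snd) ((rowsIn 0 t.val W').map Prod.snd) := by
  have key : ∀ {W : List (Letter m n × Letter u v)}, W.Pairwise precRel →
      Extremal (W.map Prod.fst) → ∀ k, HasRow col
        ((labels t W).reverse ++ (rowsIn 0 t.val W).map Prod.snd) k → k ≤ (labels t W).length := by
    intro W hW hE k hk
    rw [← rowsIn_succ_odd ht] at hk
    rw [length_labels]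
    exact hE.odd t ht k (hasColumn_of_hasRow_labels hW hk)
  have h1 := P_row_append (labels_pairwise_odd hW ht) (key hW hE)
  have h2 := P_row_append (labels_pairwise_odd hW' ht) (key hW' hE')
  rw [rowsIn_succ_odd ht, rowsIn_succ_odd ht, ← P_eq_iff, h1.1, h2.1] at h
  have := addRow_inj (fun c hc => ((isTab_P _).1 c hc).2) (fun c hc => ((isTab_P _).1 c hc).2)
    (by rw [length_labels, length_labels, hc]) h1.2 h2.2 h
  exact ⟨this.1, P_eq_iff.1 this.2⟩

/-- Here the block of `s` ends the word and is a longest column, hence the first column of the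
tableau. An empty block is treated separately, since it is not a column of the filling. -/
theorem labels_eq_even {W W' : List (Letter m n × Letter u v)} (hW : W.Pairwise precRel)
    (hW' : W'.Pairwise precRel) (hE : Extremal (W.map Prod.fst)) (hE' : Extremal (W'.map Prod.fst))
    (hc : ∀ b, (W.map Prod.fst).count b = (W'.map Prod.fst).count b)
    {s : Letter m n} (hs : s.val < m)
    (h : Plac col ((rowsIn s.val m W).map Prod.snd) ((rowsIn s.val m W').map Prod.snd)) :
    labels s W = labels s W' ∧ Plac col ((rowsIn (s.val + 1) m W).map Prod.snd)
      ((rowsIn (s.val + 1) m W').map Prod.snd) := by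
  have key : ∀ {W : List (Letter m n × Letter u v)}, W.Pairwise precRel →
      Extremal (W.map Prod.fst) → ∀ k, HasColumn col
        ((rowsIn (s.val + 1) m W).map Prod.snd ++ labels s W) k → k ≤ (labels s W).length := by
    intro W hW hE k hk
    rw [← rowsIn_even hs] at hk
    rw [length_labels]
    exact hE.even s hs k (hasRow_of_hasColumn_labels hW le_rfl hk)
  have hl : (labels s W).length = (labels s W').length := by
    rw [length_labels, length_labels, hc]
  rw [rowsIn_even hs, rowsIn_even hs] at h
  by_cases h0 : labels s W = []
  · have h0' : labels s W' = [] := List.eq_nil_of_length_eq_zero (by rw [← hl, h0]; rfl)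
    rw [h0, h0', List.append_nil, List.append_nil] at h
    exact ⟨by rw [h0, h0'], h⟩
  · have h0' : labels s W' ≠ [] := fun h' => h0 (List.eq_nil_of_length_eq_zero (by rw [hl, h']; rfl))
    rw [← P_eq_iff, P_append_column (labels_pairwise_even hW hs) h0 (key hW hE),
      P_append_column (labels_pairwise_even hW' hs) h0' (key hW' hE'), List.cons.injEq] at h
    exact ⟨h.1, P_eq_iff.1 h.2⟩

/-- A biword with extremal first word is determined by the content of that word and the plactic
class of its word of labels. -/
theorem labels_eq {W W' : List (Letter m n × Letter u v)} (hW : W.Pairwise precRel)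
    (hW' : W'.Pairwise precRel) (hE : Extremal (W.map Prod.fst)) (hE' : Extremal (W'.map Prod.fst))
    (hc : ∀ b, (W.map Prod.fst).count b = (W'.map Prod.fst).count b)
    (h : Plac col ((rowsIn 0 (m + n) W).map Prod.snd) ((rowsIn 0 (m + n) W').map Prod.snd))
    (b : Letter m n) : labels b W = labels b W' := by
  -- The blocks are listed from the largest letter to the smallest. Odd blocks are removed from the
  -- front, largest letter first; what remains are the even blocks, removed from the end, smallest
  -- letter first.
  have hodd : ∀ j ≤ n, Plac col ((rowsIn 0 (m + n - j) W).map Prod.snd)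
      ((rowsIn 0 (m + n - j) W').map Prod.snd) := by
    intro j hj
    induction j with
    | zero => exact h
    | succ j ih =>
      have := (labels_eq_odd hW hW' hE hE' hc (t := ⟨m + n - (j + 1), by omega⟩)
        (by simp only; omega) (by
          simp only
          rw [show m + n - (j + 1) + 1 = m + n - j by omega]
          exact ih (by omega))).2
      exact this
  have heven : ∀ s ≤ m, Plac col ((rowsIn s m W).map Prod.snd) ((rowsIn s m W').map Prod.snd) := by
    intro s hs
    induction s with
    | zero => simpa using hodd n le_rfl
    | succ s ih =>
      exact (labels_eq_even hW hW' hE hE' hc (s := ⟨s, by omega⟩) hs (ih (by omega))).2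
  rcases lt_or_ge b.val m with hb | hb
  · exact (labels_eq_even hW hW' hE hE' hc hb (heven _ hb.le)).1
  · refine (labels_eq_odd hW hW' hE hE' hc hb ?_).1
    have := hodd (m + n - (b.val + 1)) (by omega)
    rwa [show m + n - (m + n - (b.val + 1)) = b.val + 1 by have := b.2; omega] at this

theorem countMatrix_eq_count_labels (W : List (Letter m n × Letter u v)) (b : Letter m n)
    (b' : Letter u v) : countMatrix W b b' = (labels b W).count b' := by
  rw [countMatrix, labels, List.count, List.count, List.countP_map, List.countP_filter]
  refine List.countP_congr fun p _ => ?_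
  obtain ⟨x, y⟩ := p
  simp [and_comm]

end Extremal

/-! ### Extremal tableaux of every shape -/

section ExtremalTableau

variable {m n : ℕ}

theorem Dom.lev_le {c z : List (Letter m n)} (h : Dom (fun a b => a < b) c z) (x : ℕ) :
    lev x z ≤ lev x c := by
  induction c generalizing z with
  | nil =>
    cases z with
    | nil => simp
    | cons a z => simp at h
  | cons b c ih =>
    cases z with
    | nil => simp
    | cons a z =>
      have h1 := ih h.2
      have h2 : ¬ a < b := h.1
      rw [Fin.lt_def] at h2
      rw [lev_cons, lev_cons]
      split_ifs <;> omega

theorem dom_sublist {c z : List (Letter m n)} (hc : c.Pairwise col) (hz : z.Sublist c) :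
    Dom (fun a b => a < b) c z := by
  induction c generalizing z with
  | nil => simp [List.sublist_nil.1 hz]
  | cons b c ih =>
    rw [List.pairwise_cons] at hc
    cases z with
    | nil => simp
    | cons a z =>
      cases hz with
      | cons _ hz =>
        have hb := hc.1 a (hz.subset (by simp))
        rw [col_iff] at hb
        refine ⟨?_, ih hc.2 ((List.sublist_cons_self a z).trans hz)⟩
        change ¬ a < b
        rw [Fin.lt_def]; omega
      | cons_cons _ hz => exact ⟨lt_irrefl _, ih hc.2 hz⟩

theorem dom_append_sublist {c z₁ z₂ : List (Letter m n)} (hc : c.Pairwise col)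
    (h1 : Dom col c z₁) (h2 : z₂.Sublist c) (hz : (z₁ ++ z₂).Pairwise col) :
    Dom (fun a b => a < b) c (z₁ ++ z₂) := by
  induction z₁ generalizing c with
  | nil => exact dom_sublist hc h2
  | cons a z₁ ih =>
    cases c with
    | nil => simp at h1
    | cons y c =>
      rw [List.cons_append, List.pairwise_cons] at hz
      have hay : ¬ col a y := h1.1
      refine ⟨fun h => hay (Or.inl h), ih (List.pairwise_cons.1 hc).2 h1.2 ?_ hz.2⟩
      cases h2 with
      | cons _ h => exact h
      | cons_cons _ h => exact absurd (hz.1 y (by simp)) hay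

theorem dom_of_dom_lt {c d z : List (Letter m n)} (h : Dom col c d)
    (h' : Dom (fun a b => a < b) d z) : Dom col c z := by
  induction c generalizing d z with
  | nil =>
    cases d with
    | nil => cases z with
      | nil => simp
      | cons a z => simp at h'
    | cons b d => simp at h
  | cons y c ih =>
    cases z with
    | nil => simp
    | cons a z =>
      cases d with
      | nil => simp at h'
      | cons b d =>
        refine ⟨?_, ih h.2 h'.2⟩
        have h1 := h.1
        have h2 : ¬ a < b := h'.1
        rw [col_iff] at h1 ⊢
        rw [Fin.lt_def] at h2
        omega

/-- The upper part of a column subword comes from columns further right and so, by induction, fits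
to the right of `c`; its lower part lies in `c` itself. Hence no column subword has more letters
below a threshold than the first column. -/
theorem dom_of_sublist_reading {T : Filling m n} (hT : IsTab T) {z : List (Letter m n)}
    (hz : z.Pairwise col) (h : z.Sublist (reading T)) :
    Dom (fun a b => a < b) (T.headD []) z := by
  induction T generalizing z with
  | nil => rw [List.sublist_nil.1 h]; simp
  | cons c T ih =>
    rw [isTab_cons] at hT
    rw [reading_cons, List.sublist_append_iff] at h
    obtain ⟨z₁, z₂, rfl, h1, h2⟩ := h
    exact dom_append_sublist hT.1
      (dom_of_dom_lt hT.2.2.1 (ih hT.2.2.2 (List.pairwise_append.1 hz).1 h1)) h2 hz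

theorem hasColumn_segment_le {T : Filling m n} (hT : IsTab T) {t k : ℕ}
    (h : HasColumn col (segment 0 t (reading T)) k) : k ≤ level T 0 t := by
  obtain ⟨z, hz, hp, rfl⟩ := h
  have h1 := (dom_of_sublist_reading hT hp (hz.trans List.filter_sublist)).lev_le t
  have h2 : lev t z = z.length := by
    rw [lev, List.countP_eq_length]
    intro a ha
    have := hz.subset ha
    simp only [segment, List.mem_filter, decide_eq_true_eq] at this ⊢
    omega
  have h3 : T.headD [] = T.getD 0 [] := by cases T <;> rfl
  rw [h2, h3] at h1
  exact h1

/-- A row takes at most one letter from each column, and every column that offers a letter of the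
segment contains `s`. -/
theorem hasRow_segment_le {T : Filling m n} {s : Letter m n} {b k : ℕ}
    (hT : ∀ c ∈ T, c.Pairwise col ∧ ∀ a ∈ c, s.val ≤ a.val → a.val < b → s ∈ c)
    (h : HasRow col (segment s.val b (reading T)) k) : k ≤ (reading T).count s := by
  obtain ⟨z, hz, hp, rfl⟩ := h
  induction T generalizing z with
  | nil => simpa [segment] using hz
  | cons c T ih =>
    rw [reading_cons, segment, List.filter_append, List.reverse_append,
      List.sublist_append_iff] at hz
    obtain ⟨z₁, z₂, rfl, h1, h2⟩ := hz
    rw [List.pairwise_append] at hp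
    have h3 := ih (fun c hc => hT c (by simp [hc])) z₂ h2 hp.2.1
    have hc := hT c (by simp)
    have h4 : z₁.length ≤ c.count s := by
      cases z₁ with
      | nil => simp
      | cons a z₁ =>
        have ha := h1.subset (List.mem_cons_self)
        simp only [List.mem_reverse, List.mem_filter, decide_eq_true_eq] at ha
        have := List.count_pos_iff.2 (hc.2 a ha.1 ha.2.1 ha.2.2)
        cases z₁ with
        | nil => simpa using this
        | cons a' z₁ =>
          have h5 := (List.pairwise_reverse.2 (hc.1.filter _)).sublist h1
          simp only [List.pairwise_cons, List.mem_cons, forall_eq_or_imp] at h5 hp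
          exact absurd h5.1.1 hp.1.1.1
    rw [reading_cons, List.count_append, List.length_append]
    omega

/-- Every shape carries a tableau with an extremal reading. -/
theorem exists_extremal {T : Filling m n} (hT : IsTab T) :
    ∃ T₀ : Filling m n, IsTab T₀ ∧ T₀.map List.length = T.map List.length ∧
      Extremal (reading T₀) := by
  have hL := hT.isLevel
  set h : ℕ → ℕ := fun k => level T k (m + n) with hh
  have hanti : ∀ k, h (k + 1) ≤ h k := fun k => by
    simp only [hh]
    rw [level_top, level_top]
    exact (dom_getD hT k).length_le
  have hhook : ∀ k, h (k + n) ≤ m := fun k => hL.diagonal_le k n le_rfl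
  -- The largest odd letter occupies, in each column, the boxes with no box on their right. What
  -- remains has the shape without its first column, and the next odd letter is placed in the same
  -- way. After `n` letters, the remaining shape has at most `m` rows, and its rows are filled with
  -- the even letters in order.
  set g : ℕ → ℕ → ℕ := fun k x => if m ≤ x then h (k + (m + n) - x) else min (h (k + n)) x with hg
  have g1 : ∀ k x, m ≤ x → g k x = h (k + (m + n) - x) := fun k x hx => if_pos hx
  have g2 : ∀ k x, x ≤ m → g k x = min (h (k + n)) x := fun k x hx => by
    rcases hx.lt_or_eq with hx | hx
    · exact if_neg (by omega)
    · rw [hx, g1 _ _ le_rfl, show k + (m + n) - m = k + n by omega, min_eq_left (hhook k)]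
  have hG : IsLevel m n g := by
    refine ⟨fun k => ?_, fun k x hx => ?_, fun k x hx => ?_, fun k x hx => ?_, fun k x hx hx' => ?_⟩
    · rw [g2 _ _ (Nat.zero_le _)]; simp
    · rcases le_or_gt m x with hm | hm
      · rw [g1 _ _ hm, g1 _ _ (by omega)]
        have := hanti (k + (m + n) - (x + 1))
        rwa [show k + (m + n) - (x + 1) + 1 = k + (m + n) - x by omega] at this
      · rw [g2 _ _ hm.le, g2 _ _ hm]; omega
    · rw [g2 _ _ hx.le, g2 _ _ hx]; omega
    · have := hanti (k + n)
      rw [show k + n + 1 = k + 1 + n by omega] at this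
      rw [g2 _ _ hx, g2 _ _ hx]; omega
    · rw [g1 _ _ hx, g1 _ _ (by omega), show k + 1 + (m + n) - (x + 1) = k + (m + n) - x by omega]
  obtain ⟨S, hS, hSl⟩ := hG.exists_tab T.length (fun k => by
    rw [g1 _ _ (by omega), Nat.add_sub_cancel]; exact level_pos_iff hT k)
  have htop : ∀ k, level S k (m + n) = level T k (m + n) := fun k => by
    rw [hSl _ _ le_rfl, g1 _ _ (by omega), Nat.add_sub_cancel]
  refine ⟨S, hS, length_map_eq_of_level hS hT htop, ?_, ?_⟩
  · intro t ht k hk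
    -- The counts of `t` telescope. For `k = 0` their total is the level of the first column, which
    -- bounds every column subword of letters up to `t`.
    have hcount : ∀ k, (reading (S.drop k)).count t = level S k (t.val + 1) := by
      refine drop_induction S.length (fun k hk => ?_) (fun k ih => ?_)
      · rw [List.drop_eq_nil_of_le hk, level_eq_zero_of_length_le hk]; rfl
      · rw [reading_drop, List.count_append, ih]
        have h1 := count_getD S k t
        have h2 := t.2
        rw [hSl k t.val (by omega), g1 _ _ ht] at h1
        rw [hSl (k + 1) _ (by omega), g1 _ _ (by omega)]
        rw [h1]
        congr 2
        omega
    have := hasColumn_segment_le hS hk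
    rwa [← hcount 0, List.drop_zero] at this
  · intro s hs k hk
    refine hasRow_segment_le (fun c hc => ?_) hk
    refine ⟨(hS.1 c hc).1, fun a ha h1 h2 => ?_⟩
    obtain ⟨k, hk, rfl⟩ := List.getElem_of_mem hc
    have e : S.getD k [] = S[k] := List.getD_eq_getElem _ _ hk
    have h3 := count_getD S k a
    have h4 := count_getD S k s
    rw [e] at h3 h4
    have h5 := List.count_pos_iff.2 ha
    rw [hSl _ _ (by omega), hSl _ _ (by omega), g2 _ _ (by omega), g2 _ _ (by omega)] at h3 h4
    exact List.count_pos_iff.1 (by omega)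

end ExtremalTableau

end SuperCrystal

namespace SuperCrystal

/-! ### Lifting paths of tableaux to crystals modelled on words -/

section WordModels

variable {m n : ℕ} {B γ : Type*}

/-- A crystal whose structure is pulled back from words, by a map that need not be injective; the
operators fix the value of another function. -/
structure WordModel (X : CrystalData m n B) (word : B → List (Letter m n)) (other : B → γ) :
    Prop where
  wt : ∀ b, X.wt b = (wordCrystal m n).wt (word b)
  eps : ∀ i b, X.eps i b = (wordCrystal m n).eps i (word b)
  phi : ∀ i b, X.phi i b = (wordCrystal m n).phi i (word b)
  e_map : ∀ i b, (X.e i b).map word = (wordCrystal m n).e i (word b)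
  f_map : ∀ i b, (X.f i b).map word = (wordCrystal m n).f i (word b)
  f_iff_e : ∀ i b b', X.f i b = some b' ↔ X.e i b' = some b
  other_f : ∀ i b b', X.f i b = some b' → other b' = other b

variable {X : CrystalData m n B} {word : B → List (Letter m n)} {other : B → γ}

theorem WordModel.word_e (h : WordModel X word other) {i : Node m n} {b b' : B}
    (he : X.e i b = some b') : (wordCrystal m n).e i (word b) = some (word b') := by
  rw [← h.e_map, he]; rfl

theorem WordModel.word_f (h : WordModel X word other) {i : Node m n} {b b' : B}
    (hf : X.f i b = some b') : (wordCrystal m n).f i (word b) = some (word b') := by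
  rw [← h.f_map, hf]; rfl

theorem WordModel.isCrystal (h : WordModel X word other) : X.IsCrystal where
  phi_sub_eps i b hi := by rw [h.phi, h.eps, h.wt]; exact isCrystal_word.phi_sub_eps i _ hi
  coroot_zero_nonneg i b hi := by rw [h.wt]; exact isCrystal_word.coroot_zero_nonneg i _ hi
  phi_add_eps_of_eq i b hi := by
    rw [h.phi, h.eps, h.wt]; exact isCrystal_word.phi_add_eps_of_eq i _ hi
  phi_add_eps_of_pos i b hi := by
    rw [h.phi, h.eps, h.wt]; exact isCrystal_word.phi_add_eps_of_pos i _ hi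
  eps_e i b b' hb := by rw [h.eps, h.eps]; exact isCrystal_word.eps_e i _ _ (h.word_e hb)
  phi_e i b b' hb := by rw [h.phi, h.phi]; exact isCrystal_word.phi_e i _ _ (h.word_e hb)
  wt_e i b b' hb := by rw [h.wt, h.wt]; exact isCrystal_word.wt_e i _ _ (h.word_e hb)
  eps_f i b b' hb := by rw [h.eps, h.eps]; exact isCrystal_word.eps_f i _ _ (h.word_f hb)
  phi_f i b b' hb := by rw [h.phi, h.phi]; exact isCrystal_word.phi_f i _ _ (h.word_f hb)
  wt_f i b b' hb := by rw [h.wt, h.wt]; exact isCrystal_word.wt_f i _ _ (h.word_f hb)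
  f_iff_e := h.f_iff_e

/-- The arrows of a single crystal. -/
def Step (X : CrystalData m n B) (b b' : B) : Prop := ∃ i, X.f i b = some b'

/-- `F` carries the elements over `S` to elements over `S'`, along arrows, with left inverse `G`. -/
def LiftsTo (X : CrystalData m n B) (word : B → List (Letter m n)) (other : B → γ)
    (S S' : Filling m n) (F G : B → B) : Prop :=
  ∀ b, Plac col (word b) (reading S) → Plac col (word (F b)) (reading S') ∧
    other (F b) = other b ∧ Relation.EqvGen (Step X) b (F b) ∧ G (F b) = b

/-- As the operators respect `Plac`, an arrow between tableaux can be followed from every element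
over its source, and the inverse operator leads back. Both directions are kept together because a
path may traverse arrows backwards. -/
theorem WordModel.exists_lift (h : WordModel X word other) {S S' : Filling m n}
    (hS : Linked S S') : ∃ F G : B → B, LiftsTo X word other S S' F G ∧
      LiftsTo X word other S' S G F := by
  induction hS with
  | rel S S' hS =>
    obtain ⟨i, hi⟩ := hS
    -- The default value of `getD` never matters: the operator is defined on the elements concerned.
    refine ⟨fun b => (X.f i b).getD b, fun b => (X.e i b).getD b, fun b hb => ?_, fun b hb => ?_⟩
    · have h1 := (hb.compat i).f
      rw [hi, ← h.f_map] at h1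
      cases h2 : X.f i b with
      | none => rw [h2] at h1; cases h1
      | some b' =>
        rw [h2] at h1
        have h5 : (X.f i b).getD b = b' := by rw [h2]; rfl
        simp only [h5]
        cases h1 with
        | some h1 =>
          refine ⟨h1, h.other_f i b b' h2, .rel _ _ ⟨i, h2⟩, ?_⟩
          rw [(h.f_iff_e i b b').1 h2]; rfl
    · have h1 := (hb.compat i).e
      rw [(word_f_iff_e _ _ _).1 hi, ← h.e_map] at h1
      cases h2 : X.e i b with
      | none => rw [h2] at h1; cases h1
      | some b' =>
        rw [h2] at h1
        have h5 : (X.e i b).getD b = b' := by rw [h2]; rfl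
        simp only [h5]
        have h3 := (h.f_iff_e i b' b).2 h2
        cases h1 with
        | some h1 =>
          refine ⟨h1, (h.other_f i b' b h3).symm, .symm _ _ (.rel _ _ ⟨i, h3⟩), ?_⟩
          rw [h3]; rfl
  | refl S => exact ⟨id, id, fun b hb => ⟨hb, rfl, .refl _, rfl⟩, fun b hb => ⟨hb, rfl, .refl _, rfl⟩⟩
  | symm S S' _ ih =>
    obtain ⟨F, G, h1, h2⟩ := ih
    exact ⟨G, F, h2, h1⟩
  | trans S S' S'' _ _ ih ih' =>
    obtain ⟨F, G, h1, h2⟩ := ih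
    obtain ⟨F', G', h1', h2'⟩ := ih'
    refine ⟨F' ∘ F, G ∘ G', fun b hb => ?_, fun b hb => ?_⟩
    · obtain ⟨k1, k2, k3, k4⟩ := h1 b hb
      obtain ⟨l1, l2, l3, l4⟩ := h1' _ k1
      refine ⟨l1, l2.trans k2, .trans _ _ _ k3 l3, ?_⟩
      simp only [Function.comp_apply]
      rw [l4, k4]
    · obtain ⟨k1, k2, k3, k4⟩ := h2' b hb
      obtain ⟨l1, l2, l3, l4⟩ := h2 _ k1
      refine ⟨l1, l2.trans k2, .trans _ _ _ k3 l3, ?_⟩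
      simp only [Function.comp_apply]
      rw [l4, k4]

theorem plac_reading_of_P_eq {w : List (Letter m n)} {T : Filling m n} (h : P w = T) :
    Plac col w (reading T) := h ▸ plac_reading_P w

/-- The insertion tableau is a morphism of crystals. -/
theorem tableau_wt_P (w : List (Letter m n)) :
    (tableauCrystal m n).wt (P w) = (wordCrystal m n).wt w := (plac_reading_P w).symm.wt_eq

theorem tableau_eps_P (i : Node m n) (w : List (Letter m n)) :
    (tableauCrystal m n).eps i (P w) = (wordCrystal m n).eps i w :=
  ((plac_reading_P w).compat i).eps.symm

theorem tableau_phi_P (i : Node m n) (w : List (Letter m n)) :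
    (tableauCrystal m n).phi i (P w) = (wordCrystal m n).phi i w :=
  ((plac_reading_P w).compat i).phi.symm

/-- Any tableau of the shape of the insertion tableau of an element can be reached. -/
theorem WordModel.exists_reach (h : WordModel X word other) (b : B) {T : Filling m n}
    (hT : IsTab T) (hs : (P (word b)).map List.length = T.map List.length) :
    ∃ b', P (word b') = T ∧ other b' = other b ∧ Relation.EqvGen (Step X) b b' := by
  obtain ⟨F, G, h1, -⟩ := h.exists_lift (linked_of_shape (isTab_P (word b)) hT hs)
  obtain ⟨k1, k2, k3, -⟩ := h1 b (plac_reading_P _)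
  refine ⟨F b, ?_, k2, k3⟩
  rw [P_eq_iff.2 k1, P_reading hT]

/-- To separate elements it suffices to do so over the extremal words. -/
theorem WordModel.eq_of_extremal (h : WordModel X word other)
    (hE : ∀ b b', Extremal (word b) → Plac col (word b) (word b') → other b = other b' → b = b')
    {b b' : B} (hP : P (word b) = P (word b')) (ho : other b = other b') : b = b' := by
  obtain ⟨T, hT, hs, hx⟩ := exists_extremal (isTab_P (word b))
  obtain ⟨F, G, h1, -⟩ := h.exists_lift (linked_of_shape (isTab_P (word b)) hT hs.symm)
  obtain ⟨k1, k2, -, k4⟩ := h1 b (plac_reading_P _)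
  obtain ⟨l1, l2, -, l4⟩ := h1 b' (plac_reading_of_P_eq hP.symm)
  -- Since `G` undoes `F` on both elements, it is enough to identify their images, which lie over
  -- the extremal tableau `T`.
  rw [← k4, ← l4, hE (F b) (F b') (hx.of_plac k1.symm) (k1.trans l1.symm) (k2.trans (ho.trans l2.symm))]

end WordModels

/-! ### The two words of a matrix in terms of one another -/

section Biwords

variable {m n u v : ℕ}

/-- The first word of the biword of `A` in `Ω♯`. -/
noncomputable def firstWord (A : MSharp m n u v) : List (Letter m n) :=
  ((omegaSharpEquiv m n u v).symm A).1.1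

/-- The second word of the biword of `A` in `(Ω♯)*`. -/
noncomputable def secondWord (A : MSharp m n u v) : List (Letter u v) :=
  ((omegaSharpStarEquiv m n u v).symm A).1.2

theorem pairRel_trans {β : Type*} {L : β → β → Prop} [IsStrictTotalOrder β L] {par : β → ℕ}
    {p q r : Letter m n × β} (h : pairRel L par p q) (h' : pairRel L par q r) :
    pairRel L par p r := by
  obtain ⟨a, x⟩ := p
  obtain ⟨b, y⟩ := q
  obtain ⟨c, z⟩ := r
  rcases h with h | ⟨h, k⟩
  · rcases h' with h' | ⟨h', -⟩
    · exact Or.inl (_root_.trans h h')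
    · simp only at h h'; subst h'; exact Or.inl h
  · simp only at h; subst h
    rcases h' with h' | ⟨h', k'⟩
    · exact Or.inl h'
    · refine Or.inr ⟨h', ?_⟩
      simp only [Adj, Fin.lt_def, Fin.ext_iff, deg_eq_zero_iff, deg_eq_one_iff] at k k' ⊢
      omega

theorem pairwise_of_isChain {β : Type*} {L : β → β → Prop} [IsStrictTotalOrder β L] {par : β → ℕ}
    {W : List (Letter m n × β)} (h : W.IsChain (pairRel L par)) : W.Pairwise (pairRel L par) := by
  have : IsTrans (Letter m n × β) (pairRel L par) := ⟨fun _ _ _ => pairRel_trans⟩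
  exact List.isChain_iff_pairwise.1 h

theorem omega_pairwise (p : OmegaSharp m n u v) : (p.1.1.zip p.1.2).Pairwise precRel :=
  pairwise_of_isChain ((sharpSorted_prec_iff _).1 p.2.2)

instance gt_isStrictTotalOrder : IsStrictTotalOrder (Letter m n) (fun y y' => y' < y) :=
  inferInstanceAs (IsStrictTotalOrder (Letter m n) (· > ·))

theorem omegaStar_pairwise (p : OmegaSharpStar m n u v) :
    (p.1.2.zip p.1.1).Pairwise (pairRel (fun y y' => y' < y) deg) :=
  pairwise_of_isChain ((sharpSorted_prec'_iff_zip _ _).1 p.2.2)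

theorem countMatrix_of_perm {W W' : List (Letter m n × Letter u v)} (h : W.Perm W') :
    countMatrix W = countMatrix W' := by
  funext b b'
  exact h.count_eq _

theorem rowsIn_perm_self {β : Type*} (W : List (Letter m n × β)) :
    (rowsIn 0 (m + n) W).Perm W := by
  refine (rowsIn_perm 0 (m + n) W).trans (List.Perm.of_eq ?_)
  rw [List.filter_eq_self]
  intro p _
  simp

/-- The rearranged biword is sorted for `Prec'` and has the same counts, so uniqueness of the sorted
biword identifies it. -/
theorem secondWord_eq (p : OmegaSharp m n u v) : secondWord p.matrix =
    (rowsIn 0 (m + n) (p.1.1.zip p.1.2)).map Prod.snd := by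
  set q := (omegaSharpStarEquiv m n u v).symm p.matrix with hq
  have hqm : q.matrix = p.matrix := (omegaSharpStarEquiv m n u v).apply_symm_apply p.matrix
  have h1 : SharpSorted Prec' (rowsIn 0 (m + n) (p.1.1.zip p.1.2)) := by
    rw [sharpSorted_prec'_iff]
    refine (rowsIn_pairwise (omega_pairwise p) 0 (m + n)).isChain.imp ?_
    rintro ⟨a, b⟩ ⟨c, d⟩ h
    simp only [pairRel', labelCol, Adj, Fin.lt_def, Fin.ext_iff, deg_eq_zero_iff,
      deg_eq_one_iff] at h ⊢
    omega
  have h2 := eq_of_countMatrix Prec' _ _ h1 q.2.2 (by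
    rw [countMatrix_of_perm (rowsIn_perm_self _)]
    exact congrArg Subtype.val hqm.symm)
  rw [h2, List.map_snd_zip q.2.1.ge]
  rfl

theorem zip_swap_eq {α β : Type*} (k : List α) (l : List β) :
    (l.zip k).map Prod.swap = k.zip l := List.zip_swap l k

/-- The blocks of `rowsIn` run through the letters of the second word downwards, whereas `Prec` runs
through them upwards; hence the final reversal. -/
theorem firstWord_eq (p : OmegaSharpStar m n u v) : firstWord p.matrix =
    ((rowsIn 0 (u + v) (p.1.2.zip p.1.1)).map Prod.snd).reverse := by
  set q := (omegaSharpEquiv m n u v).symm p.matrix with hq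
  have hqm : q.matrix = p.matrix := (omegaSharpEquiv m n u v).apply_symm_apply p.matrix
  set R := (rowsIn 0 (u + v) (p.1.2.zip p.1.1)) with hR
  have h1 : SharpSorted Prec (R.reverse.map Prod.swap) := by
    rw [sharpSorted_prec_iff, List.isChain_map]
    refine (List.pairwise_reverse.2 (rowsIn_pairwise (omegaStar_pairwise p) 0 (u + v))).isChain.imp
      ?_
    rintro ⟨a, b⟩ ⟨c, d⟩ h
    simp only [pairRel', labelCol, Adj, Fin.lt_def, Fin.ext_iff, deg_eq_zero_iff,
      deg_eq_one_iff, Prod.swap] at h ⊢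
    omega
  have h2 := eq_of_countMatrix Prec _ _ h1 q.2.2 (by
    have : (R.reverse.map Prod.swap).Perm (p.1.1.zip p.1.2) := by
      rw [← zip_swap_eq]
      exact ((List.reverse_perm R).trans (rowsIn_perm_self _)).map _
    rw [countMatrix_of_perm this]
    exact congrArg Subtype.val hqm.symm)
  have h3 := congrArg (List.map Prod.fst) h2
  rw [List.map_fst_zip q.2.1.le, List.map_map] at h3
  rw [← List.map_reverse]
  exact h3.symm

/-- The action of `e_i` on a biword, split at the letter that changes. -/
theorem exists_split_of_e {β : Type*} {i : Node m n} {w w' : List (Letter m n)} {ts : List β}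
    (hl : w.length = ts.length) (h : (wordCrystal m n).e i w = some w') :
    ∃ (W₁ W₂ : List (Letter m n × β)) (y : β), w.zip ts = W₁ ++ (tgt i, y) :: W₂ ∧
      w'.zip ts = W₁ ++ (src i, y) :: W₂ ∧ Acts i (W₁.map Prod.fst) (W₂.map Prod.fst) := by
  obtain ⟨a, b, rfl, rfl, hA⟩ := word_e_eq_some_iff.1 h
  obtain ⟨t₁, t₂, rfl, h1⟩ : ∃ t₁ t₂, ts = t₁ ++ t₂ ∧ t₁.length = a.length :=
    ⟨ts.take a.length, ts.drop a.length, (List.take_append_drop _ _).symm, by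
      rw [List.length_take, ← hl]; simp⟩
  rw [List.length_append, List.length_append, h1] at hl
  cases t₂ with
  | nil => simp at hl
  | cons y t₂ =>
    have h2 : b.length = t₂.length := by simpa using hl
    refine ⟨a.zip t₁, b.zip t₂, y, ?_, ?_, ?_⟩
    · rw [List.zip_append h1.symm, List.zip_cons_cons]
    · rw [List.zip_append h1.symm, List.zip_cons_cons]
    · rwa [List.map_fst_zip h1.ge, List.map_fst_zip h2.le]

theorem plac_secondWord {i : Node m n} {p q : OmegaSharp m n u v}
    (h : (wordCrystal m n).e i p.1.1 = some q.1.1) (h' : q.1.2 = p.1.2) :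
    Plac col (secondWord p.matrix) (secondWord q.matrix) := by
  obtain ⟨W₁, W₂, y, h1, h2, hA⟩ := exists_split_of_e p.2.1 h
  have hp := omega_pairwise p
  have hq := omega_pairwise q
  rw [secondWord_eq, secondWord_eq]
  rw [h'] at hq ⊢
  rw [h1] at hp ⊢
  rw [h2] at hq ⊢
  exact rowsIn_plac hA hp hq

theorem plac_firstWord {j : Node u v} {p q : OmegaSharpStar m n u v}
    (h : (wordCrystal u v).e j p.1.2 = some q.1.2) (h' : q.1.1 = p.1.1) :
    Plac col (firstWord p.matrix) (firstWord q.matrix) := by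
  obtain ⟨W₁, W₂, y, h1, h2, hA⟩ := exists_split_of_e p.2.1.symm h
  have hp := omegaStar_pairwise p
  have hq := omegaStar_pairwise q
  rw [firstWord_eq, firstWord_eq]
  rw [h'] at hq ⊢
  rw [h1] at hp ⊢
  rw [h2] at hq ⊢
  -- The labels are here the letters of the first word in the opposite order. The reversal in
  -- `firstWord_eq` converts the congruence for `flip col` into that for `col`.
  have hflip : labelCol (fun y y' : Letter m n => y' < y) deg = flip col := by
    funext a b
    simp only [labelCol, flip, col, eq_iff_iff]
    refine or_congr Iff.rfl ⟨fun h => ⟨h.1.symm, h.1 ▸ h.2⟩, fun h => ⟨h.1.symm, h.1 ▸ h.2⟩⟩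
  have := rowsIn_plac hA hp hq
  rw [hflip] at this
  exact this.reverse_of_flip

end Biwords

/-! ### The two crystals on matrices and the injectivity of π♯ -/

section Matrices

variable {m n u v : ℕ}

theorem map_pmap_eq_self {α β : Type*} {p : α → Prop} (g : ∀ a, p a → β) (k : β → α)
    (hk : ∀ a ha, k (g a ha) = a) (o : Option α) (h : ∀ a, o = some a → p a) :
    (o.pmap g h).map k = o := by
  cases o with
  | none => rfl
  | some a => simp [hk]

theorem pmap_eq_some {α β : Type*} {p : α → Prop} (g : ∀ a, p a → β) (o : Option α)
    (h : ∀ a, o = some a → p a) (b : β) :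
    o.pmap g h = some b ↔ ∃ a, ∃ ha : o = some a, g a (h a ha) = b := by
  cases o with
  | none => simp
  | some a => simp

theorem omega_e_iff {i : Node m n} {p q : OmegaSharp m n u v} :
    (omegaSharpCrystal m n u v).e i p = some q ↔
      (wordCrystal m n).e i p.1.1 = some q.1.1 ∧ q.1.2 = p.1.2 := by
  refine Iff.trans (pmap_eq_some _ _ (omegaSharp_e i p) q) ?_
  constructor
  · rintro ⟨w, hw, rfl⟩
    exact ⟨hw, rfl⟩
  · rintro ⟨h1, h2⟩
    exact ⟨_, h1, Subtype.ext (Prod.ext rfl h2.symm)⟩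

theorem omega_f_iff {i : Node m n} {p q : OmegaSharp m n u v} :
    (omegaSharpCrystal m n u v).f i p = some q ↔
      (wordCrystal m n).f i p.1.1 = some q.1.1 ∧ q.1.2 = p.1.2 := by
  refine Iff.trans (pmap_eq_some _ _ (omegaSharp_f i p) q) ?_
  constructor
  · rintro ⟨w, hw, rfl⟩
    exact ⟨hw, rfl⟩
  · rintro ⟨h1, h2⟩
    exact ⟨_, h1, Subtype.ext (Prod.ext rfl h2.symm)⟩

theorem omegaStar_e_iff {j : Node u v} {p q : OmegaSharpStar m n u v} :
    (omegaSharpStarCrystal m n u v).e j p = some q ↔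
      (wordCrystal u v).e j p.1.2 = some q.1.2 ∧ q.1.1 = p.1.1 := by
  refine Iff.trans (pmap_eq_some _ _ (omegaSharpStar_e j p) q) ?_
  constructor
  · rintro ⟨w, hw, rfl⟩
    exact ⟨hw, rfl⟩
  · rintro ⟨h1, h2⟩
    exact ⟨_, h1, Subtype.ext (Prod.ext h2.symm rfl)⟩

theorem omegaStar_f_iff {j : Node u v} {p q : OmegaSharpStar m n u v} :
    (omegaSharpStarCrystal m n u v).f j p = some q ↔
      (wordCrystal u v).f j p.1.2 = some q.1.2 ∧ q.1.1 = p.1.1 := by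
  refine Iff.trans (pmap_eq_some _ _ (omegaSharpStar_f j p) q) ?_
  constructor
  · rintro ⟨w, hw, rfl⟩
    exact ⟨hw, rfl⟩
  · rintro ⟨h1, h2⟩
    exact ⟨_, h1, Subtype.ext (Prod.ext h2.symm rfl)⟩

theorem transport_eq_some {B B' : Type*} (φ : B ≃ B') (o : Option B) (b : B') :
    o.map φ = some b ↔ o = some (φ.symm b) := by
  rw [Option.map_eq_some_iff]
  constructor
  · rintro ⟨a, h, rfl⟩
    rw [h, φ.symm_apply_apply]
  · intro h
    exact ⟨_, h, φ.apply_symm_apply b⟩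

theorem map_transport {B B' α : Type*} (φ : B ≃ B') (o : Option B) (k : B → α) :
    (o.map φ).map (fun b => k (φ.symm b)) = o.map k := by
  cases o <;> simp

/-- The operators change the second word but not its plactic class, so the invariant recorded is its
tableau. -/
theorem sharpModel : WordModel (sharpCrystal m n u v) firstWord (fun A => P (secondWord A)) := by
  have hfe : ∀ (i : Node m n) (A A' : MSharp m n u v),
      (sharpCrystal m n u v).f i A = some A' ↔ (sharpCrystal m n u v).e i A' = some A := by
    intro i A A'
    change Option.map _ _ = some A' ↔ Option.map _ _ = some A
    rw [transport_eq_some, transport_eq_some, omega_f_iff, omega_e_iff, word_f_iff_e]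
    exact and_congr_right fun _ => eq_comm
  refine ⟨fun _ => rfl, fun _ _ => rfl, fun _ _ => rfl, fun i A => ?_, fun i A => ?_, hfe, ?_⟩
  · change Option.map (fun b => ((omegaSharpEquiv m n u v).symm b).1.1) (Option.map _ _) = _
    rw [map_transport (omegaSharpEquiv m n u v) _ fun p => p.1.1]
    exact map_pmap_eq_self _ _ (fun _ _ => rfl) _ _
  · change Option.map (fun b => ((omegaSharpEquiv m n u v).symm b).1.1) (Option.map _ _) = _
    rw [map_transport (omegaSharpEquiv m n u v) _ fun p => p.1.1]
    exact map_pmap_eq_self _ _ (fun _ _ => rfl) _ _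
  · intro i A A' h
    rw [hfe] at h
    change Option.map _ _ = some A at h
    rw [transport_eq_some, omega_e_iff] at h
    have := plac_secondWord h.1 h.2
    have hA : ∀ A : MSharp m n u v, ((omegaSharpEquiv m n u v).symm A).matrix = A :=
      (omegaSharpEquiv m n u v).apply_symm_apply
    rw [hA, hA] at this
    exact P_eq_iff.2 this

theorem sharpStarModel :
    WordModel (sharpStarCrystal m n u v) secondWord (fun A => P (firstWord A)) := by
  have hfe : ∀ (j : Node u v) (A A' : MSharp m n u v),
      (sharpStarCrystal m n u v).f j A = some A' ↔ (sharpStarCrystal m n u v).e j A' = some A := by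
    intro i A A'
    change Option.map _ _ = some A' ↔ Option.map _ _ = some A
    rw [transport_eq_some, transport_eq_some, omegaStar_f_iff, omegaStar_e_iff, word_f_iff_e]
    exact and_congr_right fun _ => eq_comm
  refine ⟨fun _ => rfl, fun _ _ => rfl, fun _ _ => rfl, fun i A => ?_, fun i A => ?_, hfe, ?_⟩
  · change Option.map (fun b => ((omegaSharpStarEquiv m n u v).symm b).1.2) (Option.map _ _) = _
    rw [map_transport (omegaSharpStarEquiv m n u v) _ fun p => p.1.2]
    exact map_pmap_eq_self _ _ (fun _ _ => rfl) _ _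
  · change Option.map (fun b => ((omegaSharpStarEquiv m n u v).symm b).1.2) (Option.map _ _) = _
    rw [map_transport (omegaSharpStarEquiv m n u v) _ fun p => p.1.2]
    exact map_pmap_eq_self _ _ (fun _ _ => rfl) _ _
  · intro i A A' h
    rw [hfe] at h
    change Option.map _ _ = some A at h
    rw [transport_eq_some, omegaStar_e_iff] at h
    have := plac_firstWord h.1 h.2
    have hA : ∀ A : MSharp m n u v, ((omegaSharpStarEquiv m n u v).symm A).matrix = A :=
      (omegaSharpStarEquiv m n u v).apply_symm_apply
    rw [hA, hA] at this
    exact P_eq_iff.2 this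

theorem eq_of_extremal_firstWord {A A' : MSharp m n u v} (hE : Extremal (firstWord A))
    (h : Plac col (firstWord A) (firstWord A')) (h' : P (secondWord A) = P (secondWord A')) :
    A = A' := by
  set p := (omegaSharpEquiv m n u v).symm A with hp
  set q := (omegaSharpEquiv m n u v).symm A' with hq
  have hpm : p.matrix = A := (omegaSharpEquiv m n u v).apply_symm_apply A
  have hqm : q.matrix = A' := (omegaSharpEquiv m n u v).apply_symm_apply A'
  have e1 : (p.1.1.zip p.1.2).map Prod.fst = firstWord A := List.map_fst_zip p.2.1.le
  have e2 : (q.1.1.zip q.1.2).map Prod.fst = firstWord A' := List.map_fst_zip q.2.1.le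
  rw [P_eq_iff, ← hpm, ← hqm, secondWord_eq, secondWord_eq] at h'
  have := labels_eq (omega_pairwise p) (omega_pairwise q) (e1 ▸ hE) (e2 ▸ hE.of_plac h)
    (fun b => by rw [e1, e2, h.perm.count_eq]) h'
  rw [← hpm, ← hqm]
  refine Subtype.ext ?_
  funext b b'
  change countMatrix _ b b' = countMatrix _ b b'
  rw [countMatrix_eq_count_labels, countMatrix_eq_count_labels, this]

theorem piSharp_injective : Function.Injective (piSharp (m := m) (n := n) (u := u) (v := v)) := by
  intro A A' h
  exact sharpModel.eq_of_extremal (fun _ _ => eq_of_extremal_firstWord) (congrArg Prod.fst h)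
    (congrArg Prod.snd h)

end Matrices

/-! ### Commutation of the operators and the components -/

section Equivariance

variable {m n u v : ℕ}

theorem WordModel.tableau_e {B γ : Type*} {X : CrystalData m n B} {word : B → List (Letter m n)}
    {other : B → γ} (h : WordModel X word other) (i : Node m n) (b : B) :
    (tableauCrystal m n).e i (P (word b)) = (X.e i b).map (fun b' => P (word b')) := by
  rw [tableau_e_P, ← h.e_map, Option.map_map]; rfl

theorem WordModel.tableau_f {B γ : Type*} {X : CrystalData m n B} {word : B → List (Letter m n)}
    {other : B → γ} (h : WordModel X word other) (i : Node m n) (b : B) :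
    (tableauCrystal m n).f i (P (word b)) = (X.f i b).map (fun b' => P (word b')) := by
  rw [tableau_f_P, ← h.f_map, Option.map_map]; rfl

theorem WordModel.other_e {B γ : Type*} {X : CrystalData m n B} {word : B → List (Letter m n)}
    {other : B → γ} (h : WordModel X word other) {i : Node m n} {b b' : B}
    (he : X.e i b = some b') : other b' = other b :=
  (h.other_f i b' b ((h.f_iff_e i b' b).2 he)).symm

theorem piSharp_e (i : Node m n) (A : MSharp m n u v) :
    ((tableauCrystal m n).onFst (Filling u v)).e i (piSharp A) =
      ((sharpCrystal m n u v).e i A).map piSharp := by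
  change ((tableauCrystal m n).e i (P (firstWord A))).map (fun b => (b, P (secondWord A))) = _
  rw [sharpModel.tableau_e, Option.map_map]
  refine Option.map_congr fun A' hA' => ?_
  exact Prod.ext rfl (sharpModel.other_e hA').symm

theorem piSharp_f (i : Node m n) (A : MSharp m n u v) :
    ((tableauCrystal m n).onFst (Filling u v)).f i (piSharp A) =
      ((sharpCrystal m n u v).f i A).map piSharp := by
  change ((tableauCrystal m n).f i (P (firstWord A))).map (fun b => (b, P (secondWord A))) = _
  rw [sharpModel.tableau_f, Option.map_map]
  refine Option.map_congr fun A' hA' => ?_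
  exact Prod.ext rfl (sharpModel.other_f i A A' hA').symm

theorem piSharp_star_e (j : Node u v) (A : MSharp m n u v) :
    (CrystalData.onSnd (Filling m n) (tableauCrystal u v)).e j (piSharp A) =
      ((sharpStarCrystal m n u v).e j A).map piSharp := by
  change ((tableauCrystal u v).e j (P (secondWord A))).map (fun b => (P (firstWord A), b)) = _
  rw [sharpStarModel.tableau_e, Option.map_map]
  refine Option.map_congr fun A' hA' => ?_
  exact Prod.ext (sharpStarModel.other_e hA').symm rfl

theorem piSharp_star_f (j : Node u v) (A : MSharp m n u v) :
    (CrystalData.onSnd (Filling m n) (tableauCrystal u v)).f j (piSharp A) =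
      ((sharpStarCrystal m n u v).f j A).map piSharp := by
  change ((tableauCrystal u v).f j (P (secondWord A))).map (fun b => (P (firstWord A), b)) = _
  rw [sharpStarModel.tableau_f, Option.map_map]
  refine Option.map_congr fun A' hA' => ?_
  exact Prod.ext (sharpStarModel.other_f j A A' hA').symm rfl

/-- Commutation is never computed on matrices. It is obvious on the product of fillings and is
pulled back along the injective map π♯. -/
theorem partialCommute_of_injective {B B' : Type*} {ψ : B → B'} (hψ : Function.Injective ψ)
    {p q : B → Option B} {p' q' : B' → Option B'} (hp : ∀ b, p' (ψ b) = (p b).map ψ)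
    (hq : ∀ b, q' (ψ b) = (q b).map ψ) (h : PartialCommute p' q') : PartialCommute p q := by
  intro b
  apply Option.map_injective hψ
  have h1 := h (ψ b)
  rw [hp, hq, Option.bind_map, Option.bind_map] at h1
  rw [Option.map_bind, Option.map_bind]
  have e1 : q' ∘ ψ = fun b => (q b).map ψ := funext hq
  have e2 : p' ∘ ψ = fun b => (p b).map ψ := funext hp
  rw [e1, e2] at h1
  exact h1

theorem partialCommute_prod {B B' : Type*} (p : B → Option B) (q : B' → Option B') :
    PartialCommute (fun x : B × B' => (p x.1).map fun b => (b, x.2))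
      (fun x : B × B' => (q x.2).map fun b => (x.1, b)) := by
  rintro ⟨a, b⟩
  simp only
  cases h1 : p a <;> cases h2 : q b <;> simp [h1, h2]

theorem isBicrystal_sharp :
    IsBicrystal (sharpCrystal m n u v) (sharpStarCrystal m n u v) where
  fst := sharpModel.isCrystal
  snd := sharpStarModel.isCrystal
  e_e i j := partialCommute_of_injective piSharp_injective (piSharp_e i) (piSharp_star_e j)
    (partialCommute_prod _ _)
  e_f i j := partialCommute_of_injective piSharp_injective (piSharp_e i) (piSharp_star_f j)
    (partialCommute_prod _ _)
  f_e i j := partialCommute_of_injective piSharp_injective (piSharp_f i) (piSharp_star_e j)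
    (partialCommute_prod _ _)
  f_f i j := partialCommute_of_injective piSharp_injective (piSharp_f i) (piSharp_star_f j)
    (partialCommute_prod _ _)

theorem WordModel.shape_f {B γ : Type*} {X : CrystalData m n B} {word : B → List (Letter m n)}
    {other : B → γ} (h : WordModel X word other) {i : Node m n} {b b' : B}
    (hf : X.f i b = some b') : (P (word b')).map List.length = (P (word b)).map List.length :=
  shape_P_f (h.word_f hf)

theorem shapes_of_connected {A A' : MSharp m n u v}
    (h : Relation.EqvGen (Arrow (sharpCrystal m n u v) (sharpStarCrystal m n u v)) A A') :
    (P (firstWord A)).map List.length = (P (firstWord A')).map List.length ∧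
      (P (secondWord A)).map List.length = (P (secondWord A')).map List.length := by
  induction h with
  | rel A A' h =>
    rcases h with ⟨i, h⟩ | ⟨j, h⟩
    · exact ⟨(sharpModel.shape_f h).symm, by rw [← sharpModel.other_f i A A' h]⟩
    · exact ⟨by rw [← sharpStarModel.other_f j A A' h], (sharpStarModel.shape_f h).symm⟩
  | refl A => exact ⟨rfl, rfl⟩
  | symm A A' _ ih => exact ⟨ih.1.symm, ih.2.symm⟩
  | trans A A' A'' _ _ ih ih' => exact ⟨ih.1.trans ih'.1, ih.2.trans ih'.2⟩

theorem bijOn_piSharp (A : MSharp m n u v) {lam mu : YoungDiagram}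
    (hl : (P (firstWord A)).map List.length = lam.transpose.rowLens)
    (hm : (P (secondWord A)).map List.length = mu.transpose.rowLens) :
    Set.BijOn piSharp
      {A' | Relation.EqvGen (Arrow (sharpCrystal m n u v) (sharpStarCrystal m n u v)) A A'}
      (hookTableaux m n lam ×ˢ hookTableaux u v mu) := by
  refine ⟨fun A' hA' => ?_, piSharp_injective.injOn, ?_⟩
  · have h := shapes_of_connected hA'
    exact ⟨isHookTableau_iff.2 ⟨isTab_P _, h.1.symm.trans hl⟩,
      isHookTableau_iff.2 ⟨isTab_P _, h.2.symm.trans hm⟩⟩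
  · rintro ⟨T, U⟩ ⟨hT, hU⟩
    have hT := isHookTableau_iff.1 hT
    have hU := isHookTableau_iff.1 hU
    -- The first crystal moves the first tableau to `T` and keeps the second; the second crystal
    -- then moves the second tableau to `U` and keeps `T`.
    obtain ⟨B, h1, h2, h3⟩ := sharpModel.exists_reach A hT.1 (hl.trans hT.2.symm)
    obtain ⟨C, k1, k2, k3⟩ := sharpStarModel.exists_reach B hU.1
      ((congrArg (List.map List.length) h2).trans (hm.trans hU.2.symm))
    refine ⟨C, .trans _ _ _ (h3.mono fun _ _ h => Or.inl h) (k3.mono fun _ _ h => Or.inr h), ?_⟩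
    exact Prod.ext (k2.trans h1) k1

end Equivariance

end SuperCrystal

theorem proposition4p1 (m n u v : ℕ) (hmn : 0 < m + n) (huv : 0 < u + v) :
    SuperCrystal.IsBicrystal (SuperCrystal.sharpCrystal m n u v)
      (SuperCrystal.sharpStarCrystal m n u v) ∧
    ∀ C : Set (SuperCrystal.MSharp m n u v),
      SuperCrystal.IsComponent (SuperCrystal.sharpCrystal m n u v)
        (SuperCrystal.sharpStarCrystal m n u v) C →
      ∃ lam mu : YoungDiagram, SuperCrystal.IsHook m n lam ∧ SuperCrystal.IsHook u v mu ∧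
        SuperCrystal.IsCrystalIso (SuperCrystal.sharpCrystal m n u v)
          ((SuperCrystal.tableauCrystal m n).onFst (SuperCrystal.Filling u v)) C
          (SuperCrystal.hookTableaux m n lam ×ˢ SuperCrystal.hookTableaux u v mu)
          SuperCrystal.piSharp ∧
        SuperCrystal.IsCrystalIso (SuperCrystal.sharpStarCrystal m n u v)
          (SuperCrystal.CrystalData.onSnd (SuperCrystal.Filling m n)
            (SuperCrystal.tableauCrystal u v)) C
          (SuperCrystal.hookTableaux m n lam ×ˢ SuperCrystal.hookTableaux u v mu)
          SuperCrystal.piSharp := by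
  refine ⟨SuperCrystal.isBicrystal_sharp, ?_⟩
  rintro C ⟨A, rfl⟩
  obtain ⟨lam, hlam, hl⟩ := (SuperCrystal.isTab_P (SuperCrystal.firstWord A)).exists_isHook
  obtain ⟨mu, hmu, hm⟩ := (SuperCrystal.isTab_P (SuperCrystal.secondWord A)).exists_isHook
  have hbij := SuperCrystal.bijOn_piSharp A hl hm
  refine ⟨lam, mu, hlam, hmu, ⟨hbij, ?_, ?_, ?_, ?_, ?_⟩, ⟨hbij, ?_, ?_, ?_, ?_, ?_⟩⟩
  · exact fun A' _ => SuperCrystal.tableau_wt_P (SuperCrystal.firstWord A')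
  · exact fun i A' _ => SuperCrystal.tableau_eps_P i (SuperCrystal.firstWord A')
  · exact fun i A' _ => SuperCrystal.tableau_phi_P i (SuperCrystal.firstWord A')
  · exact fun i A' _ => SuperCrystal.piSharp_e i A'
  · exact fun i A' _ => SuperCrystal.piSharp_f i A'
  · exact fun A' _ => SuperCrystal.tableau_wt_P (SuperCrystal.secondWord A')
  · exact fun i A' _ => SuperCrystal.tableau_eps_P i (SuperCrystal.secondWord A')
  · exact fun i A' _ => SuperCrystal.tableau_phi_P i (SuperCrystal.secondWord A')
  · exact fun j A' _ => SuperCrystal.piSharp_star_e j A'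
  · exact fun j A' _ => SuperCrystal.piSharp_star_f j A'
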